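/- Let $(\mathcal M,\phi,\xi,\eta,g)$ be a smooth three-dimensional almost paracontact metric manifold: $\phi^2=\mathrm{Id}-\eta\otimes\xi$, $\eta(\xi)=1$, $g(\phi X,\phi Y)=-g(X,Y)+\eta(X)\eta(Y)$, with $g$ pseudo-Riemannian of signature $(2,1)$. Let $\Phi(X,Y)=g(X,\phi Y)$ and $h=\tfrac12\mathcal L_\xi\phi$. The manifold is almost paracosymplectic if $d\eta=0$ and $d\Phi=0$. It is a $(\kappa,\mu)$-space, $\kappa,\mu\in\mathbb R$, if the curvature $R(X,Y)=[\nabla_X,\nabla_Y]-\nabla_{[X,Y]}$ of the Levi-Civita connection satisfies $$R(X,Y)\xi=\kappa(\eta(Y)X-\eta(X)Y)+\mu(\eta(Y)hX-\eta(X)hY).$$ A local frame $(\xi,E_1,E_2)$ is an Artin frame if $\phi E_1=E_1$, $\phi E_2=-E_2$, $g(\xi,E_1)=g(\xi,E_2)=0$ and $g(E_1,E_2)=1$. (i) Let $\mathcal M$ be a three-dimensional almost paracosymplectic $(\kappa,\mu)$-space and $p\in\mathcal M$. If $\kappa=0$, assume also that there is a vector field $X$ near $p$ with $\phi X=X$ and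 $hX\neq0$ at $p$. Then on a neighbourhood of $p$ there are an Artin frame $(\xi,E_1,E_2)$, a number $\varepsilon\in\{1,-1\}$ and a smooth function $b$ such that $$[E_1,E_2]=-bE_2,\qquad [\xi,E_1]=-\tfrac{\mu}{2}E_1+\varepsilon E_2,\qquad [\xi,E_2]=-\varepsilon\kappa E_1+\tfrac{\mu}{2}E_2,$$ and $b=0$ if $\kappa\ne0$. (ii) Let $\kappa\neq0$ and $F=(-\mu/2)^2/\kappa$, and let $G$ be the connected simply connected Lie group $\mathbb R\ltimes\mathbb R^2$ in which $t\in\mathbb R$ acts on $\mathbb R^2$ - by the rotations $\begin{pmatrix}\cos t&-\sin t\\ \sin t&\cos t\end{pmatrix}$ (the universal cover of $E(2)$) if $0<F<1$, or $F=0$ and $\kappa>0$; - by the boosts $\begin{pmatrix}\cosh t&\sinh t\\ \sinh t&\cosh t\end{pmatrix}$ (the group $E(1,1)$) if $F<0$, or $F>1$, or $F=0$ and $\kappa<0$; - by the shears $\begin{pmatrix}1&t\\0&1\end{pmatrix}$ (the Heisenberg group) if $F=1$. For each $\varepsilon=\pm1$ the group $G$ carries a left-invariant almost paracosymplectic $(\kappa,\mu)$-structure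 with a left-invariant Artin frame satisfying the commutators of (i) with $b=0$. Every three-dimensional almost paracosymplectic $(\kappa,\mu)$-space $\mathcal M$ is locally modelled on $G$: each point of $\mathcal M$ has a neighbourhood with a diffeomorphism onto an open subset of $G$ that carries $(\phi,\xi,\eta,g)$ to such a left-invariant structure, for some $\varepsilon=\pm1$. -/

import Mathlib

open scoped Manifold ContDiff Bundle

noncomputable section

/-! ### Exterior derivatives, Levi-Civita connection, curvature -/

section Calculus

variable {E : Type*} [NormedAddCommGroup E] [NormedSpace ℝ E]
  {M : Type*} [TopologicalSpace M] [ChartedSpace E M] [IsManifold 𝓘(ℝ, E) ∞ M]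

/-- `dα(X, Y) = X α(Y) - Y α(X) - α([X, Y])` for a `1`-form `α`. -/
def extDerivOneForm (α : Π x : M, TangentSpace 𝓘(ℝ, E) x →L[ℝ] ℝ)
    (X Y : Π x : M, TangentSpace 𝓘(ℝ, E) x) (p : M) : ℝ :=
  mvfderiv 𝓘(ℝ, E) (fun q : M => α q (Y q)) p (X p)
    - mvfderiv 𝓘(ℝ, E) (fun q : M => α q (X q)) p (Y p)
    - α p (VectorField.mlieBracket 𝓘(ℝ, E) X Y p)

/-- `dα(X, Y, Z)` for a `2`-form `α`: the cyclic sum of `X α(Y, Z) - α([X, Y], Z)`. -/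
def extDerivTwoForm (α : Π x : M, TangentSpace 𝓘(ℝ, E) x → TangentSpace 𝓘(ℝ, E) x → ℝ)
    (X Y Z : Π x : M, TangentSpace 𝓘(ℝ, E) x) (p : M) : ℝ :=
  mvfderiv 𝓘(ℝ, E) (fun q : M => α q (Y q) (Z q)) p (X p)
    + mvfderiv 𝓘(ℝ, E) (fun q : M => α q (Z q) (X q)) p (Y p)
    + mvfderiv 𝓘(ℝ, E) (fun q : M => α q (X q) (Y q)) p (Z p)
    - α p (VectorField.mlieBracket 𝓘(ℝ, E) X Y p) (Z p)
    - α p (VectorField.mlieBracket 𝓘(ℝ, E) Y Z p) (X p)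
    - α p (VectorField.mlieBracket 𝓘(ℝ, E) Z X p) (Y p)

/-- The connection `∇` (with `∇_X Y = (nabla Y) X`) is the Levi-Civita connection of the
pseudo-Riemannian metric `g`: it is torsion free and compatible with `g`. -/
structure IsLeviCivita
    (g : Π x : M, TangentSpace 𝓘(ℝ, E) x →L[ℝ] TangentSpace 𝓘(ℝ, E) x →L[ℝ] ℝ)
    (nabla : CovariantDerivative 𝓘(ℝ, E) E (TangentSpace 𝓘(ℝ, E) : M → Type _)) : Prop where
  torsion_free : ∀ (X Y : Π x : M, TangentSpace 𝓘(ℝ, E) x) (p : M),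
    MDiffAt (T% X) p → MDiffAt (T% Y) p →
      nabla Y p (X p) - nabla X p (Y p) = VectorField.mlieBracket 𝓘(ℝ, E) X Y p
  metric : ∀ (X Y Z : Π x : M, TangentSpace 𝓘(ℝ, E) x) (p : M),
    MDiffAt (T% X) p → MDiffAt (T% Y) p → MDiffAt (T% Z) p →
      mvfderiv 𝓘(ℝ, E) (fun q : M => g q (Y q) (Z q)) p (X p)
        = g p (nabla Y p (X p)) (Z p) + g p (Y p) (nabla Z p (X p))

/-- `R(X, Y) Z = ∇_X ∇_Y Z - ∇_Y ∇_X Z - ∇_[X, Y] Z`. -/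
def curvatureOp
    (nabla : CovariantDerivative 𝓘(ℝ, E) E (TangentSpace 𝓘(ℝ, E) : M → Type _))
    (X Y Z : Π x : M, TangentSpace 𝓘(ℝ, E) x) (p : M) : TangentSpace 𝓘(ℝ, E) p :=
  nabla (fun q => nabla Z q (Y q)) p (X p) - nabla (fun q => nabla Z q (X q)) p (Y p)
    - nabla Z p (VectorField.mlieBracket 𝓘(ℝ, E) X Y p)

end Calculus

/-! ### Almost paracontact metric structures in dimension three -/

/-- A smooth almost paracontact metric structure `(φ, ξ, η, g)` on a three-dimensional manifold:
`g` is a pseudo-Riemannian metric of signature `(2, 1)`. -/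
structure AlmostParacontactMetric (E : Type*) [NormedAddCommGroup E] [NormedSpace ℝ E]
    (M : Type*) [TopologicalSpace M] [ChartedSpace E M] [IsManifold 𝓘(ℝ, E) ∞ M] where
  phi : Π x : M, TangentSpace 𝓘(ℝ, E) x →L[ℝ] TangentSpace 𝓘(ℝ, E) x
  xi : Π x : M, TangentSpace 𝓘(ℝ, E) x
  eta : Π x : M, TangentSpace 𝓘(ℝ, E) x →L[ℝ] ℝ
  g : Π x : M, TangentSpace 𝓘(ℝ, E) x →L[ℝ] TangentSpace 𝓘(ℝ, E) x →L[ℝ] ℝ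
  smooth_phi : ContMDiff 𝓘(ℝ, E) (𝓘(ℝ, E).prod 𝓘(ℝ, E →L[ℝ] E)) ∞
    (fun x => Bundle.TotalSpace.mk' (E →L[ℝ] E)
      (E := fun x : M => TangentSpace 𝓘(ℝ, E) x →L[ℝ] TangentSpace 𝓘(ℝ, E) x) x (phi x))
  smooth_xi : ContMDiff 𝓘(ℝ, E) (𝓘(ℝ, E).prod 𝓘(ℝ, E)) ∞
    (fun x => Bundle.TotalSpace.mk' E (E := fun x : M => TangentSpace 𝓘(ℝ, E) x) x (xi x))
  smooth_eta : ContMDiff 𝓘(ℝ, E) (𝓘(ℝ, E).prod 𝓘(ℝ, E →L[ℝ] ℝ)) ∞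
    (fun x => Bundle.TotalSpace.mk' (E →L[ℝ] ℝ)
      (E := fun x : M => TangentSpace 𝓘(ℝ, E) x →L[ℝ] ℝ) x (eta x))
  smooth_g : ContMDiff 𝓘(ℝ, E) (𝓘(ℝ, E).prod 𝓘(ℝ, E →L[ℝ] E →L[ℝ] ℝ)) ∞
    (fun x => Bundle.TotalSpace.mk' (E →L[ℝ] E →L[ℝ] ℝ)
      (E := fun x : M => TangentSpace 𝓘(ℝ, E) x →L[ℝ] TangentSpace 𝓘(ℝ, E) x →L[ℝ] ℝ) x (g x))
  g_symm : ∀ (x : M) (v w : TangentSpace 𝓘(ℝ, E) x), g x v w = g x w v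
  g_signature : ∀ x : M, ∃ e : Module.Basis (Fin 3) ℝ (TangentSpace 𝓘(ℝ, E) x),
    ∀ i j, g x (e i) (e j) = Matrix.diagonal ![(1 : ℝ), 1, -1] i j
  phi_sq : ∀ (x : M) (v : TangentSpace 𝓘(ℝ, E) x), phi x (phi x v) = v - eta x v • xi x
  eta_xi : ∀ x : M, eta x (xi x) = 1
  g_phi : ∀ (x : M) (v w : TangentSpace 𝓘(ℝ, E) x),
    g x (phi x v) (phi x w) = - g x v w + eta x v * eta x w

namespace AlmostParacontactMetric

variable {E : Type*} [NormedAddCommGroup E] [NormedSpace ℝ E]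
  {M : Type*} [TopologicalSpace M] [ChartedSpace E M] [IsManifold 𝓘(ℝ, E) ∞ M]

/-- The fundamental form `Φ(v, w) = g(v, φ w)`. -/
def fundamentalForm (S : AlmostParacontactMetric E M) (x : M)
    (v w : TangentSpace 𝓘(ℝ, E) x) : ℝ :=
  S.g x v (S.phi x w)

/-- The tensor field `h = (1/2) L_ξ φ` applied to a vector field `X`, that is,
`h X = (1/2) ([ξ, φ X] - φ [ξ, X])`. -/
def hTensor (S : AlmostParacontactMetric E M) (X : Π x : M, TangentSpace 𝓘(ℝ, E) x) (p : M) :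
    TangentSpace 𝓘(ℝ, E) p :=
  (1 / 2 : ℝ) • (VectorField.mlieBracket 𝓘(ℝ, E) S.xi (fun q => S.phi q (X q)) p
    - S.phi p (VectorField.mlieBracket 𝓘(ℝ, E) S.xi X p))

/-- `dη = 0` and `dΦ = 0`, tested on local smooth vector fields. -/
def IsAlmostParacosymplectic (S : AlmostParacontactMetric E M) : Prop :=
  ∀ (U : Set M) (X Y Z : Π x : M, TangentSpace 𝓘(ℝ, E) x), IsOpen U →
    CMDiff[U] ∞ (T% X) → CMDiff[U] ∞ (T% Y) → CMDiff[U] ∞ (T% Z) → ∀ p ∈ U,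
      extDerivOneForm S.eta X Y p = 0 ∧ extDerivTwoForm S.fundamentalForm X Y Z p = 0

/-- The `(κ, μ)`-condition: the curvature of the Levi-Civita connection of `g` satisfies
`R(X, Y) ξ = κ (η(Y) X - η(X) Y) + μ (η(Y) h X - η(X) h Y)` for all local smooth vector
fields. -/
def IsKappaMuSpace (S : AlmostParacontactMetric E M) (κ μ : ℝ) : Prop :=
  ∃ nabla : CovariantDerivative 𝓘(ℝ, E) E (TangentSpace 𝓘(ℝ, E) : M → Type _),
    IsLeviCivita S.g nabla ∧
    ∀ (U : Set M) (X Y : Π x : M, TangentSpace 𝓘(ℝ, E) x), IsOpen U →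
      CMDiff[U] ∞ (T% X) → CMDiff[U] ∞ (T% Y) → ∀ p ∈ U,
        curvatureOp nabla X Y S.xi p
          = κ • (S.eta p (Y p) • X p - S.eta p (X p) • Y p)
            + μ • (S.eta p (Y p) • S.hTensor X p - S.eta p (X p) • S.hTensor Y p)

/-- `(ξ, E₁, E₂)` is an Artin frame on `U`. -/
structure IsArtinFrameOn (S : AlmostParacontactMetric E M)
    (E₁ E₂ : Π x : M, TangentSpace 𝓘(ℝ, E) x) (U : Set M) : Prop where
  frame : IsLocalFrameOn 𝓘(ℝ, E) E ∞ ![S.xi, E₁, E₂] U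
  phi_one : ∀ q ∈ U, S.phi q (E₁ q) = E₁ q
  phi_two : ∀ q ∈ U, S.phi q (E₂ q) = - E₂ q
  g_xi_one : ∀ q ∈ U, S.g q (S.xi q) (E₁ q) = 0
  g_xi_two : ∀ q ∈ U, S.g q (S.xi q) (E₂ q) = 0
  g_one_two : ∀ q ∈ U, S.g q (E₁ q) (E₂ q) = 1

/-- The commutators `[E₁, E₂] = -b E₂`, `[ξ, E₁] = -(μ/2) E₁ + ε E₂`,
`[ξ, E₂] = -ε κ E₁ + (μ/2) E₂` on `U`. -/
structure HasCommutatorsOn (S : AlmostParacontactMetric E M)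
    (E₁ E₂ : Π x : M, TangentSpace 𝓘(ℝ, E) x) (U : Set M) (κ μ ε : ℝ) (b : M → ℝ) : Prop where
  one_two : ∀ q ∈ U, VectorField.mlieBracket 𝓘(ℝ, E) E₁ E₂ q = -(b q) • E₂ q
  xi_one : ∀ q ∈ U, VectorField.mlieBracket 𝓘(ℝ, E) S.xi E₁ q
    = -(μ / 2) • E₁ q + ε • E₂ q
  xi_two : ∀ q ∈ U, VectorField.mlieBracket 𝓘(ℝ, E) S.xi E₂ q
    = -(ε * κ) • E₁ q + (μ / 2) • E₂ q

/-- There is a vector field `X` near `p` with `φ X = X` and `h X ≠ 0` at `p`. -/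
def HasNonzeroHOnPlusAt (S : AlmostParacontactMetric E M) (p : M) : Prop :=
  ∃ (U : Set M) (X : Π x : M, TangentSpace 𝓘(ℝ, E) x), IsOpen U ∧ p ∈ U ∧
    CMDiff[U] ∞ (T% X) ∧ (∀ q ∈ U, S.phi q (X q) = X q) ∧ S.hTensor X p ≠ 0

/-- The differential of `f` at `x` carries `(φ, ξ, η, g)` to `(φ', ξ', η', g')`. -/
structure PreservedAt {E' : Type*} [NormedAddCommGroup E'] [NormedSpace ℝ E']
    {M' : Type*} [TopologicalSpace M'] [ChartedSpace E' M'] [IsManifold 𝓘(ℝ, E') ∞ M']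
    (S : AlmostParacontactMetric E M) (S' : AlmostParacontactMetric E' M')
    (f : M → M') (x : M) : Prop where
  phi : ∀ v : TangentSpace 𝓘(ℝ, E) x, mfderiv 𝓘(ℝ, E) 𝓘(ℝ, E') f x (S.phi x v)
    = S'.phi (f x) (mfderiv 𝓘(ℝ, E) 𝓘(ℝ, E') f x v)
  xi : mfderiv 𝓘(ℝ, E) 𝓘(ℝ, E') f x (S.xi x) = S'.xi (f x)
  eta : ∀ v : TangentSpace 𝓘(ℝ, E) x,
    S'.eta (f x) (mfderiv 𝓘(ℝ, E) 𝓘(ℝ, E') f x v) = S.eta x v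
  g : ∀ v w : TangentSpace 𝓘(ℝ, E) x,
    S'.g (f x) (mfderiv 𝓘(ℝ, E) 𝓘(ℝ, E') f x v) (mfderiv 𝓘(ℝ, E) 𝓘(ℝ, E') f x w) = S.g x v w

end AlmostParacontactMetric

/-! ### The semidirect products `ℝ ⋉ ℝ²` -/

/-- A smooth one-parameter group of linear maps of the plane. -/
structure PlaneFlow where
  map : ℝ → (ℝ × ℝ →L[ℝ] ℝ × ℝ)
  smooth : ContDiff ℝ ∞ map
  map_zero : ∀ v, map 0 v = v
  map_add : ∀ s t v, map (s + t) v = map s (map t v)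

/-- The linear map of the plane with matrix `!![a, b; c, d]`. -/
def planeMap (a b c d : ℝ) : ℝ × ℝ →L[ℝ] ℝ × ℝ :=
  (a • ContinuousLinearMap.fst ℝ ℝ ℝ + b • ContinuousLinearMap.snd ℝ ℝ ℝ).prod
    (c • ContinuousLinearMap.fst ℝ ℝ ℝ + d • ContinuousLinearMap.snd ℝ ℝ ℝ)

@[simp] theorem planeMap_apply (a b c d : ℝ) (v : ℝ × ℝ) :
    planeMap a b c d v = (a * v.1 + b * v.2, c * v.1 + d * v.2) := by
  simp [planeMap]

theorem contDiff_planeMap {a b c d : ℝ → ℝ} (ha : ContDiff ℝ ∞ a) (hb : ContDiff ℝ ∞ b)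
    (hc : ContDiff ℝ ∞ c) (hd : ContDiff ℝ ∞ d) :
    ContDiff ℝ ∞ (fun t => planeMap (a t) (b t) (c t) (d t)) := by
  rw [contDiff_clm_apply_iff]
  intro v
  simp only [planeMap_apply]
  fun_prop

/-- Rotations of the Euclidean plane. -/
def rotationFlow : PlaneFlow where
  map t := planeMap (Real.cos t) (-Real.sin t) (Real.sin t) (Real.cos t)
  smooth := contDiff_planeMap Real.contDiff_cos Real.contDiff_sin.neg Real.contDiff_sin
    Real.contDiff_cos
  map_zero v := by simp
  map_add s t v := by
    simp only [planeMap_apply, Real.cos_add, Real.sin_add, Prod.mk.injEq]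
    constructor <;> ring

/-- Boosts of the Minkowski plane. -/
def boostFlow : PlaneFlow where
  map t := planeMap (Real.cosh t) (Real.sinh t) (Real.sinh t) (Real.cosh t)
  smooth := contDiff_planeMap Real.contDiff_cosh Real.contDiff_sinh Real.contDiff_sinh
    Real.contDiff_cosh
  map_zero v := by simp
  map_add s t v := by
    simp only [planeMap_apply, Real.cosh_add, Real.sinh_add, Prod.mk.injEq]
    constructor <;> ring

/-- Shears of the plane. -/
def shearFlow : PlaneFlow where
  map t := planeMap 1 t 0 1
  smooth := contDiff_planeMap contDiff_const contDiff_id contDiff_const contDiff_const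
  map_zero v := by simp
  map_add s t v := by
    simp only [planeMap_apply, Prod.mk.injEq]
    constructor <;> ring

/-- The connected, simply connected Lie group `ℝ ⋉ ℝ²` determined by a one-parameter group `A`:
the manifold `ℝ × ℝ²` with `(s, v) (t, w) = (s + t, v + A(s) w)`. -/
def FlowGroup (_A : PlaneFlow) : Type := ℝ × (ℝ × ℝ)

namespace FlowGroup

variable (A : PlaneFlow)

instance : TopologicalSpace (FlowGroup A) := inferInstanceAs (TopologicalSpace (ℝ × (ℝ × ℝ)))

instance : ChartedSpace (ℝ × (ℝ × ℝ)) (FlowGroup A) := chartedSpaceSelf (ℝ × (ℝ × ℝ))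

instance : IsManifold 𝓘(ℝ, ℝ × (ℝ × ℝ)) ∞ (FlowGroup A) :=
  instIsManifoldModelSpace (I := 𝓘(ℝ, ℝ × (ℝ × ℝ)))

instance : Group (FlowGroup A) where
  mul x y := (x.1 + y.1, x.2 + A.map x.1 y.2)
  one := (0, 0)
  inv x := (-x.1, -(A.map (-x.1) x.2))
  mul_assoc x y z := by
    change ((x.1 + y.1) + z.1, (x.2 + A.map x.1 y.2) + A.map (x.1 + y.1) z.2)
      = (x.1 + (y.1 + z.1), x.2 + A.map x.1 (y.2 + A.map y.1 z.2))
    rw [A.map_add, map_add, add_assoc, add_assoc]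
  one_mul x := by
    change ((0 : ℝ) + x.1, (0 : ℝ × ℝ) + A.map 0 x.2) = x
    rw [A.map_zero, zero_add, zero_add]
    rfl
  mul_one x := by
    change (x.1 + (0 : ℝ), x.2 + A.map x.1 0) = x
    rw [map_zero, add_zero, add_zero]
    rfl
  inv_mul_cancel x := by
    change (-x.1 + x.1, -(A.map (-x.1) x.2) + A.map (-x.1) x.2) = ((0 : ℝ), (0 : ℝ × ℝ))
    rw [neg_add_cancel, neg_add_cancel]

instance : LieGroup 𝓘(ℝ, ℝ × (ℝ × ℝ)) ∞ (FlowGroup A) where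
  contMDiff_mul := by
    have h : ContDiff ℝ ∞ (fun p : (ℝ × (ℝ × ℝ)) × (ℝ × (ℝ × ℝ)) =>
        (p.1.1 + p.2.1, p.1.2 + A.map p.1.1 p.2.2)) := by
      have := A.smooth
      fun_prop
    have h' := h.contMDiff
    rw [modelWithCornersSelf_prod, ← chartedSpaceSelf_prod] at h'
    exact h'
  contMDiff_inv := by
    have h : ContDiff ℝ ∞ (fun p : ℝ × (ℝ × ℝ) => (-p.1, -(A.map (-p.1) p.2))) := by
      have := A.smooth
      fun_prop
    exact h.contMDiff

end FlowGroup

/-- The universal cover of the group `E(2)` of rigid motions of the Euclidean plane. -/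
abbrev EuclideanMotionGroup : Type := FlowGroup rotationFlow

/-- The group `E(1,1)` of rigid motions of the Minkowski plane (its identity component). -/
abbrev MinkowskiMotionGroup : Type := FlowGroup boostFlow

/-- The three-dimensional Heisenberg group. -/
abbrev HeisenbergLieGroup : Type := FlowGroup shearFlow

/-! ### Left-invariant models -/

/-- `S` is a left-invariant almost paracosymplectic `(κ, μ)`-structure on `ℝ ⋉ ℝ²` with a
left-invariant Artin frame `(ξ, E₁, E₂)` such that `[E₁, E₂] = 0`,
`[ξ, E₁] = -(μ/2) E₁ + ε E₂` and `[ξ, E₂] = -ε κ E₁ + (μ/2) E₂`. -/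
structure IsLieGroupModel {A : PlaneFlow}
    (S : AlmostParacontactMetric (ℝ × (ℝ × ℝ)) (FlowGroup A)) (κ μ ε : ℝ) : Prop where
  left_invariant : ∀ a x : FlowGroup A, S.PreservedAt S (fun y => a * y) x
  almost_paracosymplectic : S.IsAlmostParacosymplectic
  kappa_mu : S.IsKappaMuSpace κ μ
  frame : ∃ u v : GroupLieAlgebra 𝓘(ℝ, ℝ × (ℝ × ℝ)) (FlowGroup A),
    S.IsArtinFrameOn (mulInvariantVectorField u) (mulInvariantVectorField v) Set.univ ∧
    S.HasCommutatorsOn (mulInvariantVectorField u) (mulInvariantVectorField v) Set.univ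
      κ μ ε (fun _ => 0)

/-- Near `p`, the almost paracontact metric manifold `M` is isomorphic to an open part of the
Lie group `ℝ ⋉ ℝ²` with a left-invariant model structure. -/
def IsLocallyModelledAt {E : Type*} [NormedAddCommGroup E] [NormedSpace ℝ E]
    {M : Type*} [TopologicalSpace M] [ChartedSpace E M] [IsManifold 𝓘(ℝ, E) ∞ M]
    (S : AlmostParacontactMetric E M) (A : PlaneFlow) (κ μ : ℝ) (p : M) : Prop :=
  ∃ (ε : ℝ) (S₀ : AlmostParacontactMetric (ℝ × (ℝ × ℝ)) (FlowGroup A))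
    (ψ : PartialDiffeomorph 𝓘(ℝ, E) 𝓘(ℝ, ℝ × (ℝ × ℝ)) M (FlowGroup A) ∞),
    (ε = 1 ∨ ε = -1) ∧ IsLieGroupModel S₀ κ μ ε ∧ p ∈ ψ.source ∧
      ∀ x ∈ ψ.source, S.PreservedAt S₀ ψ x

/-- The invariant `F = (-μ/2)² / κ`, meaningful for `κ ≠ 0`. -/
def invariantF (κ μ : ℝ) : ℝ := (-μ / 2) ^ 2 / κ

end

/-! In an Artin frame dη = 0 removes the ξ-component of every bracket, since η is constant on the
frame, and dΦ(ξ, E₁, E₂) = 0 makes ad ξ trace-free on span(E₁, E₂). Hence, for some functions, [ξ,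
E₁] = aE₁ + cE₂, [ξ, E₂] = dE₁ − aE₂, [E₁, E₂] = αE₁ + βE₂. The Levi-Civita connection is linear in
these functions (`nabla_frame`), and the (κ, μ)-condition becomes (`structure_equations`) cd = −κ,
ξc = (2a + μ)c, ξd = −(2a + μ)d, E₁d = 2βd, E₂c = −2αc.

Since hE₁ = cE₂, either cd = −κ ≠ 0 or the extra assumption gives c ≠ 0 at p. Replacing (E₁, E₂) by
(f⁻¹E₁, fE₂) with f² = |c| makes c = ε = ±1. The equations then force a = −μ/2, d = −εκ and α = 0,
and also β = 0 when κ ≠ 0. This is (i), with b = −β.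

For κ ≠ 0 the frame thus has the structure constants of ℝ ⋉ ℝ² with ad ξ acting by D = `kappaMuMap κ
μ ε`. This D is not scalar and D² = ((μ/2)² − κ)·1, so it is conjugate to a nonzero multiple λB of
the generator B of rotations, boosts or shears, according to the sign of (μ/2)² − κ
(`exists_conj_kappaMuMap`); the conditions on F encode this sign. If P conjugates D to λB and A is
the flow of B, two applications of the Poincaré lemma give functions s and x with ds = λη and dx =
A(s)P(θ¹, θ²), where (η, θ¹, θ²) is the dual coframe. The map (s, x) is a local diffeomorphism
carrying the frame to a left-invariant one (`exists_openPartialHomeomorph_of_frame`). A map matching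
Artin frames matches all four tensors.

Conversely, the left-invariant coframe on the group satisfies the Maurer–Cartan equation
(`PlaneFlow.fderiv_coframe_sub`), from which the closedness of η and Φ, the connection and the
curvature follow by algebra in the Lie algebra. -/

noncomputable section

/-! ### Pointwise algebra of φ, ξ, η, g -/

namespace AlmostParacontactMetric

variable {E : Type*} [NormedAddCommGroup E] [NormedSpace ℝ E]
  {M : Type*} [TopologicalSpace M] [ChartedSpace E M] [IsManifold 𝓘(ℝ, E) ∞ M]
  (S : AlmostParacontactMetric E M)

theorem xi_ne_zero (x : M) : S.xi x ≠ 0 := fun h => by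
  simpa [h] using S.eta_xi x

/-- φ²ξ = 0, so the formula for φ² at φξ shows that φξ is a multiple cξ; then c²ξ = φ²ξ = 0. -/
theorem phi_xi (x : M) : S.phi x (S.xi x) = 0 := by
  have h1 : S.phi x (S.phi x (S.xi x)) = 0 := by
    rw [S.phi_sq, S.eta_xi, one_smul, sub_self]
  have h2 := S.phi_sq x (S.phi x (S.xi x))
  rw [h1, map_zero] at h2
  set c := S.eta x (S.phi x (S.xi x)) with hc
  have h3 : S.phi x (S.xi x) = c • S.xi x := (sub_eq_zero.mp h2.symm)
  have h4 := h1
  rw [h3, map_smul, h3, smul_smul] at h4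
  have h5 : c * c = 0 := (smul_eq_zero.mp h4).resolve_right (S.xi_ne_zero x)
  rw [h3, mul_self_eq_zero.mp h5, zero_smul]

theorem g_xi (x : M) (v : TangentSpace 𝓘(ℝ, E) x) : S.g x (S.xi x) v = S.eta x v := by
  have h := S.g_phi x (S.xi x) v
  rw [S.phi_xi, map_zero, S.eta_xi] at h
  simp only [zero_apply, one_mul] at h
  linarith

theorem g_xi_right (x : M) (v : TangentSpace 𝓘(ℝ, E) x) : S.g x v (S.xi x) = S.eta x v := by
  rw [S.g_symm, S.g_xi]

theorem eta_phi (x : M) (v : TangentSpace 𝓘(ℝ, E) x) : S.eta x (S.phi x v) = 0 := by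
  have h1 := S.phi_sq x (S.phi x v)
  rw [S.phi_sq x v, map_sub, map_smul, S.phi_xi, smul_zero, sub_zero] at h1
  have h2 : S.eta x (S.phi x v) • S.xi x = 0 := by
    have := congrArg (fun w => S.phi x v - w) h1
    simpa using this.symm
  exact (smul_eq_zero.mp h2).resolve_right (S.xi_ne_zero x)

theorem g_phi_left (x : M) (v w : TangentSpace 𝓘(ℝ, E) x) :
    S.g x (S.phi x v) w = - S.g x v (S.phi x w) := by
  have h := S.g_phi x v (S.phi x w)
  rw [S.phi_sq, S.eta_phi, mul_zero, map_sub, map_smul, S.g_xi_right, S.eta_phi] at h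
  simpa using h

theorem g_phi_self (x : M) (v : TangentSpace 𝓘(ℝ, E) x) : S.g x v (S.phi x v) = 0 := by
  have h := S.g_phi_left x v v
  rw [S.g_symm] at h
  linarith

variable {S} {n : ℕ∞ω}

theorem contMDiffAt_phi {X : Π x : M, TangentSpace 𝓘(ℝ, E) x} {p : M}
    (hX : CMDiffAt ∞ (T% X) p) : CMDiffAt ∞ (T% (fun q => S.phi q (X q))) p :=
  ContMDiffAt.clm_bundle_apply (S.smooth_phi p) hX

theorem contMDiffAt_g {X Y : Π x : M, TangentSpace 𝓘(ℝ, E) x} {p : M}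
    (hX : CMDiffAt ∞ (T% X) p) (hY : CMDiffAt ∞ (T% Y) p) :
    CMDiffAt ∞ (fun q => S.g q (X q) (Y q)) p := by
  have h := ContMDiffAt.clm_bundle_apply₂ (E₃ := Bundle.Trivial M ℝ) (S.smooth_g p) hX hY
  simp only [Bundle.contMDiffAt_totalSpace] at h
  exact h.2

end AlmostParacontactMetric

/-! ### Structure functions and coordinates in an Artin frame -/

namespace AlmostParacontactMetric

open VectorField Filter Topology

section

variable {E : Type*} [NormedAddCommGroup E] [NormedSpace ℝ E]
  {M : Type*} [TopologicalSpace M] [ChartedSpace E M]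

theorem mvfderiv_eq_zero_of_eventually_const {f : M → ℝ} {c : ℝ} {p : M}
    (h : ∀ᶠ q in 𝓝 p, f q = c) : mvfderiv 𝓘(ℝ, E) f p = 0 := by
  have h1 : HasMFDerivAt 𝓘(ℝ, E) 𝓘(ℝ, ℝ) f p 0 :=
    (hasMFDerivAt_const c p).congr_of_eventuallyEq h
  simp [mvfderiv, h1.mfderiv]

variable [IsManifold 𝓘(ℝ, E) ∞ M]

instance isManifold_minSmoothness_two : IsManifold 𝓘(ℝ, E) (minSmoothness ℝ 2) M := by
  rw [minSmoothness_of_isRCLikeNormedField]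
  infer_instance

instance isManifold_minSmoothness_three : IsManifold 𝓘(ℝ, E) (minSmoothness ℝ 3) M := by
  rw [minSmoothness_of_isRCLikeNormedField]
  exact IsManifold.of_le (n := ∞) (WithTop.coe_le_coe.2 (le_top : (3 : ℕ∞) ≤ ⊤))

theorem contMDiffAt_mlieBracket [CompleteSpace E] {X Y : Π x : M, TangentSpace 𝓘(ℝ, E) x} {p : M}
    (hX : CMDiffAt ∞ (T% X) p) (hY : CMDiffAt ∞ (T% Y) p) :
    CMDiffAt ∞ (T% (mlieBracket 𝓘(ℝ, E) X Y)) p := by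
  have : IsManifold 𝓘(ℝ, E) (((⊤ : ℕ∞) : ℕ∞ω) + 1) M := inferInstanceAs (IsManifold 𝓘(ℝ, E) ∞ M)
  exact ContMDiffAt.mlieBracket_vectorField (m := ⊤) (n := ⊤) hX hY (by simp)

end

variable {E : Type*} [NormedAddCommGroup E] [NormedSpace ℝ E]
  {M : Type*} [TopologicalSpace M] [ChartedSpace E M] [IsManifold 𝓘(ℝ, E) ∞ M]
  {S : AlmostParacontactMetric E M}

/-- The frame coefficient `g([X, Y], Z)`. -/
def bracketCoeff (S : AlmostParacontactMetric E M) (X Y Z : Π x : M, TangentSpace 𝓘(ℝ, E) x)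
    (q : M) : ℝ := S.g q (mlieBracket 𝓘(ℝ, E) X Y q) (Z q)

theorem contMDiffAt_bracketCoeff [CompleteSpace E] {X Y Z : Π x : M, TangentSpace 𝓘(ℝ, E) x}
    {p : M} (hX : CMDiffAt ∞ (T% X) p) (hY : CMDiffAt ∞ (T% Y) p) (hZ : CMDiffAt ∞ (T% Z) p) :
    CMDiffAt ∞ (S.bracketCoeff X Y Z) p :=
  contMDiffAt_g (contMDiffAt_mlieBracket hX hY) hZ

variable {E₁ E₂ : Π x : M, TangentSpace 𝓘(ℝ, E) x} {U : Set M}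

namespace IsArtinFrameOn

variable (hF : S.IsArtinFrameOn E₁ E₂ U) {q : M} (hq : q ∈ U)
include hF hq

theorem g_one_one : S.g q (E₁ q) (E₁ q) = 0 := by
  have := S.g_phi_self q (E₁ q)
  rwa [hF.phi_one q hq] at this

theorem g_two_two : S.g q (E₂ q) (E₂ q) = 0 := by
  have := S.g_phi_self q (E₂ q)
  rw [hF.phi_two q hq, map_neg] at this
  linarith

theorem eta_one : S.eta q (E₁ q) = 0 := by rw [← S.g_xi]; exact hF.g_xi_one q hq

theorem eta_two : S.eta q (E₂ q) = 0 := by rw [← S.g_xi]; exact hF.g_xi_two q hq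

theorem g_two_one : S.g q (E₂ q) (E₁ q) = 1 := by rw [S.g_symm]; exact hF.g_one_two q hq

/-- E₁ and E₂ are null and g(E₁, E₂) = 1, so the coefficient along either one is the pairing with
the other. -/
theorem expand (v : TangentSpace 𝓘(ℝ, E) q) :
    v = S.eta q v • S.xi q + S.g q v (E₂ q) • E₁ q + S.g q v (E₁ q) • E₂ q := by
  obtain ⟨c, rfl⟩ := (Submodule.mem_span_range_iff_exists_fun ℝ).mp
    (hF.frame.generating hq (Submodule.mem_top (x := v)))
  simp only [Fin.sum_univ_three, Matrix.cons_val_zero, Matrix.cons_val_one, Matrix.cons_val,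
    map_add, map_smul, add_apply, smul_apply, smul_eq_mul, S.eta_xi, hF.eta_one hq, hF.eta_two hq,
    S.g_xi, hF.g_one_two q hq, hF.g_two_one hq, hF.g_one_one hq, hF.g_two_two hq]
  simp

theorem ext_pairing {v w : TangentSpace 𝓘(ℝ, E) q} (h0 : S.eta q v = S.eta q w)
    (h1 : S.g q v (E₁ q) = S.g q w (E₁ q)) (h2 : S.g q v (E₂ q) = S.g q w (E₂ q)) : v = w := by
  rw [hF.expand hq v, hF.expand hq w, h0, h1, h2]

omit hq in
theorem contMDiffAt_one (hU : U ∈ 𝓝 q) : CMDiffAt ∞ (T% E₁) q :=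
  (hF.frame.contMDiffOn 1).contMDiffAt hU

omit hq in
theorem contMDiffAt_two (hU : U ∈ 𝓝 q) : CMDiffAt ∞ (T% E₂) q :=
  (hF.frame.contMDiffOn 2).contMDiffAt hU

end IsArtinFrameOn

end AlmostParacontactMetric

/-! ### Brackets and h under dη = 0 and dΦ = 0 -/

namespace AlmostParacontactMetric

open VectorField Filter Topology

variable {E : Type*} [NormedAddCommGroup E] [NormedSpace ℝ E]
  {M : Type*} [TopologicalSpace M] [ChartedSpace E M] [IsManifold 𝓘(ℝ, E) ∞ M]
  {S : AlmostParacontactMetric E M}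

/-- In dη(X, Y) the terms Xη(Y) and Yη(X) differentiate constants, so only −η([X, Y]) is left. -/
theorem IsAlmostParacosymplectic.eta_mlieBracket (hS : S.IsAlmostParacosymplectic) {U : Set M}
    (hU : IsOpen U) {X Y : Π x : M, TangentSpace 𝓘(ℝ, E) x} (hX : CMDiff[U] ∞ (T% X))
    (hY : CMDiff[U] ∞ (T% Y)) {a b : ℝ} (ha : ∀ q ∈ U, S.eta q (X q) = a)
    (hb : ∀ q ∈ U, S.eta q (Y q) = b) {p : M} (hp : p ∈ U) :
    S.eta p (mlieBracket 𝓘(ℝ, E) X Y p) = 0 := by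
  have h := (hS U X Y X hU hX hY hX p hp).1
  rw [extDerivOneForm,
    mvfderiv_eq_zero_of_eventually_const (eventually_of_mem (hU.mem_nhds hp) ha),
    mvfderiv_eq_zero_of_eventually_const (eventually_of_mem (hU.mem_nhds hp) hb)] at h
  simpa using h

variable {E₁ E₂ : Π x : M, TangentSpace 𝓘(ℝ, E) x} {U : Set M}

namespace IsArtinFrameOn

variable (hF : S.IsArtinFrameOn E₁ E₂ U) (hU : IsOpen U) (hS : S.IsAlmostParacosymplectic)
  {q : M} (hq : q ∈ U)
include hF hU hS hq

theorem eta_xi_one : S.eta q (mlieBracket 𝓘(ℝ, E) S.xi E₁ q) = 0 :=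
  hS.eta_mlieBracket hU S.smooth_xi.contMDiffOn (hF.frame.contMDiffOn 1)
    (fun q _ => S.eta_xi q) (fun _ hq => hF.eta_one hq) hq

theorem eta_xi_two : S.eta q (mlieBracket 𝓘(ℝ, E) S.xi E₂ q) = 0 :=
  hS.eta_mlieBracket hU S.smooth_xi.contMDiffOn (hF.frame.contMDiffOn 2)
    (fun q _ => S.eta_xi q) (fun _ hq => hF.eta_two hq) hq

theorem eta_one_two : S.eta q (mlieBracket 𝓘(ℝ, E) E₁ E₂ q) = 0 :=
  hS.eta_mlieBracket hU (hF.frame.contMDiffOn 1) (hF.frame.contMDiffOn 2)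
    (fun _ hq => hF.eta_one hq) (fun _ hq => hF.eta_two hq) hq

/-- Φ is constant on the frame, so dΦ(ξ, E₁, E₂) = 0 contains bracket terms only, and the one with
[E₁, E₂] drops out because φξ = 0. The outcome is that ad ξ is trace-free on span(E₁, E₂). -/
theorem bracketCoeff_xi_two_one :
    S.bracketCoeff S.xi E₂ E₁ q = - S.bracketCoeff S.xi E₁ E₂ q := by
  have h := (hS U S.xi E₁ E₂ hU S.smooth_xi.contMDiffOn (hF.frame.contMDiffOn 1)
    (hF.frame.contMDiffOn 2) q hq).2
  have h1 : ∀ᶠ x in 𝓝 q, S.fundamentalForm x (E₁ x) (E₂ x) = -1 :=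
    eventually_of_mem (hU.mem_nhds hq) fun x hx => by
      rw [fundamentalForm, hF.phi_two x hx, map_neg, hF.g_one_two x hx]
  have h2 : ∀ᶠ x in 𝓝 q, S.fundamentalForm x (E₂ x) (S.xi x) = 0 :=
    Eventually.of_forall fun x => by rw [fundamentalForm, S.phi_xi, map_zero]
  have h3 : ∀ᶠ x in 𝓝 q, S.fundamentalForm x (S.xi x) (E₁ x) = 0 :=
    Eventually.of_forall fun x => by rw [fundamentalForm, S.g_xi, S.eta_phi]
  rw [extDerivTwoForm, mvfderiv_eq_zero_of_eventually_const h1,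
    mvfderiv_eq_zero_of_eventually_const h2, mvfderiv_eq_zero_of_eventually_const h3,
    mlieBracket_swap_apply (V := E₂) (W := S.xi)] at h
  simp only [fundamentalForm, hF.phi_one q hq, hF.phi_two q hq, S.phi_xi, map_neg, map_zero,
    neg_apply, zero_apply] at h
  rw [bracketCoeff, bracketCoeff]
  linarith

theorem mlieBracket_xi_one : mlieBracket 𝓘(ℝ, E) S.xi E₁ q
    = S.bracketCoeff S.xi E₁ E₂ q • E₁ q + S.bracketCoeff S.xi E₁ E₁ q • E₂ q := by
  conv_lhs => rw [hF.expand hq (mlieBracket 𝓘(ℝ, E) S.xi E₁ q), hF.eta_xi_one hU hS hq]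
  rw [zero_smul, zero_add]; rfl

theorem mlieBracket_xi_two : mlieBracket 𝓘(ℝ, E) S.xi E₂ q
    = S.bracketCoeff S.xi E₂ E₂ q • E₁ q - S.bracketCoeff S.xi E₁ E₂ q • E₂ q := by
  conv_lhs => rw [hF.expand hq (mlieBracket 𝓘(ℝ, E) S.xi E₂ q), hF.eta_xi_two hU hS hq]
  rw [zero_smul, zero_add, sub_eq_add_neg, ← neg_smul, ← hF.bracketCoeff_xi_two_one hU hS hq]; rfl

theorem mlieBracket_one_two : mlieBracket 𝓘(ℝ, E) E₁ E₂ q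
    = S.bracketCoeff E₁ E₂ E₂ q • E₁ q + S.bracketCoeff E₁ E₂ E₁ q • E₂ q := by
  conv_lhs => rw [hF.expand hq (mlieBracket 𝓘(ℝ, E) E₁ E₂ q), hF.eta_one_two hU hS hq]
  rw [zero_smul, zero_add]; rfl

/-- As φE₁ = E₁ near the point, hE₁ = ½(1 − φ)[ξ, E₁], which keeps only the E₂-component. In the
same way hE₂ = −½(1 + φ)[ξ, E₂] keeps only the E₁-component. -/
theorem hTensor_one : S.hTensor E₁ q = S.bracketCoeff S.xi E₁ E₁ q • E₂ q := by
  have h : (fun x => S.phi x (E₁ x)) =ᶠ[𝓝 q] E₁ :=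
    eventually_of_mem (hU.mem_nhds hq) hF.phi_one
  rw [hTensor, (EventuallyEq.refl _ S.xi).mlieBracket_vectorField_eq h,
    hF.mlieBracket_xi_one hU hS hq, map_add, map_smul, map_smul, hF.phi_one q hq, hF.phi_two q hq]
  module

theorem hTensor_two [CompleteSpace E] : S.hTensor E₂ q = -S.bracketCoeff S.xi E₂ E₂ q • E₁ q := by
  have h : (fun x => S.phi x (E₂ x)) =ᶠ[𝓝 q] (fun _ : M => (-1 : ℝ)) • E₂ :=
    eventually_of_mem (hU.mem_nhds hq) fun x hx => by
      change S.phi x (E₂ x) = (-1 : ℝ) • E₂ x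
      rw [neg_one_smul, hF.phi_two x hx]
  have h2 : mlieBracket 𝓘(ℝ, E) S.xi ((fun _ : M => (-1 : ℝ)) • E₂) q
      = -mlieBracket 𝓘(ℝ, E) S.xi E₂ q := by
    rw [mlieBracket_smul_right mdifferentiableAt_const
      ((hF.contMDiffAt_two (hU.mem_nhds hq)).mdifferentiableAt (by simp)), mvfderiv_const]
    simp
  rw [hTensor, (EventuallyEq.refl _ S.xi).mlieBracket_vectorField_eq h, h2,
    hF.mlieBracket_xi_two hU hS hq, map_sub, map_smul, map_smul, hF.phi_one q hq, hF.phi_two q hq]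
  module

end IsArtinFrameOn

theorem hTensor_xi (S : AlmostParacontactMetric E M) (q : M) : S.hTensor S.xi q = 0 := by
  have h : (fun x => S.phi x (S.xi x)) = 0 := funext fun x => S.phi_xi x
  rw [hTensor, h, mlieBracket_zero_right, mlieBracket_self]
  simp

end AlmostParacontactMetric

/-! ### The Levi-Civita connection in an Artin frame -/

namespace IsLeviCivita

variable {E : Type*} [NormedAddCommGroup E] [NormedSpace ℝ E]
  {M : Type*} [TopologicalSpace M] [ChartedSpace E M] [IsManifold 𝓘(ℝ, E) ∞ M]
  {g : Π x : M, TangentSpace 𝓘(ℝ, E) x →L[ℝ] TangentSpace 𝓘(ℝ, E) x →L[ℝ] ℝ}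
  {nabla : CovariantDerivative 𝓘(ℝ, E) E (TangentSpace 𝓘(ℝ, E) : M → Type _)}
  (hL : IsLeviCivita g nabla) {X Y Z : Π x : M, TangentSpace 𝓘(ℝ, E) x} {q : M}
include hL

theorem pairing_sub (hX : CMDiffAt ∞ (T% X) q) (hY : CMDiffAt ∞ (T% Y) q)
    (v : TangentSpace 𝓘(ℝ, E) q) : g q (nabla Y q (X q)) v - g q (nabla X q (Y q)) v
      = g q (VectorField.mlieBracket 𝓘(ℝ, E) X Y q) v := by
  rw [← hL.torsion_free X Y q (hX.mdifferentiableAt (by simp)) (hY.mdifferentiableAt (by simp)),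
    map_sub, sub_apply]

theorem pairing_add (hX : CMDiffAt ∞ (T% X) q) (hY : CMDiffAt ∞ (T% Y) q)
    (hZ : CMDiffAt ∞ (T% Z) q) {c : ℝ} (hc : ∀ᶠ x in nhds q, g x (Y x) (Z x) = c) :
    g q (nabla Y q (X q)) (Z q) + g q (Y q) (nabla Z q (X q)) = 0 := by
  rw [← hL.metric X Y Z q (hX.mdifferentiableAt (by simp)) (hY.mdifferentiableAt (by simp))
    (hZ.mdifferentiableAt (by simp)),
    AlmostParacontactMetric.mvfderiv_eq_zero_of_eventually_const hc, zero_apply]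

end IsLeviCivita

namespace AlmostParacontactMetric

open VectorField Filter Topology

variable {E : Type*} [NormedAddCommGroup E] [NormedSpace ℝ E]
  {M : Type*} [TopologicalSpace M] [ChartedSpace E M] [IsManifold 𝓘(ℝ, E) ∞ M]
  {S : AlmostParacontactMetric E M} {E₁ E₂ : Π x : M, TangentSpace 𝓘(ℝ, E) x} {U : Set M}

namespace IsArtinFrameOn

variable (hF : S.IsArtinFrameOn E₁ E₂ U) (hU : IsOpen U) (hS : S.IsAlmostParacosymplectic)
  {nabla : CovariantDerivative 𝓘(ℝ, E) E (TangentSpace 𝓘(ℝ, E) : M → Type _)}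
  (hL : IsLeviCivita S.g nabla) {q : M} (hq : q ∈ U)
include hF hU hL hq

/-- The covariant derivatives of an Artin frame satisfy the differentiated orthogonality
relations. -/
theorem pairing_add {X : Π x : M, TangentSpace 𝓘(ℝ, E) x} (hX : CMDiffAt ∞ (T% X) q) :
    S.eta q (nabla S.xi q (X q)) = 0 ∧
    S.g q (nabla E₁ q (X q)) (E₁ q) = 0 ∧
    S.g q (nabla E₂ q (X q)) (E₂ q) = 0 ∧
    S.eta q (nabla E₁ q (X q)) = - S.g q (nabla S.xi q (X q)) (E₁ q) ∧
    S.eta q (nabla E₂ q (X q)) = - S.g q (nabla S.xi q (X q)) (E₂ q) ∧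
    S.g q (nabla E₁ q (X q)) (E₂ q) = - S.g q (nabla E₂ q (X q)) (E₁ q) := by
  have hn := hU.mem_nhds hq
  have h0 := S.smooth_xi q
  have h1 := hF.contMDiffAt_one hn
  have h2 := hF.contMDiffAt_two hn
  have a00 := hL.pairing_add hX h0 h0 (Eventually.of_forall fun x =>
    (S.g_xi x (S.xi x)).trans (S.eta_xi x))
  have a01 := hL.pairing_add hX h0 h1 (eventually_of_mem hn hF.g_xi_one)
  have a02 := hL.pairing_add hX h0 h2 (eventually_of_mem hn hF.g_xi_two)
  have a11 := hL.pairing_add hX h1 h1 (eventually_of_mem hn fun x hx => hF.g_one_one hx)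
  have a22 := hL.pairing_add hX h2 h2 (eventually_of_mem hn fun x hx => hF.g_two_two hx)
  have a12 := hL.pairing_add hX h1 h2 (eventually_of_mem hn hF.g_one_two)
  rw [S.g_symm q (E₁ q)] at a11 a12
  rw [S.g_symm q (E₂ q)] at a22
  rw [S.g_xi, S.g_xi_right] at a00
  rw [S.g_xi] at a01 a02
  refine ⟨?_, ?_, ?_, ?_, ?_, ?_⟩ <;> linarith

include hS

/-- The Levi-Civita connection in an Artin frame. -/
theorem nabla_frame :
    nabla S.xi q (S.xi q) = 0 ∧
    nabla S.xi q (E₁ q) = -S.bracketCoeff S.xi E₁ E₁ q • E₂ q ∧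
    nabla S.xi q (E₂ q) = -S.bracketCoeff S.xi E₂ E₂ q • E₁ q ∧
    nabla E₁ q (S.xi q) = S.bracketCoeff S.xi E₁ E₂ q • E₁ q ∧
    nabla E₂ q (S.xi q) = -S.bracketCoeff S.xi E₁ E₂ q • E₂ q ∧
    nabla E₁ q (E₁ q) = -S.bracketCoeff E₁ E₂ E₁ q • E₁ q
      + S.bracketCoeff S.xi E₁ E₁ q • S.xi q ∧
    nabla E₂ q (E₂ q) = S.bracketCoeff E₁ E₂ E₂ q • E₂ q
      + S.bracketCoeff S.xi E₂ E₂ q • S.xi q := by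
  have hn := hU.mem_nhds hq
  have h0 := S.smooth_xi q
  have h1 := hF.contMDiffAt_one hn
  have h2 := hF.contMDiffAt_two hn
  -- Koszul's formula as linear algebra: nine torsion relations and, below, six metric relations in
  -- each of three directions determine the 27 pairings g(∇_X Y, Z) of frame fields.
  have t0 := hL.pairing_sub h0 h1 (S.xi q)
  have t1 := hL.pairing_sub h0 h1 (E₁ q)
  have t2 := hL.pairing_sub h0 h1 (E₂ q)
  have u0 := hL.pairing_sub h0 h2 (S.xi q)
  have u1 := hL.pairing_sub h0 h2 (E₁ q)
  have u2 := hL.pairing_sub h0 h2 (E₂ q)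
  have w0 := hL.pairing_sub h1 h2 (S.xi q)
  have w1 := hL.pairing_sub h1 h2 (E₁ q)
  have w2 := hL.pairing_sub h1 h2 (E₂ q)
  have d := hF.bracketCoeff_xi_two_one hU hS hq
  obtain ⟨a0, a1, a2, a3, a4, a5⟩ := hF.pairing_add hU hL hq h0
  obtain ⟨b0, b1, b2, b3, b4, b5⟩ := hF.pairing_add hU hL hq h1
  obtain ⟨c0, c1, c2, c3, c4, c5⟩ := hF.pairing_add hU hL hq h2
  simp only [S.g_xi_right] at t0 u0 w0
  rw [hF.eta_xi_one hU hS hq] at t0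
  rw [hF.eta_xi_two hU hS hq] at u0
  rw [hF.eta_one_two hU hS hq] at w0
  simp only [bracketCoeff] at d ⊢
  refine ⟨?_, ?_, ?_, ?_, ?_, ?_, ?_⟩ <;> apply hF.ext_pairing hq <;>
    simp only [map_add, add_apply, map_smul, smul_apply, smul_eq_mul, map_zero, zero_apply,
      S.eta_xi, S.g_xi, hF.eta_one hq, hF.eta_two hq, hF.g_one_one hq,
      hF.g_two_two hq, hF.g_one_two q hq, hF.g_two_one hq] <;> linarith

end IsArtinFrameOn

end AlmostParacontactMetric

/-! ### The curvature condition as structure equations -/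

/-- Connections are local, so the Leibniz rule applies to a section that equals f • Y only near q.
It is used to differentiate the formulas for ∇ξ, which are known on U alone. -/
theorem CovariantDerivative.apply_of_eventuallyEq_smul
    {E : Type*} [NormedAddCommGroup E] [NormedSpace ℝ E]
    {M : Type*} [TopologicalSpace M] [ChartedSpace E M] [IsManifold 𝓘(ℝ, E) ∞ M]
    (nabla : CovariantDerivative 𝓘(ℝ, E) E (TangentSpace 𝓘(ℝ, E) : M → Type _))
    {f : M → ℝ} {σ Y : Π x : M, TangentSpace 𝓘(ℝ, E) x} {q : M} (hf : CMDiffAt ∞ f q)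
    (hY : CMDiffAt ∞ (T% Y) q) (h : ∀ᶠ x in nhds q, σ x = f x • Y x)
    (v : TangentSpace 𝓘(ℝ, E) q) :
    nabla σ q v = f q • nabla Y q v + mvfderiv 𝓘(ℝ, E) f q v • Y q := by
  have hf' := hf.mdifferentiableAt (by simp)
  have hY' := hY.mdifferentiableAt (by simp)
  have h1 : MDiffAt (T% (f • Y)) q := hf'.smul_section hY'
  have h2 : MDiffAt (T% σ) q := h1.congr_of_eventuallyEq <| h.mono fun x hx => by
    simp only [hx]; rfl
  rw [nabla.isCovariantDerivativeOnUniv.congr_of_eventuallyEq h2 h1 Filter.univ_mem h,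
    nabla.isCovariantDerivativeOnUniv.leibniz hY' hf']
  rfl

namespace AlmostParacontactMetric

open VectorField Filter Topology

variable {E : Type*} [NormedAddCommGroup E] [NormedSpace ℝ E] [CompleteSpace E]
  {M : Type*} [TopologicalSpace M] [ChartedSpace E M] [IsManifold 𝓘(ℝ, E) ∞ M]
  {S : AlmostParacontactMetric E M} {E₁ E₂ : Π x : M, TangentSpace 𝓘(ℝ, E) x} {U : Set M}

namespace IsArtinFrameOn

variable (hF : S.IsArtinFrameOn E₁ E₂ U) (hU : IsOpen U) (hS : S.IsAlmostParacosymplectic)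
  {κ μ : ℝ} (hκ : S.IsKappaMuSpace κ μ) {q : M} (hq : q ∈ U)
include hF hU hS hκ hq

/-- The `(κ, μ)`-condition in terms of the structure functions of an Artin frame. -/
theorem structure_equations :
    S.bracketCoeff S.xi E₁ E₁ q * S.bracketCoeff S.xi E₂ E₂ q = -κ ∧
    mvfderiv 𝓘(ℝ, E) (S.bracketCoeff S.xi E₁ E₁) q (S.xi q)
      = (2 * S.bracketCoeff S.xi E₁ E₂ q + μ) * S.bracketCoeff S.xi E₁ E₁ q ∧
    mvfderiv 𝓘(ℝ, E) (S.bracketCoeff S.xi E₂ E₂) q (S.xi q)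
      = -(2 * S.bracketCoeff S.xi E₁ E₂ q + μ) * S.bracketCoeff S.xi E₂ E₂ q ∧
    mvfderiv 𝓘(ℝ, E) (S.bracketCoeff S.xi E₂ E₂) q (E₁ q)
      = 2 * S.bracketCoeff E₁ E₂ E₁ q * S.bracketCoeff S.xi E₂ E₂ q ∧
    mvfderiv 𝓘(ℝ, E) (S.bracketCoeff S.xi E₁ E₁) q (E₂ q)
      = -2 * S.bracketCoeff E₁ E₂ E₂ q * S.bracketCoeff S.xi E₁ E₁ q := by
  obtain ⟨nabla, hL, hR⟩ := hκ
  have hn := hU.mem_nhds hq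
  have h0 := S.smooth_xi q
  have h1 := hF.contMDiffAt_one hn
  have h2 := hF.contMDiffAt_two hn
  have hc : CMDiffAt ∞ (S.bracketCoeff S.xi E₁ E₁) q := contMDiffAt_bracketCoeff h0 h1 h1
  have hd : CMDiffAt ∞ (S.bracketCoeff S.xi E₂ E₂) q := contMDiffAt_bracketCoeff h0 h2 h2
  have e0 : ∀ᶠ x in 𝓝 q, nabla S.xi x (S.xi x) = (0 : ℝ) • S.xi x :=
    eventually_of_mem hn fun x hx => by
      rw [zero_smul]; exact (hF.nabla_frame hU hS hL hx).1
  have e1 : ∀ᶠ x in 𝓝 q, nabla S.xi x (E₁ x) = -S.bracketCoeff S.xi E₁ E₁ x • E₂ x :=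
    eventually_of_mem hn fun x hx => (hF.nabla_frame hU hS hL hx).2.1
  have e2 : ∀ᶠ x in 𝓝 q, nabla S.xi x (E₂ x) = -S.bracketCoeff S.xi E₂ E₂ x • E₁ x :=
    eventually_of_mem hn fun x hx => (hF.nabla_frame hU hS hL hx).2.2.1
  have n0 := fun v => nabla.apply_of_eventuallyEq_smul contMDiffAt_const h0 e0 v
  have n1 := fun v => nabla.apply_of_eventuallyEq_smul hc.neg h2 e1 v
  have n2 := fun v => nabla.apply_of_eventuallyEq_smul hd.neg h1 e2 v
  have nc : mvfderiv 𝓘(ℝ, E) (fun x => -S.bracketCoeff S.xi E₁ E₁ x) q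
      = -mvfderiv 𝓘(ℝ, E) (S.bracketCoeff S.xi E₁ E₁) q := mvfderiv_neg
  have nd : mvfderiv 𝓘(ℝ, E) (fun x => -S.bracketCoeff S.xi E₂ E₂ x) q
      = -mvfderiv 𝓘(ℝ, E) (S.bracketCoeff S.xi E₂ E₂) q := mvfderiv_neg
  obtain ⟨f1, f2, f3, f4, f5, f6, f7⟩ := hF.nabla_frame hU hS hL hq
  -- R(E₁, ξ)ξ carries the equations for cd and ξc, R(E₂, ξ)ξ the one for ξd, and R(E₁, E₂)ξ = 0
  -- those for E₁d and E₂c, where c = g([ξ, E₁], E₁) and d = g([ξ, E₂], E₂).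
  have r1 := hR U E₁ S.xi hU (hF.frame.contMDiffOn 1) S.smooth_xi.contMDiffOn q hq
  have r2 := hR U E₂ S.xi hU (hF.frame.contMDiffOn 2) S.smooth_xi.contMDiffOn q hq
  have r3 := hR U E₁ E₂ hU (hF.frame.contMDiffOn 1) (hF.frame.contMDiffOn 2) q hq
  have b1 := hF.mlieBracket_xi_one hU hS hq
  have b2 := hF.mlieBracket_xi_two hU hS hq
  have b3 := hF.mlieBracket_one_two hU hS hq
  have sw1 : mlieBracket 𝓘(ℝ, E) E₁ S.xi q = -mlieBracket 𝓘(ℝ, E) S.xi E₁ q :=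
    mlieBracket_swap_apply
  have sw2 : mlieBracket 𝓘(ℝ, E) E₂ S.xi q = -mlieBracket 𝓘(ℝ, E) S.xi E₂ q :=
    mlieBracket_swap_apply
  rw [curvatureOp, n0, n1, sw1, b1, hTensor_xi, hF.hTensor_one hU hS hq, nc] at r1
  rw [curvatureOp, n0, n2, sw2, b2, hTensor_xi, hF.hTensor_two hU hS hq, nd] at r2
  rw [curvatureOp, n1, n2, b3, nc, nd] at r3
  simp only [map_add, map_sub, map_neg, map_smul, neg_apply, f2, f3, f4, f5, f6, f7,
    mvfderiv_const, S.eta_xi, hF.eta_one hq, hF.eta_two hq] at r1 r2 r3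
  have r11 := congrArg (fun v => S.g q v (E₁ q)) r1
  have r12 := congrArg (fun v => S.g q v (E₂ q)) r1
  have r21 := congrArg (fun v => S.g q v (E₁ q)) r2
  have r22 := congrArg (fun v => S.g q v (E₂ q)) r2
  have r31 := congrArg (fun v => S.g q v (E₁ q)) r3
  have r32 := congrArg (fun v => S.g q v (E₂ q)) r3
  simp only [map_add, map_sub, map_neg, neg_apply, sub_apply, add_apply, map_smul, smul_apply,
      smul_eq_mul, map_zero, zero_apply, S.g_xi, hF.eta_one hq, hF.eta_two hq, hF.g_one_one hq,
      hF.g_two_two hq, hF.g_one_two q hq, hF.g_two_one hq] at r11 r12 r21 r22 r31 r32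
  refine ⟨?_, ?_, ?_, ?_, ?_⟩ <;> linarith

end IsArtinFrameOn

end AlmostParacontactMetric

/-! ### Existence and normalization of Artin frames -/

namespace AlmostParacontactMetric

open VectorField Filter Topology

variable {E : Type*} [NormedAddCommGroup E] [NormedSpace ℝ E]
  {M : Type*} [TopologicalSpace M] [ChartedSpace E M] [IsManifold 𝓘(ℝ, E) ∞ M]
  {S : AlmostParacontactMetric E M} {E₁ E₂ : Π x : M, TangentSpace 𝓘(ℝ, E) x} {U : Set M}

theorem eta_eq_zero_of_phi_eq_smul (S : AlmostParacontactMetric E M) {x : M}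
    {v : TangentSpace 𝓘(ℝ, E) x} {c : ℝ} (hc : c ≠ 0) (hv : S.phi x v = c • v) :
    S.eta x v = 0 := by
  have h := S.eta_phi x v
  rw [hv, map_smul, smul_eq_mul] at h
  exact (mul_eq_zero.mp h).resolve_left hc

theorem finrank_tangentSpace (S : AlmostParacontactMetric E M) (x : M) :
    Module.finrank ℝ (TangentSpace 𝓘(ℝ, E) x) = 3 := by
  obtain ⟨e, -⟩ := S.g_signature x
  simpa using Module.finrank_eq_card_basis e

/-- The other axioms are automatic: η vanishes on eigenvectors of φ with eigenvalue ±1, these are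
null, and pairing with the frame then gives linear independence. In dimension three independence
implies spanning. -/
theorem IsArtinFrameOn.of_phi_eq (h1 : CMDiff[U] ∞ (T% E₁)) (h2 : CMDiff[U] ∞ (T% E₂))
    (hp1 : ∀ q ∈ U, S.phi q (E₁ q) = E₁ q) (hp2 : ∀ q ∈ U, S.phi q (E₂ q) = -E₂ q)
    (hg : ∀ q ∈ U, S.g q (E₁ q) (E₂ q) = 1) : S.IsArtinFrameOn E₁ E₂ U := by
  have e1 : ∀ q ∈ U, S.eta q (E₁ q) = 0 := fun q hq =>
    S.eta_eq_zero_of_phi_eq_smul one_ne_zero ((hp1 q hq).trans (one_smul ℝ _).symm)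
  have e2 : ∀ q ∈ U, S.eta q (E₂ q) = 0 := fun q hq =>
    S.eta_eq_zero_of_phi_eq_smul (neg_ne_zero.mpr one_ne_zero)
      ((hp2 q hq).trans (by rw [neg_smul, one_smul]))
  have hli : ∀ q ∈ U, LinearIndependent ℝ (fun i => (![S.xi, E₁, E₂] : Fin 3 → _) i q) := by
    intro q hq
    have g11 : S.g q (E₁ q) (E₁ q) = 0 := by
      have := S.g_phi_self q (E₁ q)
      rwa [hp1 q hq] at this
    have g22 : S.g q (E₂ q) (E₂ q) = 0 := by
      have := S.g_phi_self q (E₂ q)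
      rw [hp2 q hq, map_neg] at this
      linarith
    have g21 : S.g q (E₂ q) (E₁ q) = 1 := by rw [S.g_symm]; exact hg q hq
    rw [Fintype.linearIndependent_iff]
    intro c hc
    simp only [Fin.sum_univ_three, Matrix.cons_val_zero, Matrix.cons_val_one,
      Matrix.cons_val] at hc
    have c0 := congrArg (S.eta q) hc
    have c1 := congrArg (fun v => S.g q v (E₂ q)) hc
    have c2 := congrArg (fun v => S.g q v (E₁ q)) hc
    simp only [map_add, map_smul, add_apply, smul_apply, smul_eq_mul, map_zero, zero_apply,
      S.eta_xi, S.g_xi, e1 q hq, e2 q hq, g11, g22, g21, hg q hq] at c0 c1 c2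
    intro i
    fin_cases i <;> simp only [Fin.zero_eta, Fin.mk_one, Fin.reduceFinMk] <;> linarith
  refine ⟨⟨fun {q} hq => hli q hq, fun {q} hq => ?_, fun i => ?_⟩, hp1, hp2, ?_, ?_, hg⟩
  · have : FiniteDimensional ℝ (TangentSpace 𝓘(ℝ, E) q) :=
      Module.finite_of_finrank_pos (by rw [S.finrank_tangentSpace q]; norm_num)
    exact ((hli q hq).span_eq_top_of_card_eq_finrank'
      (by rw [Fintype.card_fin]; exact (S.finrank_tangentSpace q).symm)).ge
  · fin_cases i
    · exact S.smooth_xi.contMDiffOn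
    · exact h1
    · exact h2
  · intro q hq; rw [S.g_xi, e1 q hq]
  · intro q hq; rw [S.g_xi, e2 q hq]

theorem phi_cube (S : AlmostParacontactMetric E M) (x : M) (v : TangentSpace 𝓘(ℝ, E) x) :
    S.phi x (S.phi x (S.phi x v)) = S.phi x v := by
  rw [S.phi_sq, S.eta_phi, zero_smul, sub_zero]

/-- Since φ³ = φ, the maps φ² + φ and φ² − φ take values in the eigenspaces for 1 and −1. Applied to
a local extension of a timelike vector they give two fields with nonzero pairing at p, and one
rescaling makes the pairing 1. -/
theorem exists_isArtinFrameOn (S : AlmostParacontactMetric E M) (p : M) :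
    ∃ (U : Set M) (E₁ E₂ : Π x : M, TangentSpace 𝓘(ℝ, E) x),
      IsOpen U ∧ p ∈ U ∧ S.IsArtinFrameOn E₁ E₂ U := by
  obtain ⟨e, he⟩ := S.g_signature p
  have hev : S.g p (e 2) (e 2) = -1 := by simpa using he 2 2
  obtain ⟨s, hs, hX⟩ := FiberBundle.exists_contMDiffOn_extend (k := ∞) 𝓘(ℝ, E) E (e 2)
  have hXp : FiberBundle.extend E (e 2) p = e 2 := FiberBundle.extend_apply_self ..
  set X := FiberBundle.extend E (e 2)
  obtain ⟨s', hs's, hs', hps'⟩ := mem_nhds_iff.mp hs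
  replace hX := hX.mono hs's
  have hXat : ∀ q ∈ s', CMDiffAt ∞ (T% X) q := fun q hq => hX.contMDiffAt (hs'.mem_nhds hq)
  let A : Π x : M, TangentSpace 𝓘(ℝ, E) x := fun x => S.phi x (S.phi x (X x)) + S.phi x (X x)
  let B : Π x : M, TangentSpace 𝓘(ℝ, E) x := fun x => S.phi x (S.phi x (X x)) - S.phi x (X x)
  have hA : ∀ q ∈ s', CMDiffAt ∞ (T% A) q := fun q hq =>
    (contMDiffAt_phi (contMDiffAt_phi (hXat q hq))).add_section (contMDiffAt_phi (hXat q hq))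
  have hB : ∀ q ∈ s', CMDiffAt ∞ (T% B) q := fun q hq =>
    (contMDiffAt_phi (contMDiffAt_phi (hXat q hq))).sub_section (contMDiffAt_phi (hXat q hq))
  have hAB : ∀ q ∈ s', CMDiffAt ∞ (fun q => S.g q (A q) (B q)) q := fun q hq =>
    contMDiffAt_g (hA q hq) (hB q hq)
  -- For v = e 2 the cross terms cancel and g(A, B) = −2g(φv, φv) = −2(1 + η(v)²), by g(v, v) = −1.
  have hABp : S.g p (A p) (B p) ≠ 0 := by
    have h1 := S.g_phi p (S.phi p (e 2)) (S.phi p (e 2))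
    have h2 := S.g_phi p (e 2) (e 2)
    have h3 : S.g p (S.phi p (e 2)) (S.phi p (S.phi p (e 2))) = 0 := S.g_phi_self p _
    have h4 : S.g p (S.phi p (S.phi p (e 2))) (S.phi p (e 2)) = 0 := by rw [S.g_symm, h3]
    simp only [A, B, hXp, map_add, map_sub, add_apply, h3, h4, h1, h2, hev, S.eta_phi]
    nlinarith [sq_nonneg (S.eta p (e 2))]
  have hev : ∀ᶠ x in 𝓝 p, x ∈ s' ∧ S.g x (A x) (B x) ≠ 0 :=
    (hs'.eventually_mem hps').and ((hAB p hps').continuousAt.eventually_ne hABp)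
  obtain ⟨U, hU, hUo, hpU⟩ := eventually_nhds_iff.mp hev
  refine ⟨U, A, fun x => (S.g x (A x) (B x))⁻¹ • B x, hUo, hpU, .of_phi_eq ?_ ?_ ?_ ?_ ?_⟩
  · exact fun q hq => (hA q (hU q hq).1).contMDiffWithinAt
  · intro q hq
    exact (((hAB q (hU q hq).1).inv₀ (hU q hq).2).smul_section
      (hB q (hU q hq).1)).contMDiffWithinAt
  · intro q _
    simp only [A, map_add, S.phi_cube]
    exact add_comm _ _
  · intro q _
    simp only [B, map_smul, map_sub, S.phi_cube]
    rw [← smul_neg, neg_sub]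
  · intro q hq
    simp only [map_smul, smul_eq_mul]
    exact inv_mul_cancel₀ (hU q hq).2

section Normalization

variable [CompleteSpace E]

/-- Near a point where `g([ξ, E₁], E₁) ≠ 0`, an Artin frame can be rescaled so that
`g([ξ, E₁], E₁) = ±1`. -/
theorem IsArtinFrameOn.exists_rescale (hF : S.IsArtinFrameOn E₁ E₂ U) (hU : IsOpen U) {p : M}
    (hp : p ∈ U) (hc : S.bracketCoeff S.xi E₁ E₁ p ≠ 0) :
    ∃ (V : Set M) (F₁ F₂ : Π x : M, TangentSpace 𝓘(ℝ, E) x) (ε : ℝ), IsOpen V ∧ p ∈ V ∧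
      (ε = 1 ∨ ε = -1) ∧ S.IsArtinFrameOn F₁ F₂ V ∧
      ∀ q ∈ V, S.bracketCoeff S.xi F₁ F₁ q = ε := by
  obtain ⟨ε, hε, hεp⟩ : ∃ ε : ℝ, (ε = 1 ∨ ε = -1) ∧ 0 < ε * S.bracketCoeff S.xi E₁ E₁ p := by
    rcases lt_or_gt_of_ne hc with h | h
    · exact ⟨-1, Or.inr rfl, by linarith⟩
    · exact ⟨1, Or.inl rfl, by linarith⟩
  have hε2 : ε * ε = 1 := by rcases hε with rfl | rfl <;> norm_num
  set c := S.bracketCoeff S.xi E₁ E₁ with hcdef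
  have hcs : ∀ q ∈ U, CMDiffAt ∞ c q := fun q hq =>
    contMDiffAt_bracketCoeff (S.smooth_xi q) (hF.contMDiffAt_one (hU.mem_nhds hq))
      (hF.contMDiffAt_one (hU.mem_nhds hq))
  have hev : ∀ᶠ x in 𝓝 p, x ∈ U ∧ 0 < ε * c x :=
    (hU.eventually_mem hp).and
      ((continuousAt_const.mul (hcs p hp).continuousAt).eventually_const_lt hεp)
  obtain ⟨V, hV, hVo, hpV⟩ := eventually_nhds_iff.mp hev
  -- Scaling E₁ by f⁻¹ turns c into f⁻²c, which is ε exactly when f² = εc; scaling E₂ by f keeps the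
  -- pairing equal to 1.
  let f : M → ℝ := fun x => Real.sqrt (ε * c x)
  have hf : ∀ q ∈ V, CMDiffAt ∞ f q := fun q hq => by
    have h1 : CMDiffAt ∞ (fun x => ε * c x) q := contMDiffAt_const.mul (hcs q (hV q hq).1)
    exact (Real.contDiffAt_sqrt (hV q hq).2.ne').contMDiffAt.comp q h1
  have hf0 : ∀ q ∈ V, f q ≠ 0 := fun q hq => (Real.sqrt_pos.mpr (hV q hq).2).ne'
  have hf2 : ∀ q ∈ V, f q * f q = ε * c q := fun q hq => Real.mul_self_sqrt (hV q hq).2.le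
  have hfi : ∀ q ∈ V, CMDiffAt ∞ (fun x => (f x)⁻¹) q := fun q hq => (hf q hq).inv₀ (hf0 q hq)
  have hE1 : ∀ q ∈ V, CMDiffAt ∞ (T% E₁) q := fun q hq =>
    hF.contMDiffAt_one (hU.mem_nhds (hV q hq).1)
  have hE2 : ∀ q ∈ V, CMDiffAt ∞ (T% E₂) q := fun q hq =>
    hF.contMDiffAt_two (hU.mem_nhds (hV q hq).1)
  refine ⟨V, fun x => (f x)⁻¹ • E₁ x, fun x => f x • E₂ x, ε, hVo, hpV, hε,
    .of_phi_eq ?_ ?_ ?_ ?_ ?_, ?_⟩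
  · exact fun q hq => ((hfi q hq).smul_section (hE1 q hq)).contMDiffWithinAt
  · exact fun q hq => ((hf q hq).smul_section (hE2 q hq)).contMDiffWithinAt
  · intro q hq
    simp only [map_smul, hF.phi_one q (hV q hq).1]
  · intro q hq
    simp only [map_smul, hF.phi_two q (hV q hq).1, smul_neg]
  · intro q hq
    simp only [map_smul, smul_apply, smul_eq_mul, hF.g_one_two q (hV q hq).1, mul_one]
    exact mul_inv_cancel₀ (hf0 q hq)
  · intro q hq
    have h : mlieBracket 𝓘(ℝ, E) S.xi (fun x => (f x)⁻¹ • E₁ x) q = _ :=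
      mlieBracket_smul_right (V := S.xi) ((hfi q hq).mdifferentiableAt (by simp))
        ((hE1 q hq).mdifferentiableAt (by simp))
    rw [bracketCoeff, h]
    -- The term with the derivative of f⁻¹ is a multiple of E₁, and E₁ is null.
    simp only [map_add, add_apply, map_smul, smul_apply, smul_eq_mul,
      hF.g_one_one (hV q hq).1, mul_zero, zero_add]
    change (f q)⁻¹ * ((f q)⁻¹ * c q) = ε
    have := hf0 q hq
    field_simp
    rw [pow_two, hf2 q hq]
    linear_combination (-c q) * hε2

/-- With c = ε constant, cd = −κ makes d = −εκ constant as well. All derivatives in the structure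
equations vanish, and what is left are products with a nonzero factor. -/
theorem IsArtinFrameOn.hasCommutatorsOn (hF : S.IsArtinFrameOn E₁ E₂ U) (hU : IsOpen U)
    (hS : S.IsAlmostParacosymplectic) {κ μ ε : ℝ} (hκ : S.IsKappaMuSpace κ μ)
    (hε : ε = 1 ∨ ε = -1) (hc : ∀ q ∈ U, S.bracketCoeff S.xi E₁ E₁ q = ε) :
    S.HasCommutatorsOn E₁ E₂ U κ μ ε (fun q => -S.bracketCoeff E₁ E₂ E₁ q) ∧
      (κ ≠ 0 → ∀ q ∈ U, -S.bracketCoeff E₁ E₂ E₁ q = 0) := by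
  have hε0 : ε ≠ 0 := by rcases hε with rfl | rfl <;> norm_num
  have hε2 : ε * ε = 1 := by rcases hε with rfl | rfl <;> norm_num
  have hd : ∀ q ∈ U, S.bracketCoeff S.xi E₂ E₂ q = -(ε * κ) := fun q hq => by
    have h := (hF.structure_equations hU hS hκ hq).1
    rw [hc q hq] at h
    linear_combination ε * h - S.bracketCoeff S.xi E₂ E₂ q * hε2
  have hc' : ∀ q ∈ U, mvfderiv 𝓘(ℝ, E) (S.bracketCoeff S.xi E₁ E₁) q = 0 := fun q hq =>
    mvfderiv_eq_zero_of_eventually_const (eventually_of_mem (hU.mem_nhds hq) hc)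
  have hd' : ∀ q ∈ U, mvfderiv 𝓘(ℝ, E) (S.bracketCoeff S.xi E₂ E₂) q = 0 := fun q hq =>
    mvfderiv_eq_zero_of_eventually_const (eventually_of_mem (hU.mem_nhds hq) hd)
  have ha : ∀ q ∈ U, S.bracketCoeff S.xi E₁ E₂ q = -(μ / 2) := fun q hq => by
    have h := (hF.structure_equations hU hS hκ hq).2.1
    rw [hc' q hq, hc q hq, zero_apply] at h
    have := (mul_eq_zero.mp h.symm).resolve_right hε0
    linarith
  refine ⟨⟨fun q hq => ?_, fun q hq => ?_, fun q hq => ?_⟩, fun hκ0 q hq => ?_⟩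
  · have h := (hF.structure_equations hU hS hκ hq).2.2.2.2
    rw [hc' q hq, hc q hq, zero_apply] at h
    have h2 : S.bracketCoeff E₁ E₂ E₂ q = 0 := by
      have := (mul_eq_zero.mp h.symm).resolve_right hε0
      linarith
    rw [hF.mlieBracket_one_two hU hS hq, h2, zero_smul, zero_add, neg_neg]
  · rw [hF.mlieBracket_xi_one hU hS hq, ha q hq, hc q hq]
  · rw [hF.mlieBracket_xi_two hU hS hq, ha q hq, hd q hq, neg_smul (μ / 2), sub_neg_eq_add]
  -- This is E₁d = 2βd with d = −εκ, so κ ≠ 0 is what permits cancelling d.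
  · have h := (hF.structure_equations hU hS hκ hq).2.2.2.1
    rw [hd' q hq, hd q hq, zero_apply] at h
    have := (mul_eq_zero.mp h.symm).resolve_right (neg_ne_zero.mpr (mul_ne_zero hε0 hκ0))
    linarith

/-- For κ ≠ 0 the equation cd = −κ suffices. Otherwise a field with φX = X has the form fE₁, and if
c vanished at p then [ξ, fE₁] would be a multiple of E₁ there, so that hX = ½(1 − φ)[ξ, X] would
vanish at p. -/
theorem IsArtinFrameOn.bracketCoeff_ne_zero (hF : S.IsArtinFrameOn E₁ E₂ U) (hU : IsOpen U)
    (hS : S.IsAlmostParacosymplectic) {κ μ : ℝ} (hκ : S.IsKappaMuSpace κ μ) {p : M} (hp : p ∈ U)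
    (h : κ ≠ 0 ∨ S.HasNonzeroHOnPlusAt p) : S.bracketCoeff S.xi E₁ E₁ p ≠ 0 := by
  intro hc
  rcases h with h | ⟨V, X, hV, hpV, hX, hphi, hh⟩
  · have := (hF.structure_equations hU hS hκ hp).1
    rw [hc, zero_mul] at this
    exact h (by linarith)
  · apply hh
    have hn : U ∩ V ∈ 𝓝 p := (hU.inter hV).mem_nhds ⟨hp, hpV⟩
    have h1 := hF.contMDiffAt_one (hU.mem_nhds hp)
    have h2 := hF.contMDiffAt_two (hU.mem_nhds hp)
    have hXp : CMDiffAt ∞ (T% X) p := hX.contMDiffAt (hV.mem_nhds hpV)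
    have hf : CMDiffAt ∞ (fun q => S.g q (X q) (E₂ q)) p := contMDiffAt_g hXp h2
    have hXE : X =ᶠ[𝓝 p] (fun q => S.g q (X q) (E₂ q)) • E₁ := by
      refine eventually_of_mem hn fun q hq => ?_
      have e0 : S.eta q (X q) = 0 := S.eta_eq_zero_of_phi_eq_smul one_ne_zero
        ((hphi q hq.2).trans (one_smul ℝ _).symm)
      have e1 : S.g q (X q) (E₁ q) = 0 := by
        have := S.g_phi q (X q) (E₁ q)
        rw [hphi q hq.2, hF.phi_one q hq.1, e0] at this
        linarith
      conv_lhs => rw [hF.expand hq.1 (X q), e0, e1]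
      simp only [zero_smul, zero_add, add_zero]
      rfl
    have hphiX : (fun q => S.phi q (X q)) =ᶠ[𝓝 p] X := eventually_of_mem (hV.mem_nhds hpV) hphi
    have hb := mlieBracket_smul_right (V := S.xi) (hf.mdifferentiableAt (by simp))
      (h1.mdifferentiableAt (by simp))
    rw [hTensor, (EventuallyEq.refl _ S.xi).mlieBracket_vectorField_eq hphiX,
      (EventuallyEq.refl _ S.xi).mlieBracket_vectorField_eq hXE, hb,
      hF.mlieBracket_xi_one hU hS hp, hc]
    simp only [zero_smul, add_zero, map_add, map_smul, hF.phi_one p hp, sub_self, smul_zero]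

/-- Existence of an Artin frame with the normalized commutators. -/
theorem exists_hasCommutatorsOn (hS : S.IsAlmostParacosymplectic) {κ μ : ℝ}
    (hκ : S.IsKappaMuSpace κ μ) (p : M) (h : κ ≠ 0 ∨ S.HasNonzeroHOnPlusAt p) :
    ∃ (U : Set M) (E₁ E₂ : Π x : M, TangentSpace 𝓘(ℝ, E) x) (ε : ℝ) (b : M → ℝ),
      IsOpen U ∧ p ∈ U ∧ (ε = 1 ∨ ε = -1) ∧ ContMDiffOn 𝓘(ℝ, E) 𝓘(ℝ, ℝ) ∞ b U ∧
      S.IsArtinFrameOn E₁ E₂ U ∧ S.HasCommutatorsOn E₁ E₂ U κ μ ε b ∧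
      (κ ≠ 0 → ∀ q ∈ U, b q = 0) := by
  obtain ⟨U, E₁, E₂, hU, hp, hF⟩ := S.exists_isArtinFrameOn p
  obtain ⟨V, F₁, F₂, ε, hV, hpV, hε, hF', hc⟩ :=
    hF.exists_rescale hU hp (hF.bracketCoeff_ne_zero hU hS hκ hp h)
  obtain ⟨hcomm, hb⟩ := hF'.hasCommutatorsOn hV hS hκ hε hc
  refine ⟨V, F₁, F₂, ε, _, hV, hpV, hε, fun q hq => ?_, hF', hcomm, hb⟩
  have h1 := hF'.contMDiffAt_one (hV.mem_nhds hq)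
  have h2 := hF'.contMDiffAt_two (hV.mem_nhds hq)
  exact (contMDiffAt_bracketCoeff h1 h2 h1).neg.contMDiffWithinAt

end Normalization

end AlmostParacontactMetric

/-! ### Integration of a frame on an open subset of a vector space -/

section FrameIntegration

open VectorField

variable {E F : Type*} [NormedAddCommGroup E] [NormedSpace ℝ E]
  [NormedAddCommGroup F] [NormedSpace ℝ F]

/-- Cartan's formula for the antisymmetrized derivative of a vector-valued `1`-form. -/
theorem fderiv_oneForm_sub {α : E → E →L[ℝ] F} {X Y : E → E} {y : E}
    (hα : DifferentiableAt ℝ α y) (hX : DifferentiableAt ℝ X y) (hY : DifferentiableAt ℝ Y y) :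
    fderiv ℝ α y (X y) (Y y) - fderiv ℝ α y (Y y) (X y)
      = fderiv ℝ (fun z => α z (Y z)) y (X y) - fderiv ℝ (fun z => α z (X z)) y (Y y)
        - α y (lieBracket ℝ X Y y) := by
  rw [fderiv_clm_apply hα hY, fderiv_clm_apply hα hX, lieBracket]
  simp
  abel

/-- The linear map with values `v₀, v₁, v₂` on the standard basis. -/
def frameMap (v₀ v₁ v₂ : E) : ℝ × (ℝ × ℝ) →L[ℝ] E :=
  (ContinuousLinearMap.fst ℝ ℝ (ℝ × ℝ)).smulRight v₀
    + ((ContinuousLinearMap.fst ℝ ℝ ℝ ∘L ContinuousLinearMap.snd ℝ ℝ (ℝ × ℝ)).smulRight v₁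
      + (ContinuousLinearMap.snd ℝ ℝ ℝ ∘L ContinuousLinearMap.snd ℝ ℝ (ℝ × ℝ)).smulRight v₂)

@[simp] theorem frameMap_apply (v₀ v₁ v₂ : E) (c : ℝ × (ℝ × ℝ)) :
    frameMap v₀ v₁ v₂ c = c.1 • v₀ + (c.2.1 • v₁ + c.2.2 • v₂) := by
  simp [frameMap]

theorem contDiffAt_frameMap {V₀ V₁ V₂ : E → E} {y : E} (h₀ : ContDiffAt ℝ ∞ V₀ y)
    (h₁ : ContDiffAt ℝ ∞ V₁ y) (h₂ : ContDiffAt ℝ ∞ V₂ y) :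
    ContDiffAt ℝ ∞ (fun z => frameMap (V₀ z) (V₁ z) (V₂ z)) y := by
  unfold frameMap
  exact (contDiffAt_const.smulRight h₀).add
    ((contDiffAt_const.smulRight h₁).add (contDiffAt_const.smulRight h₂))

/-- A smooth `1`-form on a convex open set which is closed on a frame has a smooth primitive. -/
theorem exists_primitive_of_frame [CompleteSpace F] {U : Set E} (hU : IsOpen U) (hUc : Convex ℝ U)
    {V₀ V₁ V₂ : E → E} (h₀ : ∀ y ∈ U, ContDiffAt ℝ ∞ V₀ y) (h₁ : ∀ y ∈ U, ContDiffAt ℝ ∞ V₁ y)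
    (h₂ : ∀ y ∈ U, ContDiffAt ℝ ∞ V₂ y)
    (hsurj : ∀ y ∈ U, Function.Surjective (frameMap (V₀ y) (V₁ y) (V₂ y)))
    {α : E → E →L[ℝ] F} (hα : ∀ y ∈ U, ContDiffAt ℝ ∞ α y)
    (h01 : ∀ y ∈ U, fderiv ℝ (fun z => α z (V₁ z)) y (V₀ y) - fderiv ℝ (fun z => α z (V₀ z)) y (V₁ y)
      = α y (lieBracket ℝ V₀ V₁ y))
    (h02 : ∀ y ∈ U, fderiv ℝ (fun z => α z (V₂ z)) y (V₀ y) - fderiv ℝ (fun z => α z (V₀ z)) y (V₂ y)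
      = α y (lieBracket ℝ V₀ V₂ y))
    (h12 : ∀ y ∈ U, fderiv ℝ (fun z => α z (V₂ z)) y (V₁ y) - fderiv ℝ (fun z => α z (V₁ z)) y (V₂ y)
      = α y (lieBracket ℝ V₁ V₂ y)) :
    ∃ f : E → F, ∀ y ∈ U, ContDiffAt ℝ ∞ f y ∧ HasFDerivAt f (α y) y := by
  have hsymm : ∀ y ∈ U, ∀ v w, fderiv ℝ α y v w = fderiv ℝ α y w v := by
    intro y hy v w
    have e01 := fderiv_oneForm_sub ((hα y hy).differentiableAt (by simp))
      ((h₀ y hy).differentiableAt (by simp)) ((h₁ y hy).differentiableAt (by simp))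
    have e02 := fderiv_oneForm_sub ((hα y hy).differentiableAt (by simp))
      ((h₀ y hy).differentiableAt (by simp)) ((h₂ y hy).differentiableAt (by simp))
    have e12 := fderiv_oneForm_sub ((hα y hy).differentiableAt (by simp))
      ((h₁ y hy).differentiableAt (by simp)) ((h₂ y hy).differentiableAt (by simp))
    rw [h01 y hy, sub_self, sub_eq_zero] at e01
    rw [h02 y hy, sub_self, sub_eq_zero] at e02
    rw [h12 y hy, sub_self, sub_eq_zero] at e12
    -- The derivative's symmetry is a bilinear condition, so it need only be checked on pairs of
    -- frame vectors.
    obtain ⟨c, rfl⟩ := hsurj y hy v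
    obtain ⟨d, rfl⟩ := hsurj y hy w
    simp only [frameMap_apply, map_add, map_smul, add_apply, smul_apply, e01, e02, e12]
    module
  obtain ⟨f, hf⟩ := hUc.exists_forall_hasFDerivAt_of_fderiv_symmetric hU
    (fun y hy => ((hα y hy).differentiableAt (by simp)).differentiableWithinAt) hsymm
  refine ⟨f, fun y hy => ⟨?_, hf y hy⟩⟩
  have h1 : ContDiffOn ℝ ∞ f U := by
    rw [contDiffOn_infty_iff_fderiv_of_isOpen hU]
    refine ⟨fun z hz => (hf z hz).differentiableAt.differentiableWithinAt, fun z hz => ?_⟩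
    exact ((hα z hz).contDiffWithinAt (s := U)).congr (fun x hx => (hf x hx).fderiv) (hf z hz).fderiv
  exact h1.contDiffAt (hU.mem_nhds hy)

/-- In the semidirect product determined by `A`, the left-invariant frame at a point with first
coordinate `s` which extends the frame `(lam, 0), (0, P e₁), (0, P e₂)` at the identity. -/
def PlaneFlow.frameAt (A : PlaneFlow) (lam : ℝ) (P : ℝ × ℝ →L[ℝ] ℝ × ℝ) (s : ℝ) :
    ℝ × (ℝ × ℝ) →L[ℝ] ℝ × (ℝ × ℝ) :=
  (lam • ContinuousLinearMap.fst ℝ ℝ (ℝ × ℝ)).prod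
    (A.map s ∘L P ∘L ContinuousLinearMap.snd ℝ ℝ (ℝ × ℝ))

@[simp] theorem PlaneFlow.frameAt_apply (A : PlaneFlow) (lam : ℝ) (P : ℝ × ℝ →L[ℝ] ℝ × ℝ) (s : ℝ)
    (c : ℝ × (ℝ × ℝ)) : A.frameAt lam P s c = (lam * c.1, A.map s (P c.2)) := by
  simp [PlaneFlow.frameAt]

theorem PlaneFlow.map_neg_map (A : PlaneFlow) (s : ℝ) (v : ℝ × ℝ) :
    A.map (-s) (A.map s v) = v := by
  rw [← A.map_add, neg_add_cancel, A.map_zero]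

theorem PlaneFlow.map_map_neg (A : PlaneFlow) (s : ℝ) (v : ℝ × ℝ) :
    A.map s (A.map (-s) v) = v := by
  rw [← A.map_add, add_neg_cancel, A.map_zero]

/-- The inverse of `PlaneFlow.frameAt`. -/
def PlaneFlow.coframeAt (A : PlaneFlow) (lam : ℝ) (Q : ℝ × ℝ →L[ℝ] ℝ × ℝ) (s : ℝ) :
    ℝ × (ℝ × ℝ) →L[ℝ] ℝ × (ℝ × ℝ) :=
  (lam⁻¹ • ContinuousLinearMap.fst ℝ ℝ (ℝ × ℝ)).prod
    (Q ∘L A.map (-s) ∘L ContinuousLinearMap.snd ℝ ℝ (ℝ × ℝ))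

@[simp] theorem PlaneFlow.coframeAt_apply (A : PlaneFlow) (lam : ℝ) (Q : ℝ × ℝ →L[ℝ] ℝ × ℝ)
    (s : ℝ) (c : ℝ × (ℝ × ℝ)) : A.coframeAt lam Q s c = (lam⁻¹ * c.1, Q (A.map (-s) c.2)) := by
  simp [PlaneFlow.coframeAt]

/-- `PlaneFlow.frameAt` as a linear equivalence. -/
def PlaneFlow.frameEquivAt (A : PlaneFlow) {lam : ℝ} (hl : lam ≠ 0) (P : (ℝ × ℝ) ≃L[ℝ] ℝ × ℝ)
    (s : ℝ) : (ℝ × (ℝ × ℝ)) ≃L[ℝ] ℝ × (ℝ × ℝ) :=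
  .equivOfInverse (A.frameAt lam P s) (A.coframeAt lam P.symm s)
    (fun c => by simp [A.map_neg_map, hl]) (fun c => by simp [A.map_map_neg, hl])

/-- A frame with the structure constants of the Lie algebra of `ℝ ⋉ ℝ²` is locally carried by a
diffeomorphism to the left-invariant frame of that group. -/
theorem exists_openPartialHomeomorph_of_frame [CompleteSpace E] (A : PlaneFlow)
    {B D : ℝ × ℝ →L[ℝ] ℝ × ℝ} (hA : ∀ s, HasDerivAt A.map (A.map s ∘L B) s) {lam : ℝ}
    (hl : lam ≠ 0) (P : (ℝ × ℝ) ≃L[ℝ] ℝ × ℝ) (hPD : ∀ v, P (D v) = lam • B (P v))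
    {U : Set E} (hU : IsOpen U) {p : E} (hp : p ∈ U)
    {V₀ V₁ V₂ : E → E} (h₀ : ∀ y ∈ U, ContDiffAt ℝ ∞ V₀ y) (h₁ : ∀ y ∈ U, ContDiffAt ℝ ∞ V₁ y)
    (h₂ : ∀ y ∈ U, ContDiffAt ℝ ∞ V₂ y)
    (hinv : ∀ y ∈ U, (frameMap (V₀ y) (V₁ y) (V₂ y)).IsInvertible)
    (h01 : ∀ y ∈ U, lieBracket ℝ V₀ V₁ y = frameMap (V₀ y) (V₁ y) (V₂ y) (0, D (1, 0)))
    (h02 : ∀ y ∈ U, lieBracket ℝ V₀ V₂ y = frameMap (V₀ y) (V₁ y) (V₂ y) (0, D (0, 1)))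
    (h12 : ∀ y ∈ U, lieBracket ℝ V₁ V₂ y = 0) :
    ∃ Φ : OpenPartialHomeomorph E (ℝ × (ℝ × ℝ)), p ∈ Φ.source ∧ Φ.source ⊆ U ∧
      ContDiffOn ℝ ∞ Φ Φ.source ∧ ContDiffOn ℝ ∞ Φ.symm Φ.target ∧
      ∀ y ∈ Φ.source, ∀ c, fderiv ℝ Φ y (frameMap (V₀ y) (V₁ y) (V₂ y) c)
        = A.frameAt lam P (Φ y).1 c := by
  obtain ⟨r, hr, hrU⟩ := Metric.isOpen_iff.mp hU p hp
  have hbo : IsOpen (Metric.ball p r) := Metric.isOpen_ball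
  -- The dual coframe.
  let θ : E → E →L[ℝ] ℝ × (ℝ × ℝ) := fun y => (frameMap (V₀ y) (V₁ y) (V₂ y)).inverse
  have hθL : ∀ y ∈ U, ∀ c, θ y (frameMap (V₀ y) (V₁ y) (V₂ y) c) = c := fun y hy c => by
    obtain ⟨e, he⟩ := hinv y hy
    simp only [θ, ← he, ContinuousLinearMap.inverse_equiv]
    exact e.symm_apply_apply c
  have hLθ : ∀ y ∈ U, ∀ v, frameMap (V₀ y) (V₁ y) (V₂ y) (θ y v) = v := fun y hy v => by
    obtain ⟨e, he⟩ := hinv y hy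
    simp only [θ, ← he, ContinuousLinearMap.inverse_equiv]
    exact e.apply_symm_apply v
  have hθ0 : ∀ y ∈ U, θ y (V₀ y) = (1, 0) := fun y hy => by
    simpa using hθL y hy (1, 0)
  have hθ1 : ∀ y ∈ U, θ y (V₁ y) = (0, (1, 0)) := fun y hy => by
    simpa using hθL y hy (0, (1, 0))
  have hθ2 : ∀ y ∈ U, θ y (V₂ y) = (0, (0, 1)) := fun y hy => by
    simpa using hθL y hy (0, (0, 1))
  have hθ : ∀ y ∈ U, ContDiffAt ℝ ∞ θ y := fun y hy => by
    obtain ⟨e, he⟩ := hinv y hy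
    have h := contDiffAt_map_inverse (n := ∞) e
    rw [he] at h
    exact ContDiffAt.comp y h (contDiffAt_frameMap (h₀ y hy) (h₁ y hy) (h₂ y hy))
  have hsurj : ∀ y ∈ U, Function.Surjective (frameMap (V₀ y) (V₁ y) (V₂ y)) :=
    fun y hy v => ⟨θ y v, hLθ y hy v⟩
  have hcst : ∀ {G : Type} [NormedAddCommGroup G] [NormedSpace ℝ G] {f : E → G} {c : G},
      (∀ y ∈ U, f y = c) → ∀ y ∈ U, fderiv ℝ f y = 0 := fun {G} _ _ {f} {c} h y hy => by
    have : f =ᶠ[nhds y] fun _ => c := Filter.eventually_of_mem (hU.mem_nhds hy) h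
    rw [this.fderiv_eq, fderiv_const_apply]
  -- The group coordinate s, with ds = λθ⁰. This form is closed: it is constant on the frame, and no
  -- bracket has a V₀-component.
  obtain ⟨s, hs⟩ := exists_primitive_of_frame (F := ℝ) hbo (convex_ball p r)
    (fun y hy => h₀ y (hrU hy)) (fun y hy => h₁ y (hrU hy)) (fun y hy => h₂ y (hrU hy))
    (fun y hy => hsurj y (hrU hy))
    (α := fun y => lam • (ContinuousLinearMap.fst ℝ ℝ (ℝ × ℝ) ∘L θ y))
    (fun y hy => (contDiffAt_const.clm_comp (hθ y (hrU hy))).const_smul lam)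
    (fun y hy => by
      rw [hcst (c := 0) (fun z hz => by simp [hθ1 z hz]) y (hrU hy),
        hcst (c := lam) (fun z hz => by simp [hθ0 z hz]) y (hrU hy), h01 y (hrU hy)]
      simp only [smul_apply, ContinuousLinearMap.comp_apply, hθL y (hrU hy)]
      simp)
    (fun y hy => by
      rw [hcst (c := 0) (fun z hz => by simp [hθ2 z hz]) y (hrU hy),
        hcst (c := lam) (fun z hz => by simp [hθ0 z hz]) y (hrU hy), h02 y (hrU hy)]
      simp only [smul_apply, ContinuousLinearMap.comp_apply, hθL y (hrU hy)]
      simp)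
    (fun y hy => by
      rw [hcst (c := 0) (fun z hz => by simp [hθ2 z hz]) y (hrU hy),
        hcst (c := 0) (fun z hz => by simp [hθ1 z hz]) y (hrU hy), h12 y (hrU hy)]
      simp)
  have hAs : ∀ y ∈ Metric.ball p r, ContDiffAt ℝ ∞ (fun z => A.map (s z)) y := fun y hy =>
    A.smooth.contDiffAt.comp y (hs y hy).1
  have hdA : ∀ y ∈ Metric.ball p r, ∀ w v, fderiv ℝ (fun z => A.map (s z) w) y v
      = (lam * (θ y v).1) • A.map (s y) (B w) := fun y hy w v => by
    have h1 : HasFDerivAt (fun z => A.map (s z)) _ y :=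
      (hA (s y)).hasFDerivAt.comp y (hs y hy).2
    rw [(h1.clm_apply (hasFDerivAt_const w y)).fderiv]
    simp [mul_smul]
  -- On a field with constant θ-coordinates the second form varies only through A(s), whose
  -- derivative brings in ds = λθ⁰ and the generator B.
  have hw : ∀ y ∈ Metric.ball p r, ∀ {V : E → E} {c : ℝ × (ℝ × ℝ)}, (∀ z ∈ U, θ z (V z) = c) →
      ∀ v, fderiv ℝ (fun z => (A.map (s z) ∘L ((P : ℝ × ℝ →L[ℝ] ℝ × ℝ) ∘L
        ContinuousLinearMap.snd ℝ ℝ (ℝ × ℝ)) ∘L θ z) (V z)) y v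
        = (lam * (θ y v).1) • A.map (s y) (B (P c.2)) := fun y hy {V c} hV v => by
    have : (fun z => (A.map (s z) ∘L ((P : ℝ × ℝ →L[ℝ] ℝ × ℝ) ∘L
        ContinuousLinearMap.snd ℝ ℝ (ℝ × ℝ)) ∘L θ z) (V z))
        =ᶠ[nhds y] fun z => A.map (s z) (P c.2) :=
      Filter.eventually_of_mem (hU.mem_nhds (hrU hy)) fun z hz => by simp [hV z hz]
    rw [this.fderiv_eq, hdA y hy]
  -- The plane coordinate x, with dx = A(s)P(θ¹, θ²). On (V₀, Vᵢ) closedness is λA(s)BPeᵢ =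
  -- A(s)PDeᵢ, that is, the intertwining relation `hPD`; on (V₁, V₂) both sides are zero.
  obtain ⟨x, hx⟩ := exists_primitive_of_frame (F := ℝ × ℝ) hbo (convex_ball p r)
    (fun y hy => h₀ y (hrU hy)) (fun y hy => h₁ y (hrU hy)) (fun y hy => h₂ y (hrU hy))
    (fun y hy => hsurj y (hrU hy))
    (α := fun y => A.map (s y) ∘L ((P : ℝ × ℝ →L[ℝ] ℝ × ℝ) ∘L
      ContinuousLinearMap.snd ℝ ℝ (ℝ × ℝ)) ∘L θ y)
    (fun y hy => (hAs y hy).clm_comp (contDiffAt_const.clm_comp (hθ y (hrU hy))))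
    (fun y hy => by
      rw [hw y hy hθ0, hw y hy hθ1, h01 y (hrU hy), hθ0 y (hrU hy), hθ1 y (hrU hy)]
      simp only [ContinuousLinearMap.comp_apply, hθL y (hrU hy)]
      simp [hPD])
    (fun y hy => by
      rw [hw y hy hθ0, hw y hy hθ2, h02 y (hrU hy), hθ0 y (hrU hy), hθ2 y (hrU hy)]
      simp only [ContinuousLinearMap.comp_apply, hθL y (hrU hy)]
      simp [hPD])
    (fun y hy => by
      rw [hw y hy hθ1, hw y hy hθ2, h12 y (hrU hy), hθ1 y (hrU hy), hθ2 y (hrU hy)]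
      simp)
  let ψ : E → ℝ × (ℝ × ℝ) := fun y => (s y, x y)
  have hψ : ∀ y ∈ Metric.ball p r, ContDiffAt ℝ ∞ ψ y := fun y hy => (hs y hy).1.prodMk (hx y hy).1
  have hψ' : ∀ y ∈ Metric.ball p r, HasFDerivAt ψ (A.frameAt lam P (s y) ∘L θ y) y := fun y hy => by
    have h := (hs y hy).2.prodMk (hx y hy).2
    convert h using 1
    ext v <;> simp
  let T : ∀ y ∈ U, E ≃L[ℝ] ℝ × (ℝ × ℝ) := fun y hy =>
    .equivOfInverse (θ y) (frameMap (V₀ y) (V₁ y) (V₂ y)) (hLθ y hy) (hθL y hy)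
  -- The derivative is the coframe followed by the left-invariant frame of the group, a composite of
  -- isomorphisms, so the inverse function theorem applies. Restricting to the ball keeps this
  -- formula valid on the whole source.
  have hψe : ∀ y (hy : y ∈ Metric.ball p r), HasFDerivAt ψ
      (((T y (hrU hy)).trans (A.frameEquivAt hl P (s y)) : E ≃L[ℝ] ℝ × (ℝ × ℝ)) :
        E →L[ℝ] ℝ × (ℝ × ℝ)) y := fun y hy => hψ' y hy
  have hpb : p ∈ Metric.ball p r := Metric.mem_ball_self hr
  have hstrict := (hψ p hpb).hasStrictFDerivAt' (hψe p hpb) (by simp)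
  let Φ := (hstrict.toOpenPartialHomeomorph ψ).restrOpen (Metric.ball p r) hbo
  have hsrc : Φ.source ⊆ Metric.ball p r := fun y hy => hy.2
  refine ⟨Φ, ⟨hstrict.mem_toOpenPartialHomeomorph_source, hpb⟩, hsrc.trans hrU, ?_, ?_, ?_⟩
  · exact fun y hy => (hψ y (hsrc hy)).contDiffWithinAt
  · intro z hz
    have hy := hsrc (Φ.map_target hz)
    exact (Φ.contDiffAt_symm hz (hψe _ hy) (hψ _ hy)).contDiffWithinAt
  · intro y hy c
    have : fderiv ℝ Φ y = _ := (hψ' y (hsrc hy)).fderiv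
    rw [this, ContinuousLinearMap.comp_apply, hθL y (hrU (hsrc hy))]
    rfl

end FrameIntegration

/-! ### Integration of a frame on a manifold -/

section ManifoldFrameIntegration

open VectorField AlmostParacontactMetric

variable {E : Type*} [NormedAddCommGroup E] [NormedSpace ℝ E]

theorem frameMap_isInvertible {v₀ v₁ v₂ : E} (hli : LinearIndependent ℝ ![v₀, v₁, v₂])
    (hsp : ⊤ ≤ Submodule.span ℝ (Set.range ![v₀, v₁, v₂])) :
    (frameMap v₀ v₁ v₂).IsInvertible := by
  have hinj : Function.Injective (frameMap v₀ v₁ v₂ : ℝ × (ℝ × ℝ) →ₗ[ℝ] E) := by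
    rw [← LinearMap.ker_eq_bot, LinearMap.ker_eq_bot']
    intro c hc
    have h := Fintype.linearIndependent_iff.mp hli ![c.1, c.2.1, c.2.2]
      (by simpa [Fin.sum_univ_three, add_assoc] using hc)
    exact Prod.ext (h 0) (Prod.ext (h 1) (h 2))
  have hsurj : Function.Surjective (frameMap v₀ v₁ v₂ : ℝ × (ℝ × ℝ) →ₗ[ℝ] E) := by
    intro v
    obtain ⟨c, rfl⟩ := (Submodule.mem_span_range_iff_exists_fun ℝ).mp
      (hsp (Submodule.mem_top (x := v)))
    exact ⟨(c 0, (c 1, c 2)), by simp [Fin.sum_univ_three, add_assoc]⟩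
  refine ⟨(LinearEquiv.ofBijective _ ⟨hinj, hsurj⟩).toContinuousLinearEquiv, ?_⟩
  ext <;> simp <;> exact (frameMap_apply v₀ v₁ v₂ _).trans (by simp)

theorem map_frameMap {F : Type*} [NormedAddCommGroup F] [NormedSpace ℝ F] (e : E ≃L[ℝ] F)
    (v₀ v₁ v₂ : E) (c : ℝ × (ℝ × ℝ)) :
    e (frameMap v₀ v₁ v₂ c) = frameMap (e v₀) (e v₁) (e v₂) c := by
  simp

theorem frameMap_zero_left (v₀ v₁ v₂ : E) (d : ℝ × ℝ) :
    frameMap v₀ v₁ v₂ (0, d) = d.1 • v₁ + d.2 • v₂ := by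
  simp

theorem mlieBracket_eq_lieBracket (V W : E → E) (x : E) :
    mlieBracket 𝓘(ℝ, E) V W x = lieBracket ℝ V W x :=
  (congrFun (mlieBracketWithin_eq_lieBracketWithin (V := V) (W := W) (s := Set.univ)) x).trans
    (congrFun lieBracketWithin_univ x)

variable [CompleteSpace E]
  {M : Type*} [TopologicalSpace M] [ChartedSpace E M] [IsManifold 𝓘(ℝ, E) ∞ M]

/-- Pullback by the inverse of the chart at p commutes with brackets, so the frame in the chart has
the same structure constants. The required map is the chart followed by the local diffeomorphism
obtained there. -/
theorem exists_partialDiffeomorph_of_frame (A : PlaneFlow)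
    {B D : ℝ × ℝ →L[ℝ] ℝ × ℝ} (hA : ∀ s, HasDerivAt A.map (A.map s ∘L B) s) {lam : ℝ}
    (hl : lam ≠ 0) (P : (ℝ × ℝ) ≃L[ℝ] ℝ × ℝ) (hPD : ∀ v, P (D v) = lam • B (P v))
    {U : Set M} (hU : IsOpen U) {p : M} (hp : p ∈ U)
    {V₀ V₁ V₂ : Π x : M, TangentSpace 𝓘(ℝ, E) x}
    (hF : IsLocalFrameOn 𝓘(ℝ, E) E ∞ ![V₀, V₁, V₂] U)
    (h01 : ∀ q ∈ U, mlieBracket 𝓘(ℝ, E) V₀ V₁ q = (D (1, 0)).1 • V₁ q + (D (1, 0)).2 • V₂ q)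
    (h02 : ∀ q ∈ U, mlieBracket 𝓘(ℝ, E) V₀ V₂ q = (D (0, 1)).1 • V₁ q + (D (0, 1)).2 • V₂ q)
    (h12 : ∀ q ∈ U, mlieBracket 𝓘(ℝ, E) V₁ V₂ q = 0) :
    ∃ ψ : PartialDiffeomorph 𝓘(ℝ, E) 𝓘(ℝ, ℝ × (ℝ × ℝ)) M (FlowGroup A) ∞,
      p ∈ ψ.source ∧ ψ.source ⊆ U ∧ ∀ x ∈ ψ.source,
        (mfderiv 𝓘(ℝ, E) 𝓘(ℝ, ℝ × (ℝ × ℝ)) ψ x (V₀ x) : ℝ × (ℝ × ℝ))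
          = A.frameAt lam P (ψ x).1 (1, (0, 0)) ∧
        (mfderiv 𝓘(ℝ, E) 𝓘(ℝ, ℝ × (ℝ × ℝ)) ψ x (V₁ x) : ℝ × (ℝ × ℝ))
          = A.frameAt lam P (ψ x).1 (0, (1, 0)) ∧
        (mfderiv 𝓘(ℝ, E) 𝓘(ℝ, ℝ × (ℝ × ℝ)) ψ x (V₂ x) : ℝ × (ℝ × ℝ))
          = A.frameAt lam P (ψ x).1 (0, (0, 1)) := by
  let φ := chartAt E p
  let W : (Π x : M, TangentSpace 𝓘(ℝ, E) x) → E → E :=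
    fun V => mpullback 𝓘(ℝ, E) 𝓘(ℝ, E) φ.symm V
  let U' : Set E := φ.target ∩ φ.symm ⁻¹' U
  have hU' : IsOpen U' := φ.isOpen_inter_preimage_symm hU
  have hφs : ∀ y ∈ φ.target, ContMDiffAt 𝓘(ℝ, E) 𝓘(ℝ, E) ∞ φ.symm y := fun y hy =>
    contMDiffOn_chart_symm.contMDiffAt (φ.open_target.mem_nhds hy)
  have hφ : ∀ x ∈ φ.source, ContMDiffAt 𝓘(ℝ, E) 𝓘(ℝ, E) ∞ φ x := fun y hy =>
    contMDiffOn_chart.contMDiffAt (φ.open_source.mem_nhds hy)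
  have hφd : φ.MDifferentiable 𝓘(ℝ, E) 𝓘(ℝ, E) := mdifferentiable_chart p
  -- e is the derivative of the inverse chart at y; its inverse both pulls back vector fields and is
  -- the derivative of the chart.
  have hT : ∀ y ∈ φ.target, ∃ e : E ≃L[ℝ] E,
      (e : E →L[ℝ] E) = mfderiv 𝓘(ℝ, E) 𝓘(ℝ, E) φ.symm y ∧
      (∀ V, W V y = e.symm (V (φ.symm y))) ∧
      ∀ v : E, (mfderiv 𝓘(ℝ, E) 𝓘(ℝ, E) φ (φ.symm y) v : E) = e.symm v := fun y hy => by
    let e : E ≃L[ℝ] E := hφd.symm.mfderiv hy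
    have he : (e : E →L[ℝ] E) = mfderiv 𝓘(ℝ, E) 𝓘(ℝ, E) φ.symm y := rfl
    refine ⟨e, he, fun V => ?_, fun v => ?_⟩
    · have h : ContinuousLinearMap.inverse (e : E →L[ℝ] E) = e.symm :=
        ContinuousLinearMap.inverse_equiv e
      rw [he] at h
      exact congrArg (fun T : E →L[ℝ] E => T (V (φ.symm y))) h
    · have h := hφd.comp_symm_deriv hy
      have h2 := congrArg (fun T : E →L[ℝ] E => T (e.symm v)) h
      have h3 : (mfderiv 𝓘(ℝ, E) 𝓘(ℝ, E) φ (φ.symm y) (e (e.symm v)) : E) = e.symm v := h2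
      rwa [e.apply_symm_apply] at h3
  have hsm : ∀ {V : Π x : M, TangentSpace 𝓘(ℝ, E) x}, CMDiff[U] ∞ (T% V) → ∀ y ∈ U',
      ContDiffAt ℝ ∞ (W V) y := fun {V} hV y hy => by
    obtain ⟨e, he, -⟩ := hT y hy.1
    have h := ContMDiffAt.mpullback_vectorField_preimage (n := ∞) (m := ∞)
      (hV.contMDiffAt (hU.mem_nhds hy.2)) (hφs y hy.1) ⟨e, he⟩ (by simp)
    exact contMDiffAt_vectorSpace_iff_contDiffAt.mp h
  have hbr : ∀ {V V' : Π x : M, TangentSpace 𝓘(ℝ, E) x}, CMDiff[U] ∞ (T% V) →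
      CMDiff[U] ∞ (T% V') → ∀ y ∈ U', lieBracket ℝ (W V) (W V') y
        = W (mlieBracket 𝓘(ℝ, E) V V') y := fun {V V'} hV hV' y hy => by
    have h := mpullback_mlieBracket (I := 𝓘(ℝ, E)) (n := ∞) (f := φ.symm) (x₀ := y)
      ((hV.contMDiffAt (hU.mem_nhds hy.2)).mdifferentiableAt (by simp))
      ((hV'.contMDiffAt (hU.mem_nhds hy.2)).mdifferentiableAt (by simp)) (hφs y hy.1)
      (by simpa using WithTop.coe_le_coe.2 (le_top : (2 : ℕ∞) ≤ ⊤))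
    exact (mlieBracket_eq_lieBracket (W V) (W V') y).symm.trans h.symm
  have hV0 : CMDiff[U] ∞ (T% V₀) := hF.contMDiffOn 0
  have hV1 : CMDiff[U] ∞ (T% V₁) := hF.contMDiffOn 1
  have hV2 : CMDiff[U] ∞ (T% V₂) := hF.contMDiffOn 2
  have hfr : ∀ q : M, (fun i => (![V₀, V₁, V₂] : Fin 3 → _) i q) = ![V₀ q, V₁ q, V₂ q] :=
    fun q => by ext i; fin_cases i <;> rfl
  obtain ⟨Φ, hpΦ, hΦU, hΦ, hΦs, hΦd⟩ := exists_openPartialHomeomorph_of_frame A hA hl P hPD hU'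
    (p := φ p) ⟨φ.map_source (mem_chart_source E p), by
      rw [Set.mem_preimage, φ.left_inv (mem_chart_source E p)]; exact hp⟩
    (hsm hV0) (hsm hV1) (hsm hV2)
    (fun y hy => by
      obtain ⟨e, -, he, -⟩ := hT y hy.1
      have hli := hF.linearIndependent hy.2
      have hsp := hF.generating hy.2
      rw [hfr] at hli hsp
      obtain ⟨f, hf⟩ := frameMap_isInvertible (E := E) hli hsp
      refine ⟨f.trans e.symm, ContinuousLinearMap.ext fun c => ?_⟩
      rw [he, he, he]
      exact (congrArg (fun T : ℝ × (ℝ × ℝ) →L[ℝ] E => e.symm (T c)) hf).trans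
        (map_frameMap e.symm _ _ _ c))
    (fun y hy => by
      obtain ⟨e, -, he, -⟩ := hT y hy.1
      rw [hbr hV0 hV1 y hy, he, he, he, he]
      exact (congrArg e.symm ((h01 _ hy.2).trans (frameMap_zero_left (E := E) _ _ _ _).symm)).trans
        (map_frameMap e.symm _ _ _ _))
    (fun y hy => by
      obtain ⟨e, -, he, -⟩ := hT y hy.1
      rw [hbr hV0 hV2 y hy, he, he, he, he]
      exact (congrArg e.symm ((h02 _ hy.2).trans (frameMap_zero_left (E := E) _ _ _ _).symm)).trans
        (map_frameMap e.symm _ _ _ _))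
    (fun y hy => by
      obtain ⟨e, -, he, -⟩ := hT y hy.1
      rw [hbr hV1 hV2 y hy, he]
      exact (congrArg e.symm (h12 _ hy.2)).trans (map_zero e.symm))
  let Ψ := φ.trans Φ
  have hΨs : ∀ x ∈ Ψ.source, x ∈ φ.source ∧ φ x ∈ Φ.source := fun x hx => by
    rwa [φ.trans_source] at hx
  have hΨt : ∀ z ∈ Ψ.target, z ∈ Φ.target ∧ Φ.symm z ∈ φ.target := fun x hx => by
    rwa [φ.trans_target] at hx
  have hΦat : ∀ y ∈ Φ.source, ContMDiffAt 𝓘(ℝ, E) 𝓘(ℝ, ℝ × (ℝ × ℝ)) ∞ Φ y := fun y hy =>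
    (hΦ.contDiffAt (Φ.open_source.mem_nhds hy)).contMDiffAt
  have hΨ₁ : ContMDiffOn 𝓘(ℝ, E) 𝓘(ℝ, ℝ × (ℝ × ℝ)) ∞ Ψ Ψ.source := fun x hx =>
    ((hΦat _ (hΨs x hx).2).comp x (hφ x (hΨs x hx).1)).contMDiffWithinAt
  have hΨ₂ : ContMDiffOn 𝓘(ℝ, ℝ × (ℝ × ℝ)) 𝓘(ℝ, E) ∞ Ψ.symm Ψ.target := fun z hz =>
    ((hφs _ (hΨt z hz).2).comp z ((hΦs.contDiffAt
      (Φ.open_target.mem_nhds (hΨt z hz).1)).contMDiffAt)).contMDiffWithinAt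
  let ψ : PartialDiffeomorph 𝓘(ℝ, E) 𝓘(ℝ, ℝ × (ℝ × ℝ)) M (FlowGroup A) ∞ :=
    { toPartialEquiv := Ψ.toPartialEquiv
      open_source := Ψ.open_source
      open_target := Ψ.open_target
      contMDiffOn_toFun := hΨ₁
      contMDiffOn_invFun := hΨ₂ }
  have hd : ∀ y ∈ φ.target, φ.symm y ∈ ψ.source → ∀ (V : Π x : M, TangentSpace 𝓘(ℝ, E) x) (c),
      W V y = frameMap (W V₀ y) (W V₁ y) (W V₂ y) c →
      (mfderiv 𝓘(ℝ, E) 𝓘(ℝ, ℝ × (ℝ × ℝ)) ψ (φ.symm y) (V (φ.symm y)) : ℝ × (ℝ × ℝ))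
        = A.frameAt lam P (ψ (φ.symm y)).1 c := fun y hy hx V c hc => by
    have hx' := hΨs _ hx
    have hyΦ : y ∈ Φ.source := by simpa only [φ.right_inv hy] using hx'.2
    have h := mfderiv_comp (φ.symm y) ((hΦat _ hx'.2).mdifferentiableAt (by simp))
      ((hφ _ hx'.1).mdifferentiableAt (by simp))
    rw [mfderiv_eq_fderiv, φ.right_inv hy] at h
    obtain ⟨e, -, he, he'⟩ := hT y hy
    refine (congrArg (fun T : E →L[ℝ] ℝ × (ℝ × ℝ) => T (V (φ.symm y))) h).trans ?_
    refine (congrArg (fderiv ℝ Φ y) ((he' (V (φ.symm y))).trans ((he V).symm.trans hc))).trans ?_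
    rw [hΦd y hyΦ]
    exact congrArg (fun z => A.frameAt lam P (Φ z).1 c) (φ.right_inv hy).symm
  have hW : ∀ x ∈ ψ.source, ∃ y ∈ φ.target, φ.symm y = x := fun x hx =>
    ⟨φ x, φ.map_source (hΨs x hx).1, φ.left_inv (hΨs x hx).1⟩
  refine ⟨ψ, ?_, fun x hx => ?_, fun x hx => ?_⟩
  · change p ∈ Ψ.source
    rw [φ.trans_source]
    exact ⟨mem_chart_source E p, hpΦ⟩
  · have h := (hΦU (hΨs x hx).2).2
    rwa [Set.mem_preimage, φ.left_inv (hΨs x hx).1] at h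
  · obtain ⟨y, hy, rfl⟩ := hW x hx
    exact ⟨hd y hy hx V₀ _ (by simp), hd y hy hx V₁ _ (by simp), hd y hy hx V₂ _ (by simp)⟩

end ManifoldFrameIntegration

/-! ### Structures on a vector space defined by a global frame -/

section ModelSpace

variable {E : Type*} [NormedAddCommGroup E] [NormedSpace ℝ E]

theorem mvfderiv_apply_eq_fderiv (f : E → ℝ) (x v : E) :
    mvfderiv 𝓘(ℝ, E) f x v = fderiv ℝ f x v :=
  congrArg (fun T : E →L[ℝ] ℝ => T v) (mfderiv_eq_fderiv (f := f) (x := x))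

theorem differentiableAt_of_mdifferentiableAt_section {X : Π x : E, TangentSpace 𝓘(ℝ, E) x} {p : E}
    (h : MDiffAt (T% X) p) : DifferentiableAt ℝ (X : E → E) p := by
  rw [mdifferentiableAt_section] at h
  simpa [TangentSpace] using h.differentiableAt

/-- The tangent trivializations of a vector space are identities, so in them the section is the map
T itself. The same holds for the forms below. -/
theorem contMDiff_endomorphism_section 
    {T : Π x : E, TangentSpace 𝓘(ℝ, E) x →L[ℝ] TangentSpace 𝓘(ℝ, E) x}
    (hT : ContDiff ℝ (E := E) (F := E →L[ℝ] E) ∞ T) :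
    ContMDiff 𝓘(ℝ, E) (𝓘(ℝ, E).prod 𝓘(ℝ, E →L[ℝ] E)) ∞
      (fun x => Bundle.TotalSpace.mk' (E →L[ℝ] E)
        (E := fun x : E => TangentSpace 𝓘(ℝ, E) x →L[ℝ] TangentSpace 𝓘(ℝ, E) x) x (T x)) := by
  intro x
  rw [Bundle.contMDiffAt_section]
  refine hT.contDiffAt.contMDiffAt.congr_of_eventuallyEq (Filter.Eventually.of_forall fun y => ?_)
  refine ContinuousLinearMap.ext fun v => ?_
  have h1 : (trivializationAt E (TangentSpace 𝓘(ℝ, E)) x).symmL ℝ y = (1 : E →L[ℝ] E) :=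
    TangentBundle.symmL_model_space _ _
  have h2 : (trivializationAt E (TangentSpace 𝓘(ℝ, E)) x).continuousLinearMapAt ℝ y = (1 : E →L[ℝ] E) :=
    TangentBundle.continuousLinearMapAt_model_space _ _
  exact (congrArg (fun L : E →L[ℝ] E => L (T y
    ((trivializationAt E (TangentSpace 𝓘(ℝ, E)) x).symmL ℝ y v))) h2).trans
    (congrArg (fun L : E →L[ℝ] E => T y (L v)) h1)

theorem contMDiff_oneForm_section 
    {T : Π x : E, TangentSpace 𝓘(ℝ, E) x →L[ℝ] ℝ} (hT : ContDiff ℝ (E := E) (F := E →L[ℝ] ℝ) ∞ T) :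
    ContMDiff 𝓘(ℝ, E) (𝓘(ℝ, E).prod 𝓘(ℝ, E →L[ℝ] ℝ)) ∞
      (fun x => Bundle.TotalSpace.mk' (E →L[ℝ] ℝ)
        (E := fun x : E => TangentSpace 𝓘(ℝ, E) x →L[ℝ] ℝ) x (T x)) := by
  intro x
  rw [Bundle.contMDiffAt_section]
  refine hT.contDiffAt.contMDiffAt.congr_of_eventuallyEq (Filter.Eventually.of_forall fun y => ?_)
  refine ContinuousLinearMap.ext fun v => ?_
  have h1 : (trivializationAt E (TangentSpace 𝓘(ℝ, E)) x).symmL ℝ y = (1 : E →L[ℝ] E) :=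
    TangentBundle.symmL_model_space _ _
  have h2 : ∀ r : ℝ,
      (trivializationAt ℝ (Bundle.Trivial E ℝ) x).continuousLinearMapAt ℝ y r = r := fun r => by simp
  exact (h2 _).trans
    (congrArg (fun L : E →L[ℝ] E => T y (L v)) h1)

theorem contMDiff_bilinearForm_section 
    {T : Π x : E, TangentSpace 𝓘(ℝ, E) x →L[ℝ] TangentSpace 𝓘(ℝ, E) x →L[ℝ] ℝ}
    (hT : ContDiff ℝ (E := E) (F := E →L[ℝ] E →L[ℝ] ℝ) ∞ T) :
    ContMDiff 𝓘(ℝ, E) (𝓘(ℝ, E).prod 𝓘(ℝ, E →L[ℝ] E →L[ℝ] ℝ)) ∞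
      (fun x => Bundle.TotalSpace.mk' (E →L[ℝ] E →L[ℝ] ℝ)
        (E := fun x : E => TangentSpace 𝓘(ℝ, E) x →L[ℝ] TangentSpace 𝓘(ℝ, E) x →L[ℝ] ℝ)
        x (T x)) := by
  intro x
  rw [Bundle.contMDiffAt_section]
  refine hT.contDiffAt.contMDiffAt.congr_of_eventuallyEq (Filter.Eventually.of_forall fun y => ?_)
  refine ContinuousLinearMap.ext fun v => ContinuousLinearMap.ext fun w => ?_
  have h1 : (trivializationAt E (TangentSpace 𝓘(ℝ, E)) x).symmL ℝ y = (1 : E →L[ℝ] E) :=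
    TangentBundle.symmL_model_space _ _
  have h2 : ∀ r : ℝ,
      (trivializationAt ℝ (Bundle.Trivial E ℝ) x).continuousLinearMapAt ℝ y r = r := fun r => by simp
  have h3 : ∀ L : E →L[ℝ] ℝ, (trivializationAt (E →L[ℝ] ℝ)
      (fun x : E => TangentSpace 𝓘(ℝ, E) x →L[ℝ] ℝ) x).continuousLinearMapAt ℝ y L = L := fun L => by
    have hy : y ∈ (trivializationAt (E →L[ℝ] ℝ)
        (fun x : E => TangentSpace 𝓘(ℝ, E) x →L[ℝ] ℝ) x).baseSet := by simp [chartAt_self_eq]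
    refine (Bundle.Trivialization.continuousLinearMapAt_apply_of_mem ℝ _ hy _).trans ?_
    refine ContinuousLinearMap.ext fun w => ?_
    exact (h2 _).trans (congrArg (fun K : E →L[ℝ] E => L (K w)) h1)
  exact (congrArg (fun L : E →L[ℝ] ℝ => L w) (h3 _)).trans
    (congrArg (fun K : E →L[ℝ] E => T y (K v) w) h1)

/-- The endomorphism `φ` in the standard basis `(ξ, e₁, e₂)`. -/
def artinPhi : ℝ × (ℝ × ℝ) →L[ℝ] ℝ × (ℝ × ℝ) :=
  ContinuousLinearMap.inr ℝ ℝ (ℝ × ℝ) ∘L planeMap 1 0 0 (-1) ∘L ContinuousLinearMap.snd ℝ ℝ (ℝ × ℝ)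

@[simp] theorem artinPhi_apply (c : ℝ × (ℝ × ℝ)) : artinPhi c = (0, (c.2.1, -c.2.2)) := by
  simp [artinPhi]

/-- The metric for which the standard basis `(ξ, e₁, e₂)` is an Artin basis. -/
def artinForm : ℝ × (ℝ × ℝ) →L[ℝ] ℝ × (ℝ × ℝ) →L[ℝ] ℝ :=
  (ContinuousLinearMap.fst ℝ ℝ (ℝ × ℝ)).smulRight (ContinuousLinearMap.fst ℝ ℝ (ℝ × ℝ))
    + ((ContinuousLinearMap.fst ℝ ℝ ℝ ∘L ContinuousLinearMap.snd ℝ ℝ (ℝ × ℝ)).smulRight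
        (ContinuousLinearMap.snd ℝ ℝ ℝ ∘L ContinuousLinearMap.snd ℝ ℝ (ℝ × ℝ))
      + (ContinuousLinearMap.snd ℝ ℝ ℝ ∘L ContinuousLinearMap.snd ℝ ℝ (ℝ × ℝ)).smulRight
        (ContinuousLinearMap.fst ℝ ℝ ℝ ∘L ContinuousLinearMap.snd ℝ ℝ (ℝ × ℝ)))

@[simp] theorem artinForm_apply (c d : ℝ × (ℝ × ℝ)) :
    artinForm c d = c.1 * d.1 + (c.2.1 * d.2.2 + c.2.2 * d.2.1) := by
  simp [artinForm]

/-- The pullback of `artinForm` under a linear map. -/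
def pullbackArtinForm (T : E →L[ℝ] ℝ × (ℝ × ℝ)) : E →L[ℝ] E →L[ℝ] ℝ :=
  (ContinuousLinearMap.fst ℝ ℝ (ℝ × ℝ) ∘L T).smulRight (ContinuousLinearMap.fst ℝ ℝ (ℝ × ℝ) ∘L T)
    + (((ContinuousLinearMap.fst ℝ ℝ ℝ ∘L ContinuousLinearMap.snd ℝ ℝ (ℝ × ℝ)) ∘L T).smulRight
        ((ContinuousLinearMap.snd ℝ ℝ ℝ ∘L ContinuousLinearMap.snd ℝ ℝ (ℝ × ℝ)) ∘L T)
      + ((ContinuousLinearMap.snd ℝ ℝ ℝ ∘L ContinuousLinearMap.snd ℝ ℝ (ℝ × ℝ)) ∘L T).smulRight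
        ((ContinuousLinearMap.fst ℝ ℝ ℝ ∘L ContinuousLinearMap.snd ℝ ℝ (ℝ × ℝ)) ∘L T))

theorem pullbackArtinForm_apply (T : E →L[ℝ] ℝ × (ℝ × ℝ)) (v w : E) :
    pullbackArtinForm T v w = artinForm (T v) (T w) := by
  simp [pullbackArtinForm]

theorem contDiff_pullbackArtinForm {θ : E → E →L[ℝ] ℝ × (ℝ × ℝ)} (hθ : ContDiff ℝ ∞ θ) :
    ContDiff ℝ ∞ fun z => pullbackArtinForm (θ z) := by
  have h : ∀ T : ℝ × (ℝ × ℝ) →L[ℝ] ℝ, ContDiff ℝ ∞ fun z => T ∘L θ z := fun T =>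
    contDiff_const.clm_comp hθ
  exact ((h _).smulRight (h _)).add (((h _).smulRight (h _)).add ((h _).smulRight (h _)))

/-- The null pair spans a hyperbolic plane, which (e₁ ± e₂)/√2 diagonalizes with signs +1 and −1. -/
theorem exists_basis_artinForm : ∃ e : Module.Basis (Fin 3) ℝ (ℝ × (ℝ × ℝ)),
    ∀ i j, artinForm (e i) (e j) = Matrix.diagonal ![(1 : ℝ), 1, -1] i j := by
  have hr : √2 * √2 = 2 := Real.mul_self_sqrt zero_le_two
  have h0 : √2 ≠ 0 := by positivity
  let v : Fin 3 → ℝ × (ℝ × ℝ) := ![(1, (0, 0)), (0, (1 / √2, 1 / √2)), (0, (1 / √2, -(1 / √2)))]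
  have hli : LinearIndependent ℝ v := by
    rw [Fintype.linearIndependent_iff]
    intro c hc
    simp only [v, Fin.sum_univ_three, Matrix.cons_val_zero, Matrix.cons_val_one, Matrix.cons_val,
      Prod.smul_mk, Prod.mk_add_mk, Prod.mk_eq_zero, smul_eq_mul] at hc
    obtain ⟨h1, h2, h3⟩ := hc
    field_simp at h2 h3
    intro i
    fin_cases i <;> simp <;> linarith
  refine ⟨basisOfLinearIndependentOfCardEqFinrank hli (by simp), fun i j => ?_⟩
  rw [coe_basisOfLinearIndependentOfCardEqFinrank, artinForm_apply]
  fin_cases i <;> fin_cases j <;> simp [v, Matrix.diagonal] <;> field_simp <;> nlinarith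

/-- The almost paracontact metric structure on a vector space for which the image of the standard
basis of `ℝ × (ℝ × ℝ)` under `F` is an Artin frame. -/
def AlmostParacontactMetric.ofFrame (F : E → (ℝ × (ℝ × ℝ)) ≃L[ℝ] E)
    (hF : ContDiff ℝ ∞ fun z => (F z : ℝ × (ℝ × ℝ) →L[ℝ] E))
    (hθ : ContDiff ℝ ∞ fun z => ((F z).symm : E →L[ℝ] ℝ × (ℝ × ℝ))) :
    AlmostParacontactMetric E E where
  phi z := ((F z : ℝ × (ℝ × ℝ) →L[ℝ] E) ∘L artinPhi ∘L ((F z).symm : E →L[ℝ] ℝ × (ℝ × ℝ)) :)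
  xi z := F z (1, 0)
  eta z := (ContinuousLinearMap.fst ℝ ℝ (ℝ × ℝ) ∘L ((F z).symm : E →L[ℝ] ℝ × (ℝ × ℝ)) :)
  g z := (pullbackArtinForm ((F z).symm : E →L[ℝ] ℝ × (ℝ × ℝ)) :)
  smooth_phi := contMDiff_endomorphism_section (hF.clm_comp (contDiff_const.clm_comp hθ))
  smooth_xi := contMDiff_vectorSpace_iff_contDiff.mpr (hF.clm_apply contDiff_const)
  smooth_eta := contMDiff_oneForm_section (contDiff_const.clm_comp hθ)
  smooth_g := contMDiff_bilinearForm_section (contDiff_pullbackArtinForm hθ)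
  g_symm z := by
    have h : ∀ (T : E →L[ℝ] ℝ × (ℝ × ℝ)) (v w : E),
        pullbackArtinForm T v w = pullbackArtinForm T w v := fun T v w => by
      simp only [pullbackArtinForm_apply, artinForm_apply]
      ring
    exact h _
  g_signature z := by
    obtain ⟨e, he⟩ := exists_basis_artinForm
    refine ⟨e.map (F z).toLinearEquiv, fun i j => (pullbackArtinForm_apply (E := E)
      ((F z).symm : E →L[ℝ] ℝ × (ℝ × ℝ)) (F z (e i)) (F z (e j))).trans ?_⟩
    rw [ContinuousLinearEquiv.coe_coe, (F z).symm_apply_apply, (F z).symm_apply_apply, he]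
  phi_sq z := by
    have h : ∀ v : E, F z (artinPhi ((F z).symm (F z (artinPhi ((F z).symm v))))) =
        v - ((F z).symm v).1 • F z (1, 0) := fun v => by
      obtain ⟨c, rfl⟩ := (F z).surjective v
      simp only [(F z).symm_apply_apply]
      rw [← map_smul, ← map_sub]
      congr 1
      ext <;> simp
    exact h
  eta_xi z := by
    change ((F z).symm (F z (1, 0))).1 = 1
    rw [(F z).symm_apply_apply]
  g_phi z := by
    have h : ∀ v w : E, pullbackArtinForm ((F z).symm : E →L[ℝ] ℝ × (ℝ × ℝ))
        (F z (artinPhi ((F z).symm v))) (F z (artinPhi ((F z).symm w)))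
        = - pullbackArtinForm ((F z).symm : E →L[ℝ] ℝ × (ℝ × ℝ)) v w
          + ((F z).symm v).1 * ((F z).symm w).1 := fun v w => by
      simp only [pullbackArtinForm_apply, ContinuousLinearEquiv.coe_coe, (F z).symm_apply_apply,
        artinForm_apply, artinPhi_apply]
      ring
    exact h

end ModelSpace

/-! ### Geometry of a frame satisfying the Maurer–Cartan equation -/

section FrameStructure

open VectorField AlmostParacontactMetric

variable {E : Type*} [NormedAddCommGroup E] [NormedSpace ℝ E]

/-- The bracket of the semidirect product `ℝ ⋉ ℝ²` determined by the matrix `D`. -/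
def semidirectBracket (D : ℝ × ℝ →L[ℝ] ℝ × ℝ) (a b : ℝ × (ℝ × ℝ)) : ℝ × (ℝ × ℝ) :=
  (0, a.1 • D b.2 - b.1 • D a.2)

/-- The action of `ξ` on the span of `e₁, e₂` in the model Lie algebra. -/
def kappaMuMap (κ μ ε : ℝ) : ℝ × ℝ →L[ℝ] ℝ × ℝ := planeMap (-(μ / 2)) (-(ε * κ)) ε (μ / 2)

/-- The linear map `a ↦ ∇_a b` for the Levi-Civita connection of the model Lie algebra. -/
def leviCivitaMap (κ μ ε : ℝ) (b : ℝ × (ℝ × ℝ)) : ℝ × (ℝ × ℝ) →L[ℝ] ℝ × (ℝ × ℝ) :=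
  frameMap (0, (-(μ / 2) * b.2.1, μ / 2 * b.2.2)) (ε * b.2.1, (0, -ε * b.1))
    (-(ε * κ) * b.2.2, (ε * κ * b.1, 0))

/-- The coefficients are those of `nabla_frame` with a = −μ/2, c = ε, d = −εκ and [E₁, E₂] = 0. -/
theorem leviCivitaMap_apply (κ μ ε : ℝ) (a b : ℝ × (ℝ × ℝ)) :
    leviCivitaMap κ μ ε b a = (ε * a.2.1 * b.2.1 - ε * κ * a.2.2 * b.2.2,
      (-(μ / 2) * a.1 * b.2.1 + ε * κ * a.2.2 * b.1, μ / 2 * a.1 * b.2.2 - ε * a.2.1 * b.1)) := by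
  simp only [leviCivitaMap, frameMap_apply, Prod.smul_mk, Prod.mk_add_mk, smul_eq_mul]
  ext <;> simp <;> ring

theorem leviCivitaMap_add (κ μ ε : ℝ) (b c : ℝ × (ℝ × ℝ)) :
    leviCivitaMap κ μ ε (b + c) = leviCivitaMap κ μ ε b + leviCivitaMap κ μ ε c := by
  refine ContinuousLinearMap.ext fun a => ?_
  rw [add_apply]
  simp only [leviCivitaMap_apply, Prod.fst_add, Prod.snd_add, Prod.mk_add_mk]
  ext <;> simp <;> ring

theorem leviCivitaMap_smul (κ μ ε t : ℝ) (b : ℝ × (ℝ × ℝ)) :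
    leviCivitaMap κ μ ε (t • b) = t • leviCivitaMap κ μ ε b := by
  refine ContinuousLinearMap.ext fun a => ?_
  rw [smul_apply]
  simp only [leviCivitaMap_apply, Prod.smul_fst, Prod.smul_snd, Prod.smul_mk, smul_eq_mul]
  ext <;> simp <;> ring

variable {F : E → (ℝ × (ℝ × ℝ)) ≃L[ℝ] E}
  (hF : ContDiff ℝ ∞ fun z => (F z : ℝ × (ℝ × ℝ) →L[ℝ] E))
  (hθ : ContDiff ℝ ∞ fun z => ((F z).symm : E →L[ℝ] ℝ × (ℝ × ℝ)))

include hθ in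
theorem differentiableAt_coframe {X : E → E} {z : E} (hX : DifferentiableAt ℝ X z) :
    DifferentiableAt ℝ (fun y => (F y).symm (X y)) z :=
  (hθ.differentiable (by simp) z).clm_apply hX

variable (F) in
/-- The derivative of a vector field in a frame, corrected by the Christoffel symbols of the model
Lie algebra. -/
def frameDerivative (κ μ ε : ℝ) (Y : E → E) (z : E) : E →L[ℝ] E :=
  (F z : ℝ × (ℝ × ℝ) →L[ℝ] E) ∘L (fderiv ℝ (fun y => (F y).symm (Y y)) z
    + leviCivitaMap κ μ ε ((F z).symm (Y z)) ∘L ((F z).symm : E →L[ℝ] ℝ × (ℝ × ℝ)))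

theorem coframe_frameDerivative (κ μ ε : ℝ) (Y : E → E) (z v : E) :
    (F z).symm (frameDerivative F κ μ ε Y z v) = fderiv ℝ (fun y => (F y).symm (Y y)) z v
      + leviCivitaMap κ μ ε ((F z).symm (Y z)) ((F z).symm v) := by
  simp [frameDerivative]

include hθ in
theorem frameDerivative_add (κ μ ε : ℝ) {Y Y' : E → E} {z : E} (hY : DifferentiableAt ℝ Y z)
    (hY' : DifferentiableAt ℝ Y' z) : frameDerivative F κ μ ε (Y + Y') z
      = frameDerivative F κ μ ε Y z + frameDerivative F κ μ ε Y' z := by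
  have h1 := differentiableAt_coframe hθ hY
  have h2 := differentiableAt_coframe hθ hY'
  refine ContinuousLinearMap.ext fun v => (F z).symm.injective ?_
  simp only [add_apply, map_add, coframe_frameDerivative, Pi.add_apply, leviCivitaMap_add]
  rw [fderiv_fun_add h1 h2, add_apply]
  abel

include hθ in
theorem frameDerivative_smul (κ μ ε : ℝ) {f : E → ℝ} {f' : E →L[ℝ] ℝ} {Y : E → E} {z : E}
    (hf : HasFDerivAt f f' z) (hY : DifferentiableAt ℝ Y z) :
    frameDerivative F κ μ ε (f • Y) z
      = f z • frameDerivative F κ μ ε Y z + f'.smulRight (Y z) := by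
  have h1 := differentiableAt_coframe hθ hY
  refine ContinuousLinearMap.ext fun v => (F z).symm.injective ?_
  simp only [add_apply, smul_apply, ContinuousLinearMap.smulRight_apply, map_add, map_smul,
    coframe_frameDerivative, Pi.smul_apply', leviCivitaMap_smul]
  rw [fderiv_fun_smul hf.differentiableAt h1, hf.fderiv]
  simp only [add_apply, smul_apply, ContinuousLinearMap.smulRight_apply, smul_add]
  abel

variable (F) in
/-- `frameDerivative` as a covariant derivative. -/
def frameConnection (κ μ ε : ℝ) :
    CovariantDerivative 𝓘(ℝ, E) E (TangentSpace 𝓘(ℝ, E) : E → Type _) where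
  toFun Y z := (frameDerivative F κ μ ε Y z :)
  isCovariantDerivativeOnUniv :=
    { add := fun hY hY' _ => frameDerivative_add hθ κ μ ε
        (differentiableAt_of_mdifferentiableAt_section hY)
        (differentiableAt_of_mdifferentiableAt_section hY')
      leibniz := fun hY hf _ => frameDerivative_smul hθ κ μ ε hf.hasMFDerivAt.hasFDerivAt
        (differentiableAt_of_mdifferentiableAt_section hY) }

-- `hd` is the Maurer–Cartan equation dθ(v, w) = −[θv, θw] for the coframe θ = F⁻¹. It is the only
-- link between the frame F and the model Lie algebra.
variable {κ μ ε : ℝ}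
  (hd : ∀ z v w, fderiv ℝ (fun z => ((F z).symm : E →L[ℝ] ℝ × (ℝ × ℝ))) z v w
    - fderiv ℝ (fun z => ((F z).symm : E →L[ℝ] ℝ × (ℝ × ℝ))) z w v
      = -semidirectBracket (kappaMuMap κ μ ε) ((F z).symm v) ((F z).symm w))

include hθ hd in
theorem coframe_mlieBracket {X Y : E → E} {z : E} (hX : DifferentiableAt ℝ X z)
    (hY : DifferentiableAt ℝ Y z) :
    (F z).symm (mlieBracket 𝓘(ℝ, E) X Y z) = fderiv ℝ (fun y => (F y).symm (Y y)) z (X z)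
      - fderiv ℝ (fun y => (F y).symm (X y)) z (Y z)
      + semidirectBracket (kappaMuMap κ μ ε) ((F z).symm (X z)) ((F z).symm (Y z)) := by
  have h := fderiv_oneForm_sub (hθ.differentiable (by simp) z) hX hY
  rw [hd] at h
  have h2 : (F z).symm (mlieBracket 𝓘(ℝ, E) X Y z) = (F z).symm (lieBracket ℝ X Y z) :=
    congrArg (F z).symm (mlieBracket_eq_lieBracket X Y z)
  rw [h2]
  simp only [ContinuousLinearEquiv.coe_coe] at h
  rw [← sub_eq_zero] at h ⊢
  rw [← h]
  abel

theorem ofFrame_g_apply (z v w : E) :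
    (ofFrame F hF hθ).g z v w = artinForm ((F z).symm v) ((F z).symm w) :=
  pullbackArtinForm_apply _ v w

theorem coframe_ofFrame_phi (z v : E) :
    (F z).symm ((ofFrame F hF hθ).phi z v) = artinPhi ((F z).symm v) :=
  (F z).symm_apply_apply _

theorem fderiv_fst_comp {y : E → ℝ × (ℝ × ℝ)} {z : E} (hy : DifferentiableAt ℝ y z) (v : E) :
    fderiv ℝ (fun q => (y q).1) z v = (fderiv ℝ y z v).1 := by
  rw [hy.hasFDerivAt.fst.fderiv]
  rfl

theorem fderiv_clm_comp_apply {G : Type*} [NormedAddCommGroup G] [NormedSpace ℝ G]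
    (T : ℝ × (ℝ × ℝ) →L[ℝ] G) {y : E → ℝ × (ℝ × ℝ)} {z : E}
    (hy : DifferentiableAt ℝ y z) (v : E) : fderiv ℝ (fun q => T (y q)) z v = T (fderiv ℝ y z v) :=
  congrArg (fun L : E →L[ℝ] G => L v) (T.hasFDerivAt.comp z hy.hasFDerivAt).fderiv

theorem fderiv_artinForm {y w : E → ℝ × (ℝ × ℝ)} {z : E} (hy : DifferentiableAt ℝ y z)
    (hw : DifferentiableAt ℝ w z) (v : E) : fderiv ℝ (fun q => artinForm (y q) (w q)) z v
      = artinForm (fderiv ℝ y z v) (w z) + artinForm (y z) (fderiv ℝ w z v) := by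
  rw [(artinForm.hasFDerivAt_of_bilinear hy.hasFDerivAt hw.hasFDerivAt).fderiv]
  simp
  ring

include hd in
theorem extDerivOneForm_ofFrame {X Y : E → E} {z : E} (hX : DifferentiableAt ℝ X z)
    (hY : DifferentiableAt ℝ Y z) : extDerivOneForm (ofFrame F hF hθ).eta X Y z = 0 := by
  have hx := differentiableAt_coframe hθ hX
  have hy := differentiableAt_coframe hθ hY
  have h : fderiv ℝ (fun q => ((F q).symm (Y q)).1) z (X z)
      - fderiv ℝ (fun q => ((F q).symm (X q)).1) z (Y z)
      - ((F z).symm (mlieBracket 𝓘(ℝ, E) X Y z)).1 = 0 := by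
    rw [coframe_mlieBracket hθ hd hX hY, fderiv_fst_comp hx, fderiv_fst_comp hy]
    simp [semidirectBracket]
  exact (congrArg₂ (fun a b => a - b - ((F z).symm (mlieBracket 𝓘(ℝ, E) X Y z)).1)
    (mvfderiv_apply_eq_fderiv _ z (X z)) (mvfderiv_apply_eq_fderiv _ z (Y z))).trans h

include hd in
-- Φ has constant coefficients in the frame, so the derivatives of the coordinates of X, Y, Z
-- cancel. The remaining algebraic sum vanishes because `kappaMuMap` has trace zero.
theorem extDerivTwoForm_ofFrame {X Y Z : E → E} {z : E} (hX : DifferentiableAt ℝ X z)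
    (hY : DifferentiableAt ℝ Y z) (hZ : DifferentiableAt ℝ Z z) :
    extDerivTwoForm (ofFrame F hF hθ).fundamentalForm X Y Z z = 0 := by
  have hx := differentiableAt_coframe hθ hX
  have hy := differentiableAt_coframe hθ hY
  have hz := differentiableAt_coframe hθ hZ
  have hΦ : ∀ q v w : E, (ofFrame F hF hθ).fundamentalForm q v w
      = artinForm ((F q).symm v) (artinPhi ((F q).symm w)) := fun q v w => by
    rw [← coframe_ofFrame_phi hF hθ q w]
    exact ofFrame_g_apply hF hθ q v ((ofFrame F hF hθ).phi q w)
  have hm : ∀ {V W : E → E}, DifferentiableAt ℝ (fun q => (F q).symm (V q)) z →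
      DifferentiableAt ℝ (fun q => (F q).symm (W q)) z → ∀ v : E,
      mvfderiv 𝓘(ℝ, E) (fun q : E => (ofFrame F hF hθ).fundamentalForm q (V q) (W q)) z v
        = artinForm (fderiv ℝ (fun q => (F q).symm (V q)) z v) (artinPhi ((F z).symm (W z)))
          + artinForm ((F z).symm (V z)) (artinPhi (fderiv ℝ (fun q => (F q).symm (W q)) z v)) :=
    fun {V W} hV hW v => by
      have h1 : DifferentiableAt ℝ (fun q => artinPhi ((F q).symm (W q))) z :=
        artinPhi.differentiableAt.comp z hW
      refine (mvfderiv_apply_eq_fderiv _ z v).trans ?_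
      rw [funext fun q => hΦ q (V q) (W q), fderiv_artinForm hV h1,
        fderiv_clm_comp_apply artinPhi hW]
  have key : ∀ {m₁ m₂ m₃ b₁ b₂ b₃ : ℝ},
      mvfderiv 𝓘(ℝ, E) (fun q : E => (ofFrame F hF hθ).fundamentalForm q (Y q) (Z q)) z (X z) = m₁ →
      mvfderiv 𝓘(ℝ, E) (fun q : E => (ofFrame F hF hθ).fundamentalForm q (Z q) (X q)) z (Y z) = m₂ →
      mvfderiv 𝓘(ℝ, E) (fun q : E => (ofFrame F hF hθ).fundamentalForm q (X q) (Y q)) z (Z z) = m₃ →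
      (ofFrame F hF hθ).fundamentalForm z (mlieBracket 𝓘(ℝ, E) X Y z) (Z z) = b₁ →
      (ofFrame F hF hθ).fundamentalForm z (mlieBracket 𝓘(ℝ, E) Y Z z) (X z) = b₂ →
      (ofFrame F hF hθ).fundamentalForm z (mlieBracket 𝓘(ℝ, E) Z X z) (Y z) = b₃ →
      extDerivTwoForm (ofFrame F hF hθ).fundamentalForm X Y Z z = m₁ + m₂ + m₃ - b₁ - b₂ - b₃ := by
    rintro _ _ _ _ _ _ rfl rfl rfl rfl rfl rfl
    rfl
  rw [key (hm hy hz _) (hm hz hx _) (hm hx hy _) (hΦ z _ _) (hΦ z _ _) (hΦ z _ _),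
    coframe_mlieBracket hθ hd hX hY, coframe_mlieBracket hθ hd hY hZ,
    coframe_mlieBracket hθ hd hZ hX]
  generalize fderiv ℝ (fun y => (F y).symm (X y)) z = dx
  generalize fderiv ℝ (fun y => (F y).symm (Y y)) z = dy
  generalize fderiv ℝ (fun y => (F y).symm (Z y)) z = dz
  simp only [artinForm_apply, artinPhi_apply, semidirectBracket, kappaMuMap, planeMap_apply,
    Prod.fst_add, Prod.snd_add, Prod.fst_sub, Prod.snd_sub, Prod.smul_mk, smul_eq_mul, Prod.mk_sub_mk]
  ring

include hd in
theorem isAlmostParacosymplectic_ofFrame : (ofFrame F hF hθ).IsAlmostParacosymplectic := by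
  intro U X Y Z hU hX hY hZ p hp
  have h : ∀ {X : Π x : E, TangentSpace 𝓘(ℝ, E) x}, CMDiff[U] ∞ (T% X) →
      DifferentiableAt ℝ (X : E → E) p := fun hX =>
    differentiableAt_of_mdifferentiableAt_section
      ((hX.contMDiffAt (hU.mem_nhds hp)).mdifferentiableAt (by simp))
  exact ⟨extDerivOneForm_ofFrame hF hθ hd (h hX) (h hY),
    extDerivTwoForm_ofFrame hF hθ hd (h hX) (h hY) (h hZ)⟩

include hθ hd in
-- After cancelling the derivative terms of `coframe_mlieBracket`, this is the identity ∇_a b − ∇_b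
-- a = [a, b] in the model Lie algebra.
theorem frameDerivative_sub {X Y : E → E} {z : E} (hX : DifferentiableAt ℝ X z)
    (hY : DifferentiableAt ℝ Y z) :
    frameDerivative F κ μ ε Y z (X z) - frameDerivative F κ μ ε X z (Y z)
      = (mlieBracket 𝓘(ℝ, E) X Y z : E) := by
  refine (F z).symm.injective (Eq.trans ?_ (coframe_mlieBracket hθ hd hX hY).symm)
  rw [map_sub, coframe_frameDerivative, coframe_frameDerivative]
  generalize fderiv ℝ (fun y => (F y).symm (Y y)) z (X z) = a
  generalize fderiv ℝ (fun y => (F y).symm (X y)) z (Y z) = b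
  simp only [leviCivitaMap_apply, semidirectBracket, kappaMuMap, planeMap_apply]
  ext <;> simp <;> ring

/-- The metric is constant in the frame, and b ↦ ∇_a b is skew for `artinForm`. -/
theorem mvfderiv_ofFrame_g {Y Z : E → E} {z : E} (hY : DifferentiableAt ℝ Y z)
    (hZ : DifferentiableAt ℝ Z z) (v : E) :
    mvfderiv 𝓘(ℝ, E) (fun q : E => (ofFrame F hF hθ).g q (Y q) (Z q)) z v
      = (ofFrame F hF hθ).g z (frameDerivative F κ μ ε Y z v) (Z z)
        + (ofFrame F hF hθ).g z (Y z) (frameDerivative F κ μ ε Z z v) := by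
  have hy := differentiableAt_coframe hθ hY
  have hz := differentiableAt_coframe hθ hZ
  refine (mvfderiv_apply_eq_fderiv _ z v).trans ?_
  refine Eq.trans ?_ (congrArg₂ (· + ·) (ofFrame_g_apply hF hθ z (frameDerivative F κ μ ε Y z v) (Z z))
    (ofFrame_g_apply hF hθ z (Y z) (frameDerivative F κ μ ε Z z v))).symm
  rw [funext fun q => ofFrame_g_apply hF hθ q (Y q) (Z q), fderiv_artinForm hy hz,
    coframe_frameDerivative, coframe_frameDerivative]
  generalize fderiv ℝ (fun y => (F y).symm (Y y)) z v = a
  generalize fderiv ℝ (fun y => (F y).symm (Z y)) z v = b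
  simp only [leviCivitaMap_apply, artinForm_apply, Prod.fst_add, Prod.snd_add]
  ring

include hd in
theorem isLeviCivita_frameConnection :
    IsLeviCivita (ofFrame F hF hθ).g (frameConnection F hθ κ μ ε) where
  torsion_free _ _ _ hX hY := frameDerivative_sub hθ hd
    (differentiableAt_of_mdifferentiableAt_section hX)
    (differentiableAt_of_mdifferentiableAt_section hY)
  metric X _ _ z _ hY hZ := mvfderiv_ofFrame_g hF hθ
    (differentiableAt_of_mdifferentiableAt_section hY)
    (differentiableAt_of_mdifferentiableAt_section hZ) (X z)

include hd in
-- φ is constant in the frame, so derivatives of the coordinates of X cancel, and h becomes half the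
-- commutator of ad ξ with φ.
theorem coframe_hTensor {X : E → E} {z : E} (hX : DifferentiableAt ℝ X z) :
    (F z).symm ((ofFrame F hF hθ).hTensor X z)
      = (0, (ε * κ * ((F z).symm (X z)).2.2, ε * ((F z).symm (X z)).2.1)) := by
  let ξ : E → E := fun q => F q (1, 0)
  let Z : E → E := fun q => F q (artinPhi ((F q).symm (X q)))
  have hx := differentiableAt_coframe hθ hX
  have hξ : DifferentiableAt ℝ ξ z :=
    (hF.differentiable (by simp) z).clm_apply (differentiableAt_const _)
  have hZ : DifferentiableAt ℝ Z z :=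
    (hF.differentiable (by simp) z).clm_apply (artinPhi.differentiableAt.comp z hx)
  obtain ⟨B, hB⟩ : ∃ B : E, B = mlieBracket 𝓘(ℝ, E) ξ X z := ⟨_, rfl⟩
  obtain ⟨B', hB'⟩ : ∃ B' : E, B' = mlieBracket 𝓘(ℝ, E) ξ Z z := ⟨_, rfl⟩
  have h1 := (congrArg (F z).symm hB).trans (coframe_mlieBracket hθ hd hξ hX)
  have h2 := (congrArg (F z).symm hB').trans (coframe_mlieBracket hθ hd hξ hZ)
  have e1 : (fun q => (F q).symm (ξ q)) = fun _ => (1, 0) :=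
    funext fun q => (F q).symm_apply_apply _
  have e2 : (fun q => (F q).symm (Z q)) = fun q => artinPhi ((F q).symm (X q)) :=
    funext fun q => (F q).symm_apply_apply _
  rw [e1, congrFun e1 z] at h1
  rw [e1, e2, congrFun e1 z, congrFun e2 z, fderiv_clm_comp_apply artinPhi hx] at h2
  have h3 : ((ofFrame F hF hθ).hTensor X z : E)
      = (1 / 2 : ℝ) • (B' - F z (artinPhi ((F z).symm B))) := by
    rw [hB, hB']
    rfl
  refine (congrArg (F z).symm h3).trans ?_
  rw [map_smul, map_sub, (F z).symm_apply_apply, h2, h1]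
  generalize fderiv ℝ (fun y => (F y).symm (X y)) z (ξ z) = a
  simp only [artinPhi_apply, semidirectBracket, kappaMuMap, planeMap_apply]
  ext <;> simp <;> ring

include hd in
-- In the frame, ∇ξ is the constant endomorphism `leviCivitaMap κ μ ε (1, 0)`, seen as a function of
-- the direction. The derivatives of the coordinates of X and Y therefore cancel against those in
-- [X, Y], and an identity in the Lie algebra remains.
theorem curvatureOp_frameConnection (hε : ε = 1 ∨ ε = -1) {X Y : E → E} {z : E}
    (hX : DifferentiableAt ℝ X z) (hY : DifferentiableAt ℝ Y z) {H H' : E}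
    (hH : (ofFrame F hF hθ).hTensor X z = H) (hH' : (ofFrame F hF hθ).hTensor Y z = H') :
    (curvatureOp (frameConnection F hθ κ μ ε) X Y (ofFrame F hF hθ).xi z : E)
      = κ • (((F z).symm (Y z)).1 • X z - ((F z).symm (X z)).1 • Y z)
        + μ • (((F z).symm (Y z)).1 • H - ((F z).symm (X z)).1 • H') := by
  let ξ : E → E := fun q => F q (1, 0)
  have e1 : (fun q => (F q).symm (ξ q)) = fun _ => (1, 0) :=
    funext fun q => (F q).symm_apply_apply _
  have e2 : ∀ q v : E, (F q).symm (frameDerivative F κ μ ε ξ q v)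
      = leviCivitaMap κ μ ε (1, 0) ((F q).symm v) := fun q v => by
    rw [coframe_frameDerivative, e1, congrFun e1 q]
    simp
  have e3 : ∀ {V : E → E}, DifferentiableAt ℝ V z → ∀ w : E,
      (F z).symm (frameDerivative F κ μ ε (fun q => frameDerivative F κ μ ε ξ q (V q)) z w)
      = leviCivitaMap κ μ ε (1, 0) (fderiv ℝ (fun q => (F q).symm (V q)) z w)
        + leviCivitaMap κ μ ε (leviCivitaMap κ μ ε (1, 0) ((F z).symm (V z)))
          ((F z).symm w) := fun {V} hV w => by
    rw [coframe_frameDerivative]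
    simp only [e2]
    rw [fderiv_clm_comp_apply _ (differentiableAt_coframe hθ hV)]
  have hε2 : ε * ε = 1 := by rcases hε with rfl | rfl <;> norm_num
  obtain ⟨B, hB⟩ : ∃ B : E, B = mlieBracket 𝓘(ℝ, E) X Y z := ⟨_, rfl⟩
  have hL : (curvatureOp (frameConnection F hθ κ μ ε) X Y (ofFrame F hF hθ).xi z : E)
      = frameDerivative F κ μ ε (fun q => frameDerivative F κ μ ε ξ q (Y q)) z (X z)
        - frameDerivative F κ μ ε (fun q => frameDerivative F κ μ ε ξ q (X q)) z (Y z)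
        - frameDerivative F κ μ ε ξ z B := by
    rw [hB]
    rfl
  have hb := (congrArg (F z).symm hB).trans (coframe_mlieBracket hθ hd hX hY)
  have h1 : (F z).symm H = _ := (congrArg (F z).symm hH).symm.trans (coframe_hTensor hF hθ hd hX)
  have h2 : (F z).symm H' = _ := (congrArg (F z).symm hH').symm.trans (coframe_hTensor hF hθ hd hY)
  rw [hL]
  refine (F z).symm.injective ?_
  simp only [map_add, map_sub, map_smul]
  rw [e3 hX, e3 hY, e2, hb, h1, h2]
  generalize fderiv ℝ (fun y => (F y).symm (X y)) z (Y z) = a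
  generalize fderiv ℝ (fun y => (F y).symm (Y y)) z (X z) = b
  generalize (F z).symm (X z) = x
  generalize (F z).symm (Y z) = y
  simp only [leviCivitaMap_apply, semidirectBracket, kappaMuMap, planeMap_apply]
  ext
  · simp
    ring
  · simp
    -- The curvature produces ε²κ, from the product of the coefficients ε and −εκ; here ε² = 1
    -- enters.
    linear_combination (κ * (y.1 * x.2.1 - x.1 * y.2.1)) * hε2
  · simp
    linear_combination (κ * (y.1 * x.2.2 - x.1 * y.2.2)) * hε2

include hd in
theorem isKappaMuSpace_ofFrame (hε : ε = 1 ∨ ε = -1) : (ofFrame F hF hθ).IsKappaMuSpace κ μ := by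
  refine ⟨frameConnection F hθ κ μ ε, isLeviCivita_frameConnection hF hθ hd, ?_⟩
  intro U X Y hU hX hY p hp
  have h : ∀ {X : Π x : E, TangentSpace 𝓘(ℝ, E) x}, CMDiff[U] ∞ (T% X) →
      DifferentiableAt ℝ (X : E → E) p := fun hX =>
    differentiableAt_of_mdifferentiableAt_section
      ((hX.contMDiffAt (hU.mem_nhds hp)).mdifferentiableAt (by simp))
  exact curvatureOp_frameConnection hF hθ hd hε (h hX) (h hY) rfl rfl

theorem isArtinFrameOn_ofFrame : (ofFrame F hF hθ).IsArtinFrameOn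
    (fun z => F z (0, (1, 0))) (fun z => F z (0, (0, 1))) Set.univ := by
  refine .of_phi_eq (fun z _ => ?_) (fun z _ => ?_) (fun z _ => ?_) (fun z _ => ?_) (fun z _ => ?_)
  · exact (contMDiffAt_vectorSpace_iff_contDiffAt.mpr
      (hF.contDiffAt.clm_apply contDiffAt_const)).contMDiffWithinAt
  · exact (contMDiffAt_vectorSpace_iff_contDiffAt.mpr
      (hF.contDiffAt.clm_apply contDiffAt_const)).contMDiffWithinAt
  · refine (F z).symm.injective ((coframe_ofFrame_phi hF hθ z _).trans ?_)
    simp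
  · refine (F z).symm.injective ((coframe_ofFrame_phi hF hθ z _).trans ?_)
    refine Eq.trans ?_ (map_neg (F z).symm (F z (0, (0, 1)))).symm
    simp
  · refine (ofFrame_g_apply hF hθ z _ _).trans ?_
    simp

include hF hθ hd in
theorem mlieBracket_frame (a b : ℝ × (ℝ × ℝ)) (z : E) :
    mlieBracket 𝓘(ℝ, E) (fun z : E => F z a) (fun z : E => F z b) z
      = F z (semidirectBracket (kappaMuMap κ μ ε) a b) := by
  have h : ∀ c : ℝ × (ℝ × ℝ), DifferentiableAt ℝ (fun z => F z c) z := fun c =>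
    (hF.differentiable (by simp) z).clm_apply (differentiableAt_const _)
  refine (F z).symm.injective ((coframe_mlieBracket hθ hd (h a) (h b)).trans ?_)
  simp

include hd in
theorem hasCommutatorsOn_ofFrame : (ofFrame F hF hθ).HasCommutatorsOn
    (fun z => F z (0, (1, 0))) (fun z => F z (0, (0, 1))) Set.univ κ μ ε (fun _ => 0) where
  one_two z _ := (mlieBracket_frame hF hθ hd (0, (1, 0)) (0, (0, 1)) z).trans <| by
    have h : F z (semidirectBracket (kappaMuMap κ μ ε) (0, (1, 0)) (0, (0, 1)))
        = (-0 : ℝ) • F z (0, (0, 1)) := by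
      simp [semidirectBracket]
    exact h
  xi_one z _ := (mlieBracket_frame hF hθ hd (1, 0) (0, (1, 0)) z).trans <| by
    have h : F z (semidirectBracket (kappaMuMap κ μ ε) (1, 0) (0, (1, 0)))
        = -(μ / 2) • F z (0, (1, 0)) + ε • F z (0, (0, 1)) := by
      rw [← map_smul, ← map_smul, ← map_add]
      simp [semidirectBracket, kappaMuMap]
    exact h
  xi_two z _ := (mlieBracket_frame hF hθ hd (1, 0) (0, (0, 1)) z).trans <| by
    have h : F z (semidirectBracket (kappaMuMap κ μ ε) (1, 0) (0, (0, 1)))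
        = -(ε * κ) • F z (0, (1, 0)) + (μ / 2) • F z (0, (0, 1)) := by
      rw [← map_smul, ← map_smul, ← map_add]
      simp [semidirectBracket, kappaMuMap]
    exact h

end FrameStructure

/-! ### Maps between Artin frames -/

namespace AlmostParacontactMetric

variable {E : Type*} [NormedAddCommGroup E] [NormedSpace ℝ E]
  {M : Type*} [TopologicalSpace M] [ChartedSpace E M] [IsManifold 𝓘(ℝ, E) ∞ M]
  {E' : Type*} [NormedAddCommGroup E'] [NormedSpace ℝ E']
  {M' : Type*} [TopologicalSpace M'] [ChartedSpace E' M'] [IsManifold 𝓘(ℝ, E') ∞ M']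
  {S : AlmostParacontactMetric E M} {S' : AlmostParacontactMetric E' M'}

/-- A map whose differential carries an Artin frame to an Artin frame preserves the structure. -/
theorem IsArtinFrameOn.preservedAt {E₁ E₂ : Π x : M, TangentSpace 𝓘(ℝ, E) x} {U : Set M}
    (hE : S.IsArtinFrameOn E₁ E₂ U) {x : M} (hx : x ∈ U)
    {E₁' E₂' : Π x : M', TangentSpace 𝓘(ℝ, E') x} {U' : Set M'}
    (hE' : S'.IsArtinFrameOn E₁' E₂' U') {f : M → M'} (hfx : f x ∈ U')
    (h0 : mfderiv 𝓘(ℝ, E) 𝓘(ℝ, E') f x (S.xi x) = S'.xi (f x))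
    (h1 : mfderiv 𝓘(ℝ, E) 𝓘(ℝ, E') f x (E₁ x) = E₁' (f x))
    (h2 : mfderiv 𝓘(ℝ, E) 𝓘(ℝ, E') f x (E₂ x) = E₂' (f x)) : S.PreservedAt S' f x := by
  have hv : ∀ v, mfderiv 𝓘(ℝ, E) 𝓘(ℝ, E') f x v
      = S.eta x v • S'.xi (f x) + S.g x v (E₂ x) • E₁' (f x) + S.g x v (E₁ x) • E₂' (f x) :=
    fun v => by
      conv_lhs => rw [hE.expand hx v]
      rw [map_add, map_add, map_smul, map_smul, map_smul, h0, h1, h2]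
  have hη : ∀ v, S'.eta (f x) (mfderiv 𝓘(ℝ, E) 𝓘(ℝ, E') f x v) = S.eta x v := fun v => by
    rw [hv]
    simp [S'.eta_xi, hE'.eta_one hfx, hE'.eta_two hfx]
  refine ⟨fun v => ?_, h0, hη, fun v w => ?_⟩
  · rw [hv, hv v]
    simp only [map_add, map_smul, S'.phi_xi, hE'.phi_one _ hfx, hE'.phi_two _ hfx, S.eta_phi,
      S.g_phi_left, hE.phi_one x hx, hE.phi_two x hx, map_neg, neg_neg]
    module
  · rw [hv v]
    have h0' := hη w
    have h1' : S'.g (f x) (E₁' (f x)) (mfderiv 𝓘(ℝ, E) 𝓘(ℝ, E') f x w) = S.g x w (E₁ x) := by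
      rw [hv w]
      simp [S'.g_xi_right, hE'.eta_one hfx, hE'.g_one_one hfx, hE'.g_one_two _ hfx]
    have h2' : S'.g (f x) (E₂' (f x)) (mfderiv 𝓘(ℝ, E) 𝓘(ℝ, E') f x w) = S.g x w (E₂ x) := by
      rw [hv w]
      simp [S'.g_xi_right, hE'.eta_two hfx, hE'.g_two_two hfx, hE'.g_two_one hfx]
    simp only [map_add, map_smul, add_apply, smul_apply, smul_eq_mul, S'.g_xi, h0', h1', h2']
    conv_rhs => rw [hE.expand hx v]
    simp only [map_add, map_smul, add_apply, smul_apply, smul_eq_mul, S.g_xi,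
      S.g_symm x (E₁ x) w, S.g_symm x (E₂ x) w]

end AlmostParacontactMetric

/-! ### Left-invariant models on ℝ ⋉ ℝ² -/

section LieGroupModel

open AlmostParacontactMetric

variable {A : PlaneFlow} {B : ℝ × ℝ →L[ℝ] ℝ × ℝ}

/-- Differentiate A(t)A(s) = A(s)A(t) at t = 0. -/
theorem PlaneFlow.generator_comm (hA : ∀ s, HasDerivAt A.map (A.map s ∘L B) s) (s : ℝ)
    (v : ℝ × ℝ) : B (A.map s v) = A.map s (B v) := by
  have h0 : ∀ w, HasDerivAt (fun t => A.map t w) (B w) 0 := fun w => by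
    have h := (hA 0).clm_apply (hasDerivAt_const (0 : ℝ) w)
    simpa [A.map_zero] using h
  have h1 := h0 (A.map s v)
  have h2 : HasDerivAt (fun t => A.map s (A.map t v)) (A.map s (B v)) 0 :=
    (A.map s).hasFDerivAt.comp_hasDerivAt 0 (h0 v)
  have h3 : (fun t => A.map t (A.map s v)) = fun t => A.map s (A.map t v) :=
    funext fun t => by rw [← A.map_add, ← A.map_add, add_comm]
  rw [h3] at h1
  exact h1.unique h2

variable {lam : ℝ} (hl : lam ≠ 0) (P : (ℝ × ℝ) ≃L[ℝ] ℝ × ℝ)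

theorem PlaneFlow.contDiff_frameEquivAt :
    ContDiff ℝ ∞ fun z : ℝ × (ℝ × ℝ) =>
      (A.frameEquivAt hl P z.1 : ℝ × (ℝ × ℝ) →L[ℝ] ℝ × (ℝ × ℝ)) := by
  rw [contDiff_clm_apply_iff]
  intro c
  have h : ContDiff ℝ ∞ fun z : ℝ × (ℝ × ℝ) => (lam * c.1, A.map z.1 (P c.2)) :=
    contDiff_const.prodMk ((A.smooth.comp contDiff_fst).clm_apply contDiff_const)
  convert h using 2 with z
  exact A.frameAt_apply lam P z.1 c

theorem PlaneFlow.contDiff_frameEquivAt_symm :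
    ContDiff ℝ ∞ fun z : ℝ × (ℝ × ℝ) =>
      ((A.frameEquivAt hl P z.1).symm : ℝ × (ℝ × ℝ) →L[ℝ] ℝ × (ℝ × ℝ)) := by
  rw [contDiff_clm_apply_iff]
  intro c
  have h : ContDiff ℝ ∞ fun z : ℝ × (ℝ × ℝ) => (lam⁻¹ * c.1, P.symm (A.map (-z.1) c.2)) :=
    contDiff_const.prodMk (P.symm.contDiff.comp
      ((A.smooth.comp contDiff_fst.neg).clm_apply contDiff_const))
  convert h using 2 with z
  exact A.coframeAt_apply lam P.symm z.1 c

/-- The coframe at (s, x) sends w to (λ⁻¹w₁, P⁻¹A(−s)w₂), so only A(−s) is differentiated. This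
yields −B, which commutes with A(−s), and DP⁻¹ = λP⁻¹B turns it into D. Antisymmetrizing gives the
Maurer–Cartan equation. -/
theorem PlaneFlow.fderiv_coframe {D : ℝ × ℝ →L[ℝ] ℝ × ℝ}
    (hA : ∀ s, HasDerivAt A.map (A.map s ∘L B) s) (hPD : ∀ v, P (D v) = lam • B (P v))
    (z v w : ℝ × (ℝ × ℝ)) :
    fderiv ℝ (fun z : ℝ × (ℝ × ℝ) => ((A.frameEquivAt hl P z.1).symm :
      ℝ × (ℝ × ℝ) →L[ℝ] ℝ × (ℝ × ℝ))) z v w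
      = -(0, (((A.frameEquivAt hl P z.1).symm v).1) • D ((A.frameEquivAt hl P z.1).symm w).2) := by
  have h1 := fderiv_clm_apply
    ((A.contDiff_frameEquivAt_symm hl P).differentiable (by simp) z) (differentiableAt_const w)
  have h2 : fderiv ℝ (fun z : ℝ × (ℝ × ℝ) => ((A.frameEquivAt hl P z.1).symm :
      ℝ × (ℝ × ℝ) →L[ℝ] ℝ × (ℝ × ℝ)) w) z v = fderiv ℝ (fun z : ℝ × (ℝ × ℝ) =>
        ((A.frameEquivAt hl P z.1).symm : ℝ × (ℝ × ℝ) →L[ℝ] ℝ × (ℝ × ℝ))) z v w := by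
    rw [h1]
    simp
  rw [← h2]
  have h3 : HasFDerivAt (fun z : ℝ × (ℝ × ℝ) => A.map (-z.1) w.2) _ z :=
    (((hA (-z.1)).hasFDerivAt.comp z hasFDerivAt_fst.neg).clm_apply (hasFDerivAt_const w.2 z))
  have h4 : HasFDerivAt (fun z : ℝ × (ℝ × ℝ) => (lam⁻¹ * w.1, P.symm (A.map (-z.1) w.2))) _ z :=
    (hasFDerivAt_const (lam⁻¹ * w.1) z).prodMk (P.symm.hasFDerivAt.comp z h3)
  have h5 : (fun z : ℝ × (ℝ × ℝ) => ((A.frameEquivAt hl P z.1).symm :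
      ℝ × (ℝ × ℝ) →L[ℝ] ℝ × (ℝ × ℝ)) w)
      = fun z : ℝ × (ℝ × ℝ) => (lam⁻¹ * w.1, P.symm (A.map (-z.1) w.2)) :=
    funext fun z => A.coframeAt_apply lam P.symm z.1 w
  have h6 : ∀ u, (A.frameEquivAt hl P z.1).symm u = (lam⁻¹ * u.1, P.symm (A.map (-z.1) u.2)) :=
    fun u => A.coframeAt_apply lam P.symm z.1 u
  have h7 : ∀ u, D (P.symm u) = lam • P.symm (B u) := fun u => by
    refine P.injective ?_
    rw [hPD, map_smul, P.apply_symm_apply, P.apply_symm_apply]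
  rw [h5, h4.fderiv, h6, h6, h7, PlaneFlow.generator_comm hA, smul_smul, mul_right_comm,
    inv_mul_cancel₀ hl, one_mul]
  simp

theorem PlaneFlow.fderiv_coframe_sub {D : ℝ × ℝ →L[ℝ] ℝ × ℝ}
    (hA : ∀ s, HasDerivAt A.map (A.map s ∘L B) s) (hPD : ∀ v, P (D v) = lam • B (P v))
    (z v w : ℝ × (ℝ × ℝ)) :
    fderiv ℝ (fun z : ℝ × (ℝ × ℝ) => ((A.frameEquivAt hl P z.1).symm :
      ℝ × (ℝ × ℝ) →L[ℝ] ℝ × (ℝ × ℝ))) z v w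
      - fderiv ℝ (fun z : ℝ × (ℝ × ℝ) => ((A.frameEquivAt hl P z.1).symm :
        ℝ × (ℝ × ℝ) →L[ℝ] ℝ × (ℝ × ℝ))) z w v
      = -semidirectBracket D ((A.frameEquivAt hl P z.1).symm v)
          ((A.frameEquivAt hl P z.1).symm w) := by
  rw [A.fderiv_coframe hl P hA hPD, A.fderiv_coframe hl P hA hPD, semidirectBracket]
  ext <;> simp <;> ring

variable (A) in
/-- The left-invariant almost paracontact metric structure on `ℝ ⋉ ℝ²` with Artin frame
`(lam, 0), (0, P e₁), (0, P e₂)` at the identity. -/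
def PlaneFlow.model : AlmostParacontactMetric (ℝ × (ℝ × ℝ)) (FlowGroup A) :=
  ofFrame (E := ℝ × (ℝ × ℝ)) (fun z => A.frameEquivAt hl P z.1) (A.contDiff_frameEquivAt hl P)
    (A.contDiff_frameEquivAt_symm hl P)

theorem FlowGroup.mfderiv_mul_left (a x : FlowGroup A) (v : ℝ × (ℝ × ℝ)) :
    (mfderiv 𝓘(ℝ, ℝ × (ℝ × ℝ)) 𝓘(ℝ, ℝ × (ℝ × ℝ)) (fun y => a * y) x v : ℝ × (ℝ × ℝ))
      = (v.1, A.map a.1 v.2) := by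
  let L : ℝ × (ℝ × ℝ) →L[ℝ] ℝ × (ℝ × ℝ) := (ContinuousLinearMap.fst ℝ ℝ (ℝ × ℝ)).prod
    (A.map a.1 ∘L ContinuousLinearMap.snd ℝ ℝ (ℝ × ℝ))
  have h : ∀ z : ℝ × (ℝ × ℝ), HasFDerivAt
      (fun y : ℝ × (ℝ × ℝ) => (a.1 + y.1, a.2 + A.map a.1 y.2)) L z := fun z =>
    (hasFDerivAt_fst.const_add a.1).prodMk
      (((A.map a.1).hasFDerivAt.comp z hasFDerivAt_snd).const_add a.2)
  exact congrArg (fun T : ℝ × (ℝ × ℝ) →L[ℝ] ℝ × (ℝ × ℝ) => T v) (h x).hasMFDerivAt.mfderiv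

theorem FlowGroup.mulInvariantVectorField_apply (w : ℝ × ℝ) (x : FlowGroup A) :
    (mulInvariantVectorField (I := 𝓘(ℝ, ℝ × (ℝ × ℝ))) (G := FlowGroup A)
      ((0, w) : ℝ × (ℝ × ℝ)) x : ℝ × (ℝ × ℝ)) = (0, A.map x.1 w) :=
  FlowGroup.mfderiv_mul_left x 1 (0, w)

theorem PlaneFlow.mulInvariantVectorField_frame (c : ℝ × ℝ) :
    (mulInvariantVectorField ((0, P c) : ℝ × (ℝ × ℝ)) :
      Π x : FlowGroup A, TangentSpace 𝓘(ℝ, ℝ × (ℝ × ℝ)) x)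
      = fun x : FlowGroup A => (A.frameEquivAt hl P x.1 (0, c) :) := by
  funext x
  refine (FlowGroup.mulInvariantVectorField_apply (P c) x).trans ?_
  have h : (0, A.map x.1 (P c)) = A.frameAt lam P x.1 (0, c) := by simp
  exact h

theorem PlaneFlow.isArtinFrameOn_model : (A.model hl P).IsArtinFrameOn
    (mulInvariantVectorField ((0, P (1, 0)) : ℝ × (ℝ × ℝ)))
    (mulInvariantVectorField ((0, P (0, 1)) : ℝ × (ℝ × ℝ))) Set.univ := by
  rw [PlaneFlow.mulInvariantVectorField_frame hl P, PlaneFlow.mulInvariantVectorField_frame hl P]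
  exact isArtinFrameOn_ofFrame (A.contDiff_frameEquivAt hl P) (A.contDiff_frameEquivAt_symm hl P)

/-- Left translation by a maps the frame at first coordinate x.1 to the one at a.1 + x.1, by the
group law of A; a map matching Artin frames preserves the structure. -/
theorem PlaneFlow.model_preservedAt_mul_left (a x : FlowGroup A) :
    (A.model hl P).PreservedAt (A.model hl P) (fun y => a * y) x := by
  have hF := PlaneFlow.isArtinFrameOn_model (A := A) hl P
  have h : ∀ c, (mfderiv 𝓘(ℝ, ℝ × (ℝ × ℝ)) 𝓘(ℝ, ℝ × (ℝ × ℝ)) (fun y => a * y) x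
      (A.frameEquivAt hl P x.1 c) : ℝ × (ℝ × ℝ)) = A.frameEquivAt hl P (a.1 + x.1) c := fun c => by
    refine (FlowGroup.mfderiv_mul_left a x _).trans ?_
    have h1 : ∀ s, A.frameEquivAt hl P s c = (lam * c.1, A.map s (P c.2)) := fun s =>
      A.frameAt_apply lam P s c
    rw [h1, h1, A.map_add]
  refine hF.preservedAt (Set.mem_univ _) hF (Set.mem_univ _) (h (1, 0)) ?_ ?_
  · rw [PlaneFlow.mulInvariantVectorField_frame hl P]
    exact h _
  · rw [PlaneFlow.mulInvariantVectorField_frame hl P]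
    exact h _

theorem PlaneFlow.isLieGroupModel_model {κ μ ε : ℝ} (hε : ε = 1 ∨ ε = -1)
    (hA : ∀ s, HasDerivAt A.map (A.map s ∘L B) s)
    (hPD : ∀ v, P (kappaMuMap κ μ ε v) = lam • B (P v)) :
    IsLieGroupModel (A.model hl P) κ μ ε where
  left_invariant := PlaneFlow.model_preservedAt_mul_left hl P
  almost_paracosymplectic := isAlmostParacosymplectic_ofFrame _ _ (A.fderiv_coframe_sub hl P hA hPD)
  kappa_mu := isKappaMuSpace_ofFrame _ _ (A.fderiv_coframe_sub hl P hA hPD) hε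
  frame := by
    refine ⟨_, _, PlaneFlow.isArtinFrameOn_model hl P, ?_⟩
    rw [PlaneFlow.mulInvariantVectorField_frame hl P, PlaneFlow.mulInvariantVectorField_frame hl P]
    exact hasCommutatorsOn_ofFrame _ _ (A.fderiv_coframe_sub hl P hA hPD)

variable {E : Type*} [NormedAddCommGroup E] [NormedSpace ℝ E] [CompleteSpace E]
  {M : Type*} [TopologicalSpace M] [ChartedSpace E M] [IsManifold 𝓘(ℝ, E) ∞ M]

theorem AlmostParacontactMetric.HasCommutatorsOn.isLocallyModelledAt
    {S : AlmostParacontactMetric E M} {E₁ E₂ : Π x : M, TangentSpace 𝓘(ℝ, E) x} {U : Set M}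
    {κ μ ε : ℝ} {b : M → ℝ} (hc : S.HasCommutatorsOn E₁ E₂ U κ μ ε b)
    (hF : S.IsArtinFrameOn E₁ E₂ U) (hU : IsOpen U) {p : M} (hp : p ∈ U) (hb : ∀ q ∈ U, b q = 0)
    (hε : ε = 1 ∨ ε = -1) (hA : ∀ s, HasDerivAt A.map (A.map s ∘L B) s) (hl : lam ≠ 0)
    (P : (ℝ × ℝ) ≃L[ℝ] ℝ × ℝ) (hPD : ∀ v, P (kappaMuMap κ μ ε v) = lam • B (P v)) :
    IsLocallyModelledAt S A κ μ p := by
  obtain ⟨ψ, hpψ, hψU, hψ⟩ := exists_partialDiffeomorph_of_frame A hA hl P hPD hU hp hF.frame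
    (fun q hq => by rw [hc.xi_one q hq]; simp [kappaMuMap])
    (fun q hq => by rw [hc.xi_two q hq]; simp [kappaMuMap])
    (fun q hq => by rw [hc.one_two q hq, hb q hq, neg_zero, zero_smul])
  refine ⟨ε, A.model hl P, ψ, hε, PlaneFlow.isLieGroupModel_model hl P hε hA hPD, hpψ,
    fun x hx => ?_⟩
  obtain ⟨h0, h1, h2⟩ := hψ x hx
  refine hF.preservedAt (hψU hx) (PlaneFlow.isArtinFrameOn_model hl P) (Set.mem_univ _) h0 ?_ ?_
  · rw [PlaneFlow.mulInvariantVectorField_frame hl P]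
    exact h1
  · rw [PlaneFlow.mulInvariantVectorField_frame hl P]
    exact h2

end LieGroupModel

/-! ### The three flows, conjugacy of generators, and the invariant F -/

section PlaneFlows

theorem hasDerivAt_planeMap {a b c d : ℝ → ℝ} {a' b' c' d' s : ℝ} (ha : HasDerivAt a a' s)
    (hb : HasDerivAt b b' s) (hc : HasDerivAt c c' s) (hd : HasDerivAt d d' s) :
    HasDerivAt (fun t => planeMap (a t) (b t) (c t) (d t)) (planeMap a' b' c' d') s := by
  have h : ∀ a b c d : ℝ, planeMap a b c d = a • planeMap 1 0 0 0 + b • planeMap 0 1 0 0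
      + c • planeMap 0 0 1 0 + d • planeMap 0 0 0 1 := fun a b c d => by
    refine ContinuousLinearMap.ext fun v => ?_
    simp [planeMap_apply]
  rw [funext fun t => h (a t) (b t) (c t) (d t), h a' b' c' d']
  exact (((ha.smul_const (planeMap 1 0 0 0)).add (hb.smul_const (planeMap 0 1 0 0))).add
    (hc.smul_const (planeMap 0 0 1 0))).add (hd.smul_const (planeMap 0 0 0 1))

theorem hasDerivAt_rotationFlow (s : ℝ) :
    HasDerivAt rotationFlow.map (rotationFlow.map s ∘L planeMap 0 (-1) 1 0) s := by
  refine (hasDerivAt_planeMap (Real.hasDerivAt_cos s) (Real.hasDerivAt_sin s).neg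
    (Real.hasDerivAt_sin s) (Real.hasDerivAt_cos s)).congr_deriv
    (ContinuousLinearMap.ext fun v => ?_)
  simp only [rotationFlow, ContinuousLinearMap.comp_apply, planeMap_apply]
  ext <;> simp <;> ring

theorem hasDerivAt_boostFlow (s : ℝ) :
    HasDerivAt boostFlow.map (boostFlow.map s ∘L planeMap 0 1 1 0) s := by
  refine (hasDerivAt_planeMap (Real.hasDerivAt_cosh s) (Real.hasDerivAt_sinh s)
    (Real.hasDerivAt_sinh s) (Real.hasDerivAt_cosh s)).congr_deriv
    (ContinuousLinearMap.ext fun v => ?_)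
  simp only [boostFlow, ContinuousLinearMap.comp_apply, planeMap_apply]
  ext <;> simp <;> ring

theorem hasDerivAt_shearFlow (s : ℝ) :
    HasDerivAt shearFlow.map (shearFlow.map s ∘L planeMap 0 1 0 0) s := by
  refine (hasDerivAt_planeMap (hasDerivAt_const s (1 : ℝ)) (hasDerivAt_id s)
    (hasDerivAt_const s (0 : ℝ)) (hasDerivAt_const s (1 : ℝ))).congr_deriv
    (ContinuousLinearMap.ext fun v => ?_)
  simp only [shearFlow, ContinuousLinearMap.comp_apply, planeMap_apply]
  ext <;> simp

/-- The linear map `D` is conjugate to a nonzero multiple of the infinitesimal generator of `A`. -/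
def PlaneFlow.HasConjugateGenerator (A : PlaneFlow) (D : ℝ × ℝ →L[ℝ] ℝ × ℝ) : Prop :=
  ∃ (B : ℝ × ℝ →L[ℝ] ℝ × ℝ) (lam : ℝ) (P : (ℝ × ℝ) ≃L[ℝ] ℝ × ℝ),
    (∀ s, HasDerivAt A.map (A.map s ∘L B) s) ∧ lam ≠ 0 ∧ ∀ v, P (D v) = lam • B (P v)

/-- Take Pv = (v₁, τ(Dv)₁) with D = `kappaMuMap κ μ ε`; it is invertible because the off-diagonal
entry −εκ of D is nonzero. As D² = ((μ/2)² − κ)·1, in these coordinates D is the off-diagonal matrix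
with entries τ⁻¹ and τ((μ/2)² − κ), and `h1`, `h2` equate them to λσ and λρ. -/
theorem exists_conj_kappaMuMap {κ μ ε lam σ ρ τ : ℝ} (hκ : κ ≠ 0) (hε : ε * ε = 1)
    (h1 : lam * σ * τ = 1) (h2 : τ * ((μ / 2) ^ 2 - κ) = lam * ρ) :
    ∃ P : (ℝ × ℝ) ≃L[ℝ] ℝ × ℝ, ∀ v, P (kappaMuMap κ μ ε v) = lam • planeMap 0 σ ρ 0 (P v) := by
  have hε0 : ε ≠ 0 := left_ne_zero_of_mul_eq_one hε
  have hτ : τ ≠ 0 := right_ne_zero_of_mul_eq_one h1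
  refine ⟨.equivOfInverse (planeMap 1 0 (-(τ * (μ / 2))) (-(τ * (ε * κ))))
    (planeMap 1 0 (-(μ / 2) / (ε * κ)) (-1 / (τ * (ε * κ)))) (fun v => ?_) (fun v => ?_),
    fun v => ?_⟩
  · simp only [planeMap_apply]
    ext
    · simp
    · simp
      field_simp
      ring
  · simp only [planeMap_apply]
    ext
    · simp
    · simp
      field_simp
      ring
  · simp only [ContinuousLinearEquiv.equivOfInverse_apply, kappaMuMap, planeMap_apply,
      Prod.smul_mk, smul_eq_mul]
    ext
    · simp only
      linear_combination (μ / 2 * v.1 + ε * κ * v.2) * h1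
    · simp only
      linear_combination v.1 * h2 - τ * κ * v.1 * hε

theorem rotationFlow_hasConjugateGenerator {κ μ ε : ℝ} (hκ : κ ≠ 0) (hε : ε = 1 ∨ ε = -1)
    (h : (μ / 2) ^ 2 < κ) : rotationFlow.HasConjugateGenerator (kappaMuMap κ μ ε) := by
  have hd : 0 < κ - (μ / 2) ^ 2 := sub_pos.mpr h
  have hl : √(κ - (μ / 2) ^ 2) ≠ 0 := (Real.sqrt_pos.mpr hd).ne'
  have hs := Real.mul_self_sqrt hd.le
  generalize √(κ - (μ / 2) ^ 2) = lam at hl hs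
  -- σ and ρ are the entries of the rotation generator, and λσρλ = −λ² must be (μ/2)² − κ; then τ =
  -- (λσ)⁻¹.
  obtain ⟨P, hP⟩ := exists_conj_kappaMuMap (lam := lam) (σ := -1) (ρ := 1)
    (τ := -lam⁻¹) (ε := ε) (μ := μ) hκ (by rcases hε with rfl | rfl <;> norm_num)
    (by field_simp) (by rw [← neg_sub, ← hs]; field_simp)
  exact ⟨_, _, P, hasDerivAt_rotationFlow, hl, hP⟩

theorem boostFlow_hasConjugateGenerator {κ μ ε : ℝ} (hκ : κ ≠ 0) (hε : ε = 1 ∨ ε = -1)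
    (h : κ < (μ / 2) ^ 2) : boostFlow.HasConjugateGenerator (kappaMuMap κ μ ε) := by
  have hd : 0 < (μ / 2) ^ 2 - κ := sub_pos.mpr h
  have hl : √((μ / 2) ^ 2 - κ) ≠ 0 := (Real.sqrt_pos.mpr hd).ne'
  have hs := Real.mul_self_sqrt hd.le
  generalize √((μ / 2) ^ 2 - κ) = lam at hl hs
  obtain ⟨P, hP⟩ := exists_conj_kappaMuMap (lam := lam) (σ := 1) (ρ := 1)
    (τ := lam⁻¹) (ε := ε) (μ := μ) hκ (by rcases hε with rfl | rfl <;> norm_num)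
    (by field_simp) (by rw [← hs]; field_simp)
  exact ⟨_, _, P, hasDerivAt_boostFlow, hl, hP⟩

theorem shearFlow_hasConjugateGenerator {κ μ ε : ℝ} (hκ : κ ≠ 0) (hε : ε = 1 ∨ ε = -1)
    (h : (μ / 2) ^ 2 = κ) : shearFlow.HasConjugateGenerator (kappaMuMap κ μ ε) := by
  -- Here D² = 0, so D is a nonzero nilpotent and no scaling is needed.
  obtain ⟨P, hP⟩ := exists_conj_kappaMuMap (lam := 1) (σ := 1) (ρ := 0)
    (τ := 1) (ε := ε) (μ := μ) hκ (by rcases hε with rfl | rfl <;> norm_num)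
    (by norm_num) (by rw [h]; ring)
  exact ⟨_, _, P, hasDerivAt_shearFlow, one_ne_zero, hP⟩

theorem sq_lt_of_invariantF {κ μ : ℝ}
    (h : 0 < invariantF κ μ ∧ invariantF κ μ < 1 ∨ invariantF κ μ = 0 ∧ 0 < κ) :
    (μ / 2) ^ 2 < κ := by
  have hs : (-μ / 2) ^ 2 = (μ / 2) ^ 2 := by ring
  rw [invariantF, hs] at h
  rcases h with ⟨h0, h1⟩ | ⟨h0, hκ⟩
  · have hκ : 0 < κ := by
      by_contra hκ
      exact h0.not_ge (div_nonpos_of_nonneg_of_nonpos (sq_nonneg _) (not_lt.mp hκ))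
    exact (div_lt_one hκ).mp h1
  · rwa [(div_eq_zero_iff.mp h0).resolve_right hκ.ne']

theorem lt_sq_of_invariantF {κ μ : ℝ}
    (h : invariantF κ μ < 0 ∨ 1 < invariantF κ μ ∨ invariantF κ μ = 0 ∧ κ < 0) :
    κ < (μ / 2) ^ 2 := by
  have hs : (-μ / 2) ^ 2 = (μ / 2) ^ 2 := by ring
  rw [invariantF, hs] at h
  by_cases hκ : κ < 0
  · exact hκ.trans_le (sq_nonneg _)
  have h0 : 0 ≤ (μ / 2) ^ 2 / κ := div_nonneg (sq_nonneg _) (not_lt.mp hκ)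
  rcases h with h | h | h
  · exact absurd h h0.not_gt
  -- At κ = 0 the quotient has the default value 0, which is not above 1.
  · have hκ' : 0 < κ := (not_lt.mp hκ).lt_of_ne' fun hz => by
      rw [hz, div_zero] at h
      exact absurd h (by norm_num)
    exact (one_lt_div hκ').mp h
  · exact absurd h.2 hκ

theorem sq_eq_of_invariantF {κ μ : ℝ} (hκ : κ ≠ 0) (h : invariantF κ μ = 1) :
    (μ / 2) ^ 2 = κ := by
  rw [invariantF, div_eq_one_iff_eq hκ] at h
  rw [← h]
  ring

theorem PlaneFlow.HasConjugateGenerator.exists_isLieGroupModel {A : PlaneFlow} {κ μ ε : ℝ}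
    (h : A.HasConjugateGenerator (kappaMuMap κ μ ε)) (hε : ε = 1 ∨ ε = -1) :
    ∃ S₀ : AlmostParacontactMetric (ℝ × (ℝ × ℝ)) (FlowGroup A), IsLieGroupModel S₀ κ μ ε := by
  obtain ⟨_, _, P, hA, hl, hPD⟩ := h
  exact ⟨_, PlaneFlow.isLieGroupModel_model hl P hε hA hPD⟩

theorem AlmostParacontactMetric.isLocallyModelledAt {E : Type*} [NormedAddCommGroup E]
    [NormedSpace ℝ E] [CompleteSpace E] {M : Type*} [TopologicalSpace M] [ChartedSpace E M]
    [IsManifold 𝓘(ℝ, E) ∞ M] {S : AlmostParacontactMetric E M} (hS : S.IsAlmostParacosymplectic)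
    {κ μ : ℝ} (hκμ : S.IsKappaMuSpace κ μ) (hκ : κ ≠ 0) {A : PlaneFlow}
    (h : ∀ {ε : ℝ}, (ε = 1 ∨ ε = -1) → A.HasConjugateGenerator (kappaMuMap κ μ ε)) (p : M) :
    IsLocallyModelledAt S A κ μ p := by
  obtain ⟨U, E₁, E₂, ε, b, hU, hp, hε, -, hF, hc, hb⟩ :=
    exists_hasCommutatorsOn hS hκμ p (Or.inl hκ)
  obtain ⟨_, _, P, hA, hl, hPD⟩ := h hε
  exact hc.isLocallyModelledAt hF hU hp (hb hκ) hε hA hl P hPD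

end PlaneFlows

end

theorem mainTheorem4 :
    -- the local Artin frame
    (∀ (M : Type*) [TopologicalSpace M] [T2Space M] [ChartedSpace (EuclideanSpace ℝ (Fin 3)) M]
      [IsManifold (𝓡 3) ∞ M] (S : AlmostParacontactMetric (EuclideanSpace ℝ (Fin 3)) M) (κ μ : ℝ),
      S.IsAlmostParacosymplectic → S.IsKappaMuSpace κ μ →
      ∀ p : M, (κ ≠ 0 ∨ S.HasNonzeroHOnPlusAt p) →
        ∃ (U : Set M) (E₁ E₂ : Π x : M, TangentSpace (𝓡 3) x) (ε : ℝ) (b : M → ℝ),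
          IsOpen U ∧ p ∈ U ∧ (ε = 1 ∨ ε = -1) ∧ ContMDiffOn (𝓡 3) 𝓘(ℝ, ℝ) ∞ b U ∧
          S.IsArtinFrameOn E₁ E₂ U ∧ S.HasCommutatorsOn E₁ E₂ U κ μ ε b ∧
          (κ ≠ 0 → ∀ q ∈ U, b q = 0)) ∧
    -- for `κ ≠ 0`, the space is locally isomorphic to a Lie group with a left-invariant structure
    (∀ (M : Type*) [TopologicalSpace M] [T2Space M] [ChartedSpace (EuclideanSpace ℝ (Fin 3)) M]
      [IsManifold (𝓡 3) ∞ M] (S : AlmostParacontactMetric (EuclideanSpace ℝ (Fin 3)) M) (κ μ : ℝ),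
      S.IsAlmostParacosymplectic → S.IsKappaMuSpace κ μ → κ ≠ 0 → ∀ p : M,
        ((0 < invariantF κ μ ∧ invariantF κ μ < 1 ∨ invariantF κ μ = 0 ∧ 0 < κ) →
          IsLocallyModelledAt S rotationFlow κ μ p) ∧
        ((invariantF κ μ < 0 ∨ 1 < invariantF κ μ ∨ invariantF κ μ = 0 ∧ κ < 0) →
          IsLocallyModelledAt S boostFlow κ μ p) ∧
        (invariantF κ μ = 1 → IsLocallyModelledAt S shearFlow κ μ p)) ∧
    -- for `κ ≠ 0`, these Lie groups do carry such left-invariant structures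
    (∀ κ μ ε : ℝ, κ ≠ 0 → (ε = 1 ∨ ε = -1) →
        ((0 < invariantF κ μ ∧ invariantF κ μ < 1 ∨ invariantF κ μ = 0 ∧ 0 < κ) →
          ∃ S₀ : AlmostParacontactMetric (ℝ × (ℝ × ℝ)) EuclideanMotionGroup,
            IsLieGroupModel S₀ κ μ ε) ∧
        ((invariantF κ μ < 0 ∨ 1 < invariantF κ μ ∨ invariantF κ μ = 0 ∧ κ < 0) →
          ∃ S₀ : AlmostParacontactMetric (ℝ × (ℝ × ℝ)) MinkowskiMotionGroup,
            IsLieGroupModel S₀ κ μ ε) ∧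
        (invariantF κ μ = 1 →
          ∃ S₀ : AlmostParacontactMetric (ℝ × (ℝ × ℝ)) HeisenbergLieGroup,
            IsLieGroupModel S₀ κ μ ε)) := by
  refine ⟨fun M _ _ _ _ S κ μ hS hκμ p h =>
    AlmostParacontactMetric.exists_hasCommutatorsOn hS hκμ p h,
    fun M _ _ _ _ S κ μ hS hκμ hκ p => ⟨fun hF => ?_, fun hF => ?_, fun hF => ?_⟩,
    fun κ μ ε hκ hε => ⟨fun hF => ?_, fun hF => ?_, fun hF => ?_⟩⟩
  · exact AlmostParacontactMetric.isLocallyModelledAt hS hκμ hκ (fun hε =>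
      rotationFlow_hasConjugateGenerator hκ hε (sq_lt_of_invariantF hF)) p
  · exact AlmostParacontactMetric.isLocallyModelledAt hS hκμ hκ (fun hε =>
      boostFlow_hasConjugateGenerator hκ hε (lt_sq_of_invariantF hF)) p
  · exact AlmostParacontactMetric.isLocallyModelledAt hS hκμ hκ (fun hε =>
      shearFlow_hasConjugateGenerator hκ hε (sq_eq_of_invariantF hκ hF)) p
  · exact (rotationFlow_hasConjugateGenerator hκ hε
      (sq_lt_of_invariantF hF)).exists_isLieGroupModel hε
  · exact (boostFlow_hasConjugateGenerator hκ hε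
      (lt_sq_of_invariantF hF)).exists_isLieGroupModel hε
  · exact (shearFlow_hasConjugateGenerator hκ hε
      (sq_eq_of_invariantF hκ hF)).exists_isLieGroupModel hε
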